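/- **Theorem 2.2.** Let $B:\mathbb{R}^2\to\mathbb{R}$ satisfy $B\in L^p_{\rm loc}(\mathbb{R}^2)$ for some $p>2$ and $|B(x)|=\mathcal{O}(|x|^{-\tau})$ as $|x|\to\infty$ for some $\tau>2$. Let $$\alpha=\frac1{2\pi}\int_{\mathbb{R}^2}B\,dx,\qquad \mu_\alpha=\min_{m\in\mathbb{Z}}|m-\alpha|,\qquad h(x)=-\frac1{2\pi}\int_{\mathbb{R}^2}B(y)\log|x-y|\,dy ,$$ and suppose that $0<\alpha\notin\mathbb{Z}$. For $\rho>0$ let $g_+(\rho;r)=1$ if $r\le\rho$ and $g_+(\rho;r)=\rho^{-\alpha}r^{\alpha}$ if $r>\rho$, and put $$k_+(\rho)=\inf_{x\in\mathbb{R}^2}\frac{e^{-h(x)}}{g_+(\rho;|x|)},\qquad K_+(\rho)=\sup_{x\in\mathbb{R}^2}\frac{e^{-h(x)}}{g_+(\rho;|x|)},\qquad \beta_+(B;\rho)=\Big(\frac{k_+(\rho)}{K_+(\rho)}\Big)^2 .$$ Let $A\in L^\infty(\mathbb{R}^2;\mathbb{R}^2)$ be such that $\nabla\times A=\partial_1A_2-\partial_2A_1=B$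 in the sense of distributions, and for $u\in H^1(\mathbb{R}^2)$ (complex valued) let $$Q_+[u]=\int_{\mathbb{R}^2}\big(|(i\nabla+A)u|^2+B|u|^2\big)\,dx .$$ Then the integral defining $h(x)$ converges absolutely for every $x\in\mathbb{R}^2$, and, for all $\rho>0$, $0<k_+(\rho)\le K_+(\rho)<\infty$. Moreover, for all $\rho>0$ and all $u\in H^1(\mathbb{R}^2)$, the integrals in the following inequality converge absolutely and $$Q_+[u]\;\ge\;\mu_\alpha^2\,\beta_+(B;\rho)\int_{\mathbb{R}^2}\frac{|u(x)|^2}{\rho^2+|x|^2}\,dx .$$ -/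

import Mathlib

open MeasureTheory
open scoped ENNReal ContDiff

namespace PauliHardy

/-- The Euclidean plane `ℝ²`, with the Euclidean norm and Lebesgue measure `volume`. -/
abbrev Plane : Type := EuclideanSpace ℝ (Fin 2)

/-- The (classical) partial derivative of a real function on the plane. -/
noncomputable def partialDeriv (i : Fin 2) (φ : Plane → ℝ) (x : Plane) : ℝ :=
  fderiv ℝ φ x (EuclideanSpace.single i (1 : ℝ))

/-- Real valued test functions, the elements of `C₀^∞(ℝ²)`. Testing against these is the same as
testing against complex valued test functions, by linearity. -/
def IsTestFunction (φ : Plane → ℝ) : Prop :=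
  ContDiff ℝ ∞ φ ∧ HasCompactSupport φ

/-- `u ∈ H¹(ℝ²)` (complex valued), with weak partial derivatives `Du 0 = ∂₁u` and `Du 1 = ∂₂u`:
the function `u` and its distributional partial derivatives are square integrable. The family `Du`
is determined by `u` up to equality almost everywhere. -/
structure HasH1Gradient (u : Plane → ℂ) (Du : Fin 2 → Plane → ℂ) : Prop where
  memLp : MemLp u 2 volume
  memLp_grad : ∀ i, MemLp (Du i) 2 volume
  weak_deriv : ∀ i, ∀ φ : Plane → ℝ, IsTestFunction φ →
    ∫ x, (partialDeriv i φ x : ℂ) * u x = - ∫ x, (φ x : ℂ) * Du i x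

/-- `∇ × A = ∂₁A₂ - ∂₂A₁ = B` in the sense of distributions. -/
def HasDistribCurl (A : Plane → Plane) (B : Plane → ℝ) : Prop :=
  ∀ φ : Plane → ℝ, IsTestFunction φ →
    ∫ x, (A x 0 * partialDeriv 1 φ x - A x 1 * partialDeriv 0 φ x) = ∫ x, B x * φ x

/-- The standing assumption on the magnetic field: `B ∈ L^p_loc(ℝ²)` for some `p > 2`, and
`|B(x)| = O(|x|^{-τ})` as `|x| → ∞` for some `τ > 2` (almost everywhere, as `B` is a class of
functions modulo null sets). -/
def FieldAssumption (B : Plane → ℝ) : Prop :=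
  (∃ p : ℝ≥0∞, 2 < p ∧ ∀ K : Set Plane, IsCompact K → MemLp B p (volume.restrict K)) ∧
  (∃ τ : ℝ, 2 < τ ∧ ∃ C R : ℝ, 0 < R ∧
    ∀ᵐ x : Plane, R ≤ ‖x‖ → |B x| ≤ C * ‖x‖ ^ (-τ))

/-- The normalized flux `α = (2π)⁻¹ ∫ B`. -/
noncomputable def flux (B : Plane → ℝ) : ℝ :=
  1 / (2 * Real.pi) * ∫ x, B x

/-- `μ_α = min_{m ∈ ℤ} |m - α|`, the distance from `α` to the integers. -/
noncomputable def distInt (α : ℝ) : ℝ :=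
  ⨅ m : ℤ, |(m : ℝ) - α|

/-- The logarithmic potential `h(x) = -(2π)⁻¹ ∫ B(y) log |x - y| dy`. -/
noncomputable def logPotential (B : Plane → ℝ) (x : Plane) : ℝ :=
  -(1 / (2 * Real.pi)) * ∫ y, B y * Real.log ‖x - y‖

/-- `g₊(ρ; r)`, equal to `1` for `r ≤ ρ` and to `ρ^{-α} r^α` for `r > ρ`. -/
noncomputable def gPlus (α ρ r : ℝ) : ℝ :=
  if r ≤ ρ then 1 else ρ ^ (-α) * r ^ α

/-- The quotient `e^{-h(x)} / g₊(ρ; |x|)`. -/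
noncomputable def ratioPlus (B : Plane → ℝ) (ρ : ℝ) (x : Plane) : ℝ :=
  Real.exp (-logPotential B x) / gPlus (flux B) ρ ‖x‖

/-- `k₊(ρ) = inf_x e^{-h(x)} / g₊(ρ; |x|)`. -/
noncomputable def kPlus (B : Plane → ℝ) (ρ : ℝ) : ℝ :=
  ⨅ x : Plane, ratioPlus B ρ x

/-- `K₊(ρ) = sup_x e^{-h(x)} / g₊(ρ; |x|)`. -/
noncomputable def KPlus (B : Plane → ℝ) (ρ : ℝ) : ℝ :=
  ⨆ x : Plane, ratioPlus B ρ x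

/-- `β₊(B; ρ) = (k₊(ρ) / K₊(ρ))²`. -/
noncomputable def betaPlus (B : Plane → ℝ) (ρ : ℝ) : ℝ :=
  (kPlus B ρ / KPlus B ρ) ^ 2

/-- The density `|(i∇ + A)u|² + B |u|²` of the spin-up Pauli form, for `u` with weak partial
derivatives `Du`. -/
noncomputable def pauliPlusDensity (A : Plane → Plane) (B : Plane → ℝ)
    (u : Plane → ℂ) (Du : Fin 2 → Plane → ℂ) (x : Plane) : ℝ :=
  (∑ j : Fin 2, ‖Complex.I * Du j x + (A x j : ℂ) * u x‖ ^ 2) + B x * ‖u x‖ ^ 2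

/-- The spin-up Pauli form `Q₊[u] = ∫ (|(i∇ + A)u|² + B |u|²) dx`. -/
noncomputable def pauliPlusForm (A : Plane → Plane) (B : Plane → ℝ)
    (u : Plane → ℂ) (Du : Fin 2 → Plane → ℂ) : ℝ :=
  ∫ x, pauliPlusDensity A B u Du x

end PauliHardy

namespace PauliHardy

/-! The spin-up form is a perfect square. With `D = (i∂₁ + A₁) - i(i∂₂ + A₂)` one has `Q₊[u] = ∫
|Du|²` for smooth compactly supported `u` (`pauliPlusForm_eq`): the cross terms are `A · ∇^⊥|u|²`,
where `∇^⊥ = (∂₂, -∂₁)`, which integrates to `∫ B|u|²`, and a Jacobian, which integrates to zero.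

Since `-Δh = B`, the potential `A` is `∇^⊥h + ∇χ` for some gauge `χ`, and then `D = i e^{-w} (∂₁ -
i∂₂) e^w` with `w = h - iχ` (`hardy_dbarOp`). Because `h(x) = -α log(1+|x|) + O(1)`, the function
`e^{-h}` is comparable with `g₊`, with optimal constants `k₊` and `K₊`. Exchanging `e^{-2h}` for
`g₊²` once on each side costs exactly the factor `β₊`. What remains is a Hardy inequality for `∂₁ -
i∂₂` with the radial weight `g₊²` (`hardy_smooth`, `hardy_polar`).

In polar coordinates `|(∂₁ - i∂₂)v| = |∂_r v - (i/r)∂_θ v|`. The square integrated over a circle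
consists of radial energy, angular energy and the radial derivative of the angular momentum `J`.
Outside the disc of radius `ρ` the weight `r^{2α}` turns this into an exact derivative plus `∫
|-i∂_θ v - αv|²`, and the spectral gap of that operator on the circle is `μ_α`
(`distInt_sq_mul_integral_le`). Inside the disc there is no such gap, and an explicit subsolution of
a Riccati equation is used instead. The two boundary terms `J(ρ)` cancel, and the other boundary
terms add up to `(α - μ_α/2) ∫ |v(ρ,θ)|² dθ ≥ 0`.

Two approximations remove the smoothness. Mollifying `A` and `h` with the same kernel preserves the
relation between them exactly, and perturbs the comparison with `g₊` only slightly because `log g₊`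
is Lipschitz (`hardy_dbarOp_rough`). Smooth compactly supported functions are dense in `H¹`, and
`Q₊` passes to the limit because `A` is bounded and a field in `L²` is form bounded in two
dimensions (`hardy_pauliPlusForm`). -/

/-! ### Distance to the integers and the spectral gap on the circle -/

lemma distInt_le (α : ℝ) (m : ℤ) : distInt α ≤ |(m : ℝ) - α| :=
  ciInf_le ⟨0, by rintro _ ⟨m, rfl⟩; exact abs_nonneg _⟩ m

lemma distInt_nonneg (α : ℝ) : 0 ≤ distInt α :=
  Real.iInf_nonneg fun _ => abs_nonneg _

/-- Needed for the Riccati inequality on the inner disc in `hardy_polar`; `distInt_le_abs` gives the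
sign of the boundary term there. -/
lemma distInt_le_half (α : ℝ) : distInt α ≤ 1 / 2 :=
  (distInt_le α (round α)).trans (by rw [abs_sub_comm]; exact abs_sub_round α)

lemma distInt_le_abs (α : ℝ) : distInt α ≤ |α| := by
  simpa using distInt_le α 0

/-- The spectrum of `-i d/dθ - α` on the circle stays at distance `distInt α` from zero. -/
lemma distInt_sq_mul_integral_le {f f' : ℝ → ℂ} (hf : ∀ θ, HasDerivAt f (f' θ) θ)
    (hf' : Continuous f') (hper : f Real.pi = f (-Real.pi)) (α : ℝ) :
    distInt α ^ 2 * ∫ θ in (-Real.pi)..Real.pi, ‖f θ‖ ^ 2 ≤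
      ∫ θ in (-Real.pi)..Real.pi, ‖-Complex.I * f' θ - α * f θ‖ ^ 2 := by
  have hpi : -Real.pi < Real.pi := by linarith [Real.pi_pos]
  have hfc : Continuous f := continuous_iff_continuousAt.2 fun θ => (hf θ).continuousAt
  have mem : ∀ {k : ℝ → ℂ}, Continuous k →
      MemLp k 2 (volume.restrict (Set.Ioc (-Real.pi) Real.pi)) := fun {k} hk =>
    by
    obtain ⟨C, hC⟩ := isCompact_Icc.exists_bound_of_continuousOn (s := Set.Icc (-Real.pi) Real.pi)
      hk.continuousOn
    exact MemLp.of_bound hk.aestronglyMeasurable C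
      ((ae_restrict_mem measurableSet_Ioc).mono fun θ hθ => hC θ (Set.Ioc_subset_Icc_self hθ))
  set G : ℝ → ℂ := fun θ => -Complex.I * f' θ - α * f θ with hG
  have hGc : Continuous G := by fun_prop
  -- Parseval for `f` and for `G = -i f' - α f`. The `n`-th coefficient of `G` is `n - α` times that
  -- of `f`, so the inequality holds term by term.
  have h1 := hasSum_sq_fourierCoeffOn hpi (mem hfc)
  have h2 := hasSum_sq_fourierCoeffOn hpi (mem hGc)
  have hcoef' : ∀ n : ℤ, fourierCoeffOn hpi f' n = Complex.I * n * fourierCoeffOn hpi f n := by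
    intro n
    have hpi0 : (Real.pi : ℂ) ≠ 0 := by exact_mod_cast Real.pi_ne_zero
    -- The formula for the coefficients of a derivative divides by `n`, so `n = 0` is treated by the
    -- fundamental theorem of calculus.
    rcases eq_or_ne n 0 with rfl | hn
    · have : ∫ θ in (-Real.pi)..Real.pi, f' θ = 0 := by
        rw [intervalIntegral.integral_eq_sub_of_hasDerivAt (fun θ _ => hf θ)
          (hf'.intervalIntegrable _ _), hper, sub_self]
      simp [fourierCoeffOn_eq_integral, this]
    · have h := fourierCoeffOn_of_hasDerivAt hpi hn (fun θ _ => hf θ)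
        (hf'.intervalIntegrable _ _)
      rw [h, hper]
      have hn' : (n : ℂ) ≠ 0 := by exact_mod_cast hn
      push_cast
      field_simp
      ring
  have hcoef : ∀ n : ℤ, fourierCoeffOn hpi G n = ((n : ℝ) - α : ℝ) * fourierCoeffOn hpi f n := by
    intro n
    have : fourierCoeffOn hpi G n =
        -Complex.I * fourierCoeffOn hpi f' n - α * fourierCoeffOn hpi f n := by
      have hfou : Continuous fun x : ℝ => (fourier (-n) (x : AddCircle (Real.pi - -Real.pi))) :=
        (map_continuous (fourier (-n))).comp (AddCircle.continuous_mk' _)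
      have hint : ∫ θ in (-Real.pi)..Real.pi, fourier (-n) (θ : AddCircle (Real.pi - -Real.pi)) *
            (-Complex.I * f' θ - α * f θ) =
          -Complex.I * (∫ θ in (-Real.pi)..Real.pi,
            fourier (-n) (θ : AddCircle (Real.pi - -Real.pi)) * f' θ) -
          α * ∫ θ in (-Real.pi)..Real.pi,
            fourier (-n) (θ : AddCircle (Real.pi - -Real.pi)) * f θ := by
        rw [← intervalIntegral.integral_const_mul (-Complex.I),
          ← intervalIntegral.integral_const_mul (α : ℂ), ← intervalIntegral.integral_sub
            (Continuous.intervalIntegrable (by fun_prop) _ _)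
            (Continuous.intervalIntegrable (by fun_prop) _ _)]
        refine intervalIntegral.integral_congr fun θ _ => ?_
        ring
      simp only [fourierCoeffOn_eq_integral, hG, smul_eq_mul, Complex.real_smul, hint]
      ring
    rw [this, hcoef']
    push_cast
    linear_combination (-(n : ℂ) * fourierCoeffOn hpi f n) * Complex.I_sq
  have hle : distInt α ^ 2 * ((Real.pi - -Real.pi)⁻¹ • ∫ θ in (-Real.pi)..Real.pi, ‖f θ‖ ^ 2) ≤
      (Real.pi - -Real.pi)⁻¹ • ∫ θ in (-Real.pi)..Real.pi, ‖G θ‖ ^ 2 := by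
    refine hasSum_le (fun n => ?_) (h1.mul_left _) h2
    rw [hcoef, norm_mul, mul_pow, Complex.norm_real, Real.norm_eq_abs]
    gcongr
    · exact distInt_nonneg α
    · exact distInt_le α n
  simp only [smul_eq_mul] at hle
  have h0 : 0 < (Real.pi - -Real.pi)⁻¹ := by
    apply inv_pos.2; linarith [Real.pi_pos]
  rw [mul_left_comm] at hle
  exact le_of_mul_le_mul_left hle h0

/-! ### Polar coordinates and integrals over circles -/

/-- The point with polar coordinates `(r, θ)`. -/
noncomputable def polarPt (r θ : ℝ) : Plane := !₂[r * Real.cos θ, r * Real.sin θ]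

lemma contDiff_polarPt {n : WithTop ℕ∞} : ContDiff ℝ n (fun p : ℝ × ℝ => polarPt p.1 p.2) := by
  rw [contDiff_euclidean]
  intro i
  fin_cases i
  · simp only [polarPt]
    exact contDiff_fst.mul (Real.contDiff_cos.comp contDiff_snd)
  · simp only [polarPt]
    exact contDiff_fst.mul (Real.contDiff_sin.comp contDiff_snd)

lemma continuous_polarPt : Continuous (fun p : ℝ × ℝ => polarPt p.1 p.2) :=
  (contDiff_polarPt (n := 0)).continuous

lemma norm_polarPt (r θ : ℝ) : ‖polarPt r θ‖ = |r| := by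
  rw [EuclideanSpace.norm_eq, ← Real.sqrt_sq_eq_abs]
  congr 1
  simp only [polarPt, Fin.sum_univ_two, Real.norm_eq_abs, sq_abs, PiLp.toLp_apply,
    Matrix.cons_val_zero, Matrix.cons_val_one]
  linear_combination r ^ 2 * Real.sin_sq_add_cos_sq θ

lemma polarPt_zero (θ : ℝ) : polarPt 0 θ = 0 := by
  rw [← norm_eq_zero, norm_polarPt, abs_zero]

lemma integral_plane_eq (f : Plane → ℝ) :
    ∫ x, f x = ∫ p : ℝ × ℝ, f !₂[p.1, p.2] := by
  rw [← ((EuclideanSpace.volume_preserving_symm_measurableEquiv_toLp (Fin 2)).symm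
    (MeasurableEquiv.toLp 2 (Fin 2 → ℝ)).symm).integral_comp'  f,
    ← ((volume_preserving_finTwoArrow ℝ).symm
      MeasurableEquiv.finTwoArrow).integral_comp']
  rfl

lemma integral_eq_polar {f : Plane → ℝ} (hf : Continuous f) {R : ℝ} (hR : 0 ≤ R)
    (hfR : ∀ x, R ≤ ‖x‖ → f x = 0) :
    ∫ x, f x = ∫ r in (0 : ℝ)..R, r * ∫ θ in (-Real.pi)..Real.pi, f (polarPt r θ) := by
  have hpi : -Real.pi ≤ Real.pi := by linarith [Real.pi_pos]
  have hcont : Continuous fun p : ℝ × ℝ => p.1 * f (polarPt p.1 p.2) :=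
    continuous_fst.mul (hf.comp continuous_polarPt)
  have h1 : ∫ x, f x = ∫ p in polarCoord.target, p.1 * f (polarPt p.1 p.2) := by
    rw [integral_plane_eq, ← integral_comp_polarCoord_symm]
    rfl
  have h2 : ∫ p in polarCoord.target, p.1 * f (polarPt p.1 p.2) =
      ∫ p in Set.Ioc 0 R ×ˢ Set.Ioc (-Real.pi) Real.pi, p.1 * f (polarPt p.1 p.2) := by
    -- The polar chart omits the ray `θ = π`, which is a null set.
    have hae : (Set.Ioc 0 R ×ˢ Set.Ioo (-Real.pi) Real.pi : Set (ℝ × ℝ)) =ᵐ[volume]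
        (Set.Ioc 0 R ×ˢ Set.Ioc (-Real.pi) Real.pi : Set (ℝ × ℝ)) :=
      Measure.set_prod_ae_eq (ae_eq_refl _) Ioo_ae_eq_Ioc
    rw [← setIntegral_congr_set hae, polarCoord_target]
    refine (setIntegral_eq_of_subset_of_forall_sdiff_eq_zero
      (measurableSet_Ioi.prod measurableSet_Ioo)
      (Set.prod_mono Set.Ioc_subset_Ioi_self le_rfl) ?_)
    rintro ⟨r, θ⟩ ⟨⟨h0, hθ⟩, h⟩
    simp only [Set.mem_Ioi] at h0
    have : R ≤ r := by
      by_contra! hlt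
      exact h ⟨⟨h0, hlt.le⟩, hθ⟩
    rw [hfR, mul_zero]
    rw [norm_polarPt]
    exact this.trans (le_abs_self r)
  have hint : IntegrableOn (fun p : ℝ × ℝ => p.1 * f (polarPt p.1 p.2))
      (Set.Ioc 0 R ×ˢ Set.Ioc (-Real.pi) Real.pi) :=
    (hcont.continuousOn.integrableOn_compact (isCompact_Icc.prod isCompact_Icc)).mono_set
      (Set.prod_mono Set.Ioc_subset_Icc_self Set.Ioc_subset_Icc_self)
  rw [h1, h2, Measure.volume_eq_prod, setIntegral_prod _ hint, intervalIntegral.integral_of_le hR]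
  refine setIntegral_congr_fun measurableSet_Ioc fun r _ => ?_
  rw [intervalIntegral.integral_of_le hpi, integral_const_mul]

/-- Differentiation under an integral over a compact interval. -/
lemma hasDerivAt_intervalIntegral_param {E : Type*} [NormedAddCommGroup E] [NormedSpace ℝ E]
    [CompleteSpace E] {F F' : ℝ → ℝ → E} {a b : ℝ}
    (hF : Continuous (Function.uncurry F)) (hF' : Continuous (Function.uncurry F'))
    (hd : ∀ r θ, HasDerivAt (fun s => F s θ) (F' r θ) r) (r : ℝ) :
    HasDerivAt (fun s => ∫ θ in a..b, F s θ) (∫ θ in a..b, F' r θ) r := by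
  have hc : ∀ s, Continuous (F s) := fun s => hF.comp (by fun_prop : Continuous fun θ => (s, θ))
  have hc' : ∀ s, Continuous (F' s) := fun s => hF'.comp (by fun_prop : Continuous fun θ => (s, θ))
  obtain ⟨C, hC⟩ := ((isCompact_closedBall r 1).prod (isCompact_uIcc (a := a) (b := b))
    ).exists_bound_of_continuousOn hF'.continuousOn
  refine (intervalIntegral.hasDerivAt_integral_of_dominated_loc_of_deriv_le
    (bound := fun _ => C) (Metric.closedBall_mem_nhds r one_pos)
    (.of_forall fun s => (hc s).aestronglyMeasurable) ((hc r).intervalIntegrable _ _)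
    (hc' r).aestronglyMeasurable (.of_forall fun θ hθ s hs => ?_) (by simp)
    (.of_forall fun θ _ s _ => hd s θ)).2
  exact hC (s, θ) ⟨hs, Set.uIoc_subset_uIcc hθ⟩

lemma continuous_intervalIntegral_param {E : Type*} [NormedAddCommGroup E] [NormedSpace ℝ E]
    {F : ℝ → ℝ → E} {a b : ℝ} (hF : Continuous (Function.uncurry F)) :
    Continuous (fun s => ∫ θ in a..b, F s θ) :=
  intervalIntegral.continuous_parametric_intervalIntegral_of_continuous' hF a b

lemma hasDerivAt_clm_apply_comp {E F : Type*} [NormedAddCommGroup E] [NormedSpace ℝ E]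
    [NormedAddCommGroup F] [NormedSpace ℝ F] {D : E → E →L[ℝ] F} {D' : E →L[ℝ] E →L[ℝ] F}
    {γ : ℝ → E} {γ' : E} {t : ℝ} (hD : HasFDerivAt D D' (γ t)) (hγ : HasDerivAt γ γ' t) (v : E) :
    HasDerivAt (fun s => D (γ s) v) (D' γ' v) t :=
  ((ContinuousLinearMap.apply ℝ F v).hasFDerivAt.comp_hasDerivAt t (hD.comp_hasDerivAt t hγ))

/-- Angular integral of the radial derivative of `|W|²`, angular momentum of `W` and its radial
derivative, for a function `W` in polar coordinates that is periodic in the angle. -/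
lemma hasDerivAt_angular {W : ℝ × ℝ → ℂ} (hW : ContDiff ℝ 2 W)
    (hper : ∀ r, W (r, Real.pi) = W (r, -Real.pi)) (r : ℝ) :
    HasDerivAt (fun s => ∫ θ in (-Real.pi)..Real.pi, ‖W (s, θ)‖ ^ 2)
      (∫ θ in (-Real.pi)..Real.pi,
        2 * (star (W (r, θ)) * fderiv ℝ W (r, θ) (1, 0)).re) r ∧
    HasDerivAt (fun s => ∫ θ in (-Real.pi)..Real.pi,
        (star (W (s, θ)) * (-Complex.I * fderiv ℝ W (s, θ) (0, 1))).re)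
      (∫ θ in (-Real.pi)..Real.pi,
        2 * (star (fderiv ℝ W (r, θ) (1, 0)) *
          (-Complex.I * fderiv ℝ W (r, θ) (0, 1))).re) r := by
  have hWc : Continuous W := hW.continuous
  have hD : ContDiff ℝ 1 (fderiv ℝ W) := hW.fderiv_right (by norm_num)
  have hDc : Continuous (fderiv ℝ W) := hD.continuous
  have hDDc : Continuous (fderiv ℝ (fderiv ℝ W)) := hD.continuous_fderiv one_ne_zero
  have hWd : ∀ p, HasFDerivAt W (fderiv ℝ W p) p := fun p =>
    (hW.differentiable (by norm_num) p).hasFDerivAt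
  have hDd : ∀ p, HasFDerivAt (fderiv ℝ W) (fderiv ℝ (fderiv ℝ W) p) p := fun p =>
    (hD.differentiable (by norm_num) p).hasFDerivAt
  have l1 : ∀ r θ : ℝ, HasDerivAt (fun s : ℝ => (s, θ)) ((1 : ℝ), (0 : ℝ)) r := fun r θ =>
    (hasDerivAt_id r).prodMk (hasDerivAt_const r θ)
  have l2 : ∀ r θ : ℝ, HasDerivAt (fun s : ℝ => (r, s)) ((0 : ℝ), (1 : ℝ)) θ := fun r θ =>
    (hasDerivAt_const θ r).prodMk (hasDerivAt_id θ)
  have d1 : ∀ r θ : ℝ, HasDerivAt (fun s => W (s, θ)) (fderiv ℝ W (r, θ) (1, 0)) r := fun r θ =>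
    (hWd (r, θ)).comp_hasDerivAt r (l1 r θ)
  have d2 : ∀ r θ : ℝ, HasDerivAt (fun s => W (r, s)) (fderiv ℝ W (r, θ) (0, 1)) θ := fun r θ =>
    (hWd (r, θ)).comp_hasDerivAt θ (l2 r θ)
  have d12 : ∀ r θ : ℝ, HasDerivAt (fun s => fderiv ℝ W (s, θ) (0, 1))
      (fderiv ℝ (fderiv ℝ W) (r, θ) (1, 0) (0, 1)) r := fun r θ =>
    hasDerivAt_clm_apply_comp (γ := fun s => (s, θ)) (hDd (r, θ)) (l1 r θ) _
  have d21 : ∀ r θ : ℝ, HasDerivAt (fun s => fderiv ℝ W (r, s) (1, 0))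
      (fderiv ℝ (fderiv ℝ W) (r, θ) (1, 0) (0, 1)) θ := fun r θ => by
    have hsymm : fderiv ℝ (fderiv ℝ W) (r, θ) (1, 0) (0, 1) =
        fderiv ℝ (fderiv ℝ W) (r, θ) (0, 1) (1, 0) :=
      (hW.contDiffAt.isSymmSndFDerivAt (by simp)).eq _ _
    rw [hsymm]
    exact hasDerivAt_clm_apply_comp (γ := fun s => (r, s)) (hDd (r, θ)) (l2 r θ) _
  have reD : ∀ {f : ℝ → ℂ} {f' : ℂ} {t : ℝ}, HasDerivAt f f' t →
      HasDerivAt (fun s => (f s).re) f'.re t := fun h =>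
    Complex.reCLM.hasFDerivAt.comp_hasDerivAt _ h
  refine ⟨?_, ?_⟩
  · refine hasDerivAt_intervalIntegral_param (F := fun s θ => ‖W (s, θ)‖ ^ 2)
      (F' := fun r θ => 2 * (star (W (r, θ)) * fderiv ℝ W (r, θ) (1, 0)).re)
      ?_ ?_ (fun r θ => ?_) r
    · simp only [Function.uncurry_def]; fun_prop
    · simp only [Function.uncurry_def]; fun_prop
    · have := reD ((d1 r θ).star.mul (d1 r θ))
      refine this.congr_deriv ?_ |>.congr_of_eventuallyEq (.of_forall fun s => ?_)
      · simp
        ring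
      · simp only [Pi.mul_apply, ← Complex.normSq_eq_norm_sq, Complex.normSq_apply]
        simp
  · have h1 := hasDerivAt_intervalIntegral_param (a := -Real.pi) (b := Real.pi)
      (F := fun s θ => (star (W (s, θ)) * (-Complex.I * fderiv ℝ W (s, θ) (0, 1))).re)
      (F' := fun r θ => (star (fderiv ℝ W (r, θ) (1, 0)) *
          (-Complex.I * fderiv ℝ W (r, θ) (0, 1))).re +
          (star (W (r, θ)) * (-Complex.I * fderiv ℝ (fderiv ℝ W) (r, θ) (1, 0) (0, 1))).re)
      (by simp only [Function.uncurry_def]; fun_prop)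
      (by simp only [Function.uncurry_def]; fun_prop) (fun r θ => by
        simpa using reD ((d1 r θ).star.mul ((d12 r θ).const_mul (-Complex.I)))) r
    -- Integration by parts in the angle: this is the integral of the `θ`-derivative of `Re (W̄ (-i
    -- ∂_r W))` over a full period. Subtracting it eliminates the mixed second derivative, and the
    -- two remaining terms coincide because `Re (b̄ (-i a)) = -Re (ā (-i b))`.
    have h2 : ∫ θ in (-Real.pi)..Real.pi, ((star (fderiv ℝ W (r, θ) (0, 1)) *
          (-Complex.I * fderiv ℝ W (r, θ) (1, 0))).re +
          (star (W (r, θ)) * (-Complex.I * fderiv ℝ (fderiv ℝ W) (r, θ) (1, 0) (0, 1))).re)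
          = 0 := by
      rw [intervalIntegral.integral_eq_sub_of_hasDerivAt
        (f := fun θ => (star (W (r, θ)) * (-Complex.I * fderiv ℝ W (r, θ) (1, 0))).re)]
      · have : fderiv ℝ W (r, Real.pi) (1, 0) = fderiv ℝ W (r, -Real.pi) (1, 0) :=
          (d1 r Real.pi).unique ((d1 r (-Real.pi)).congr_of_eventuallyEq
            (.of_forall fun s => hper s))
        simp [this, hper]
      · intro θ _
        simpa using reD ((d2 r θ).star.mul ((d21 r θ).const_mul (-Complex.I)))
      · exact Continuous.intervalIntegrable (by fun_prop) _ _
    refine h1.congr_deriv ((sub_zero _).symm.trans ?_)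
    refine (congrArg _ h2.symm).trans ?_
    rw [← intervalIntegral.integral_sub
      (Continuous.intervalIntegrable (by fun_prop) _ _)
      (Continuous.intervalIntegrable (by fun_prop) _ _)]
    refine intervalIntegral.integral_congr fun θ _ => ?_
    simp
    ring

/-! ### The weight `g₊` and the weighted Hardy inequality in polar coordinates -/

lemma gPlus_of_le {α ρ r : ℝ} (h : r ≤ ρ) : gPlus α ρ r = 1 := if_pos h

lemma gPlus_of_ge {α ρ r : ℝ} (hρ : 0 < ρ) (h : ρ ≤ r) : gPlus α ρ r = ρ ^ (-α) * r ^ α := by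
  rcases h.eq_or_lt with rfl | h
  · rw [gPlus_of_le le_rfl, ← Real.rpow_add hρ, neg_add_cancel, Real.rpow_zero]
  · exact if_neg h.not_ge

/-- A formula without cases, from which continuity, positivity and the Lipschitz bound for `log g₊`
are read off. -/
lemma gPlus_eq {α ρ r : ℝ} (hρ : 0 < ρ) : gPlus α ρ r = ρ ^ (-α) * (max ρ r) ^ α := by
  rcases le_total r ρ with h | h
  · rw [gPlus_of_le h, max_eq_left h, ← gPlus_of_ge hρ le_rfl, gPlus_of_le le_rfl]
  · rw [gPlus_of_ge hρ h, max_eq_right h]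

lemma gPlus_pos {α ρ r : ℝ} (hρ : 0 < ρ) : 0 < gPlus α ρ r := by
  rw [gPlus_eq hρ]
  have : 0 < max ρ r := lt_max_of_lt_left hρ
  positivity

lemma continuous_gPlus {α ρ : ℝ} (hρ : 0 < ρ) : Continuous (gPlus α ρ) := by
  have : gPlus α ρ = fun r => ρ ^ (-α) * (max ρ r) ^ α := funext fun r => gPlus_eq hρ
  rw [this]
  refine continuous_const.mul ((continuous_const.max continuous_id).rpow_const fun r => Or.inl ?_)
  exact (lt_max_of_lt_left hρ).ne'

set_option maxHeartbeats 1000000 in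
/-- The weighted Hardy inequality in polar coordinates. -/
lemma hardy_polar {W : ℝ × ℝ → ℂ} (hW : ContDiff ℝ 2 W)
    (hper : ∀ r, W (r, Real.pi) = W (r, -Real.pi)) (hzero : ∀ θ, W (0, θ) = W (0, 0))
    {T : ℝ → ℝ} (hTc : Continuous T)
    (hT : ∀ r, 0 < r → T r = ∫ θ in (-Real.pi)..Real.pi,
      ‖fderiv ℝ W (r, θ) (1, 0) - Complex.I / r * fderiv ℝ W (r, θ) (0, 1)‖ ^ 2)
    {α ρ R : ℝ} (hα : 0 < α) (hρ : 0 < ρ) (hρR : ρ < R) (hR : ∀ θ, W (R, θ) = 0) :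
    distInt α ^ 2 * (∫ r in (0 : ℝ)..R, r * (gPlus α ρ r ^ 2 / (ρ ^ 2 + r ^ 2) *
        ∫ θ in (-Real.pi)..Real.pi, ‖W (r, θ)‖ ^ 2)) ≤
      ∫ r in (0 : ℝ)..R, r * (gPlus α ρ r ^ 2 * T r) := by
  have hpi : -Real.pi ≤ Real.pi := by linarith [Real.pi_pos]
  set μ := distInt α with hμ
  have hμ0 : 0 ≤ μ := distInt_nonneg α
  have hμ2 : μ ≤ 1 / 2 := distInt_le_half α
  have hμα : μ ≤ α := (distInt_le_abs α).trans_eq (abs_of_pos hα)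
  have hWc : Continuous W := hW.continuous
  have hDc : Continuous (fderiv ℝ W) := hW.continuous_fderiv (by norm_num)
  set N : ℝ → ℝ := fun r => ∫ θ in (-Real.pi)..Real.pi, ‖W (r, θ)‖ ^ 2 with hN
  set J : ℝ → ℝ := fun r => ∫ θ in (-Real.pi)..Real.pi,
    (star (W (r, θ)) * (-Complex.I * fderiv ℝ W (r, θ) (0, 1))).re with hJ
  set N' : ℝ → ℝ := fun r => ∫ θ in (-Real.pi)..Real.pi,
    2 * (star (W (r, θ)) * fderiv ℝ W (r, θ) (1, 0)).re with hN'
  set J' : ℝ → ℝ := fun r => ∫ θ in (-Real.pi)..Real.pi,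
    2 * (star (fderiv ℝ W (r, θ) (1, 0)) * (-Complex.I * fderiv ℝ W (r, θ) (0, 1))).re with hJ'
  set E : ℝ → ℝ := fun r => ∫ θ in (-Real.pi)..Real.pi, ‖fderiv ℝ W (r, θ) (1, 0)‖ ^ 2 with hE
  set Θ : ℝ → ℝ := fun r => ∫ θ in (-Real.pi)..Real.pi, ‖fderiv ℝ W (r, θ) (0, 1)‖ ^ 2 with hΘ
  have dN : ∀ r, HasDerivAt N (N' r) r := fun r => (hasDerivAt_angular hW hper r).1
  have dJ : ∀ r, HasDerivAt J (J' r) r := fun r => (hasDerivAt_angular hW hper r).2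
  have cN : Continuous N := continuous_iff_continuousAt.2 fun r => (dN r).continuousAt
  have cJ : Continuous J := continuous_iff_continuousAt.2 fun r => (dJ r).continuousAt
  have cN' : Continuous N' := continuous_intervalIntegral_param
    (by simp only [Function.uncurry_def]; fun_prop)
  have cJ' : Continuous J' := continuous_intervalIntegral_param
    (by simp only [Function.uncurry_def]; fun_prop)
  have hN0 : ∀ r, 0 ≤ N r := fun r => intervalIntegral.integral_nonneg hpi fun θ _ => by positivity
  have hΘ0 : ∀ r, 0 ≤ Θ r := fun r => intervalIntegral.integral_nonneg hpi fun θ _ => by positivity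
  -- expansions of squares
  have hTexp : ∀ r, 0 < r → r * T r = r * E r + Θ r / r + J' r := by
    intro r hr
    rw [hT r hr, hE, hΘ, hJ', ← intervalIntegral.integral_const_mul,
      ← intervalIntegral.integral_const_mul, ← intervalIntegral.integral_div,
      ← intervalIntegral.integral_add (Continuous.intervalIntegrable (by fun_prop) _ _)
      (Continuous.intervalIntegrable (by fun_prop) _ _),
      ← intervalIntegral.integral_add (Continuous.intervalIntegrable (by fun_prop) _ _)
      (Continuous.intervalIntegrable (by fun_prop) _ _)]
    refine intervalIntegral.integral_congr fun θ _ => ?_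
    simp only [← Complex.normSq_eq_norm_sq, Complex.normSq_apply]
    simp
    field_simp
    ring
  -- Completing the square with a free parameter `c`, to be `F r / r` inside the disc of radius `ρ`
  -- and `α / r` outside.
  have hsq : ∀ c r : ℝ, 0 ≤ E r + c * N' r + c ^ 2 * N r := by
    intro c r
    have : E r + c * N' r + c ^ 2 * N r = ∫ θ in (-Real.pi)..Real.pi,
        ‖fderiv ℝ W (r, θ) (1, 0) + c * W (r, θ)‖ ^ 2 := by
      rw [hE, hN', hN, ← intervalIntegral.integral_const_mul,
        ← intervalIntegral.integral_const_mul,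
        ← intervalIntegral.integral_add (Continuous.intervalIntegrable (by fun_prop) _ _)
        (Continuous.intervalIntegrable (by fun_prop) _ _),
        ← intervalIntegral.integral_add (Continuous.intervalIntegrable (by fun_prop) _ _)
        (Continuous.intervalIntegrable (by fun_prop) _ _)]
      refine intervalIntegral.integral_congr fun θ _ => ?_
      simp only [← Complex.normSq_eq_norm_sq, Complex.normSq_apply]
      simp
      ring
    rw [this]
    exact intervalIntegral.integral_nonneg hpi fun θ _ => by positivity
  -- The spectral gap on the circle, with `‖-i ∂_θ W - α W‖²` expanded.
  have hcirc : ∀ r, μ ^ 2 * N r ≤ Θ r - 2 * α * J r + α ^ 2 * N r := by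
    intro r
    have hd : ∀ θ, HasDerivAt (fun s => W (r, s)) (fderiv ℝ W (r, θ) (0, 1)) θ := fun θ =>
      ((hW.differentiable (by norm_num) (r, θ)).hasFDerivAt).comp_hasDerivAt θ
        ((hasDerivAt_const θ r).prodMk (hasDerivAt_id θ))
    refine (distInt_sq_mul_integral_le hd (by fun_prop) (hper r) α).trans_eq ?_
    rw [hΘ, hJ, hN, ← intervalIntegral.integral_const_mul,
      ← intervalIntegral.integral_const_mul,
      ← intervalIntegral.integral_sub (Continuous.intervalIntegrable (by fun_prop) _ _)
      (Continuous.intervalIntegrable (by fun_prop) _ _),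
      ← intervalIntegral.integral_add (Continuous.intervalIntegrable (by fun_prop) _ _)
      (Continuous.intervalIntegrable (by fun_prop) _ _)]
    refine intervalIntegral.integral_congr fun θ _ => ?_
    simp only [← Complex.normSq_eq_norm_sq, Complex.normSq_apply]
    simp
    ring
  have cg : Continuous (gPlus α ρ) := continuous_gPlus hρ
  have hden : ∀ r : ℝ, ρ ^ 2 + r ^ 2 ≠ 0 := fun r => by positivity
  have cL : Continuous fun r => r * (gPlus α ρ r ^ 2 / (ρ ^ 2 + r ^ 2) * N r) := by
    fun_prop (disch := exact hden _)
  have cL2 : Continuous fun r => μ ^ 2 * (r * (gPlus α ρ r ^ 2 / (ρ ^ 2 + r ^ 2) * N r)) :=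
    continuous_const.mul cL
  have cR : Continuous fun r => r * (gPlus α ρ r ^ 2 * T r) := by fun_prop
  -- The circle of radius zero is a single point, so `W` does not depend on the angle there.
  have hJ00 : J 0 = 0 := by
    have : ∀ θ, fderiv ℝ W (0, θ) (0, 1) = 0 := fun θ => by
      have h1 : HasDerivAt (fun s => W (0, s)) (fderiv ℝ W (0, θ) (0, 1)) θ :=
        ((hW.differentiable (by norm_num) (0, θ)).hasFDerivAt).comp_hasDerivAt θ
          ((hasDerivAt_const θ (0 : ℝ)).prodMk (hasDerivAt_id θ))
      exact h1.unique ((hasDerivAt_const θ (W (0, 0))).congr_of_eventuallyEq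
        (.of_forall hzero))
    simp [hJ, this]
  have hJR : J R = 0 := by simp [hJ, hR]
  have hNR : N R = 0 := by simp [hN, hR]
  -- the inner disc
  have hin : J ρ - μ / 2 * N ρ + μ ^ 2 * (∫ r in (0 : ℝ)..ρ,
      r * (gPlus α ρ r ^ 2 / (ρ ^ 2 + r ^ 2) * N r)) ≤
      ∫ r in (0 : ℝ)..ρ, r * (gPlus α ρ r ^ 2 * T r) := by
    -- `F` is a subsolution of a Riccati equation: `F' - F²/r ≥ μ² r/(ρ² + r²)` for `0 < r < ρ`.
    -- With `c = F/r` in `hsq` and the angular energy dropped, `r T` is at least `(J - F N)' + (F' -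
    -- F²/r) N`. The boundary values are `F 0 = 0` and `F ρ = μ/2`.
    set F : ℝ → ℝ := fun r => μ * r ^ 2 / (ρ ^ 2 + r ^ 2) with hF
    have dF : ∀ r, HasDerivAt F (2 * μ * r * ρ ^ 2 / (ρ ^ 2 + r ^ 2) ^ 2) r := fun r => by
      have h1 := (((hasDerivAt_id r).pow 2).const_mul μ).div
        (((hasDerivAt_id r).pow 2).const_add (ρ ^ 2)) (hden r)
      refine h1.congr_deriv ?_
      simp only [id_eq, Pi.pow_apply]
      congr 1
      push_cast
      ring
    have cF : Continuous F := continuous_iff_continuousAt.2 fun r => (dF r).continuousAt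
    have cF' : Continuous fun r => 2 * μ * r * ρ ^ 2 / (ρ ^ 2 + r ^ 2) ^ 2 :=
      (by fun_prop : Continuous fun r => 2 * μ * r * ρ ^ 2).div (by fun_prop)
        fun r => pow_ne_zero _ (hden r)
    have hftc := intervalIntegral.integral_eq_sub_of_hasDerivAt (a := 0) (b := ρ)
      (fun r _ => (dJ r).sub ((dF r).mul (dN r)))
      (Continuous.intervalIntegrable (by fun_prop) _ _)
    have hval : J ρ - μ / 2 * N ρ = (J - F * N) ρ - (J - F * N) 0 := by
      simp only [Pi.sub_apply, Pi.mul_apply, hJ00, hF]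
      have : ρ ^ 2 + ρ ^ 2 ≠ 0 := hden ρ
      field_simp
      ring
    rw [hval, ← hftc, ← intervalIntegral.integral_const_mul, ← intervalIntegral.integral_add
      (Continuous.intervalIntegrable (by fun_prop) _ _) (cL2.intervalIntegrable _ _)]
    refine intervalIntegral.integral_mono_on_of_le_Ioo hρ.le
      (Continuous.intervalIntegrable (by fun_prop) _ _) (cR.intervalIntegrable _ _) ?_
    rintro r ⟨hr, hrρ⟩
    rw [gPlus_of_le hrρ.le]
    have h1 := mul_nonneg hr.le (hsq (F r / r) r)
    have h2 : r * (E r + F r / r * N' r + (F r / r) ^ 2 * N r) =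
        r * E r + F r * N' r + F r ^ 2 / r * N r := by field_simp
    have h3 : μ ^ 2 * (r * (1 ^ 2 / (ρ ^ 2 + r ^ 2))) ≤
        2 * μ * r * ρ ^ 2 / (ρ ^ 2 + r ^ 2) ^ 2 - F r ^ 2 / r := by
      have : 2 * μ * r * ρ ^ 2 / (ρ ^ 2 + r ^ 2) ^ 2 - F r ^ 2 / r -
          μ ^ 2 * (r * (1 ^ 2 / (ρ ^ 2 + r ^ 2))) =
          μ * r / (ρ ^ 2 + r ^ 2) ^ 2 * (2 * ρ ^ 2 - μ * (ρ ^ 2 + 2 * r ^ 2)) := by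
        have := hden r
        simp only [hF]
        field_simp
        ring
      have hrr : r ^ 2 ≤ ρ ^ 2 := by gcongr
      have : 0 ≤ μ * r / (ρ ^ 2 + r ^ 2) ^ 2 * (2 * ρ ^ 2 - μ * (ρ ^ 2 + 2 * r ^ 2)) := by
        refine mul_nonneg (by positivity) ?_
        -- Since `μ ≤ 1/2` and `r ≤ ρ`, one has `μ (ρ² + 2r²) ≤ 3ρ²/2 ≤ 2ρ²`.
        nlinarith [mul_nonneg (sub_nonneg.2 hμ2) (by positivity : 0 ≤ ρ ^ 2 + 2 * r ^ 2),
          sq_nonneg ρ]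
      linarith
    have h4 := mul_le_mul_of_nonneg_right h3 (hN0 r)
    have h5 : 0 ≤ Θ r / r := div_nonneg (hΘ0 r) hr.le
    have h6 := hTexp r hr
    nlinarith
  -- the outer region
  have hout : -(J ρ - α * N ρ) + μ ^ 2 * (∫ r in ρ..R,
      r * (gPlus α ρ r ^ 2 / (ρ ^ 2 + r ^ 2) * N r)) ≤
      ∫ r in ρ..R, r * (gPlus α ρ r ^ 2 * T r) := by
    set G : ℝ → ℝ := fun r => (ρ ^ (-α) * r ^ α) ^ 2 with hG
    have hGg : ∀ r, ρ ≤ r → gPlus α ρ r ^ 2 = G r := fun r hr => by rw [gPlus_of_ge hρ hr]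
    have dG : ∀ r, 0 < r → HasDerivAt G (2 * α / r * G r) r := fun r hr => by
      have h1 := (((hasDerivAt_id r).rpow_const (p := α) (Or.inl hr.ne')).const_mul
        (ρ ^ (-α))).pow 2
      refine h1.congr_deriv ?_
      simp only [id_eq, hG, Real.rpow_sub hr, Real.rpow_one]
      field_simp
      push_cast
      ring
    have cG : ContinuousOn (fun r => gPlus α ρ r ^ 2) (Set.uIcc ρ R) := by fun_prop
    have hpos : ∀ r ∈ Set.uIcc ρ R, ρ ≤ r := fun r hr => by
      rw [Set.uIcc_of_le hρR.le] at hr; exact hr.1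
    have hii : IntervalIntegrable (fun r => 2 * α / r * gPlus α ρ r ^ 2 * (J r - α * N r) +
        gPlus α ρ r ^ 2 * (J' r - α * N' r)) volume ρ R := by
      refine ContinuousOn.intervalIntegrable ?_
      refine ContinuousOn.add (((continuousOn_const.div continuousOn_id fun r hr => ?_).mul cG).mul
        (by fun_prop)) (by fun_prop)
      exact (hρ.trans_le (hpos r hr)).ne'
    -- The exact part of the outer integrand is the derivative of `g₊² (J - α N)`, where `(g₊²)' =
    -- (2α/r) g₊²`.
    have hftc := intervalIntegral.integral_eq_sub_of_hasDerivAt (a := ρ) (b := R)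
      (f := G * (J - (fun r => α * N r)))
      (f' := fun r => 2 * α / r * gPlus α ρ r ^ 2 * (J r - α * N r) +
        gPlus α ρ r ^ 2 * (J' r - α * N' r))
      (fun r hr => by
        have hr' := hpos r hr
        rw [hGg r hr']
        exact (dG r (hρ.trans_le hr')).mul ((dJ r).sub ((dN r).const_mul α))) hii
    have hval : -(J ρ - α * N ρ) = (G * (J - (fun r => α * N r))) R -
        (G * (J - (fun r => α * N r))) ρ := by
      have : G ρ = 1 := by rw [← hGg ρ le_rfl, gPlus_of_le le_rfl, one_pow]
      simp [hJR, hNR, this]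
    rw [hval, ← hftc, ← intervalIntegral.integral_const_mul, ← intervalIntegral.integral_add
      hii (cL2.intervalIntegrable _ _)]
    refine intervalIntegral.integral_mono_on_of_le_Ioo hρR.le
      (hii.add (cL2.intervalIntegrable _ _)) (cR.intervalIntegrable _ _) ?_
    rintro r ⟨hrρ, -⟩
    have hr : 0 < r := hρ.trans hrρ
    -- The choice `c = α/r` corresponds to the zero mode `r^{-α}` of `∂_r + α/r`. It bounds the
    -- radial energy from below, and `hcirc` does the same for the angular energy.
    have h1 := mul_nonneg hr.le (hsq (α / r) r)
    have h2 : r * (E r + α / r * N' r + (α / r) ^ 2 * N r) =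
        r * E r + α * N' r + α ^ 2 * N r / r := by field_simp
    have h3 := div_le_div_of_nonneg_right (hcirc r) hr.le
    have h6 := hTexp r hr
    have h7 : r * (1 / (ρ ^ 2 + r ^ 2) * N r) ≤ N r / r := by
      rw [show r * (1 / (ρ ^ 2 + r ^ 2) * N r) = N r * r / (ρ ^ 2 + r ^ 2) by ring,
        div_le_div_iff₀ (by positivity) hr]
      nlinarith [mul_nonneg (hN0 r) (sq_nonneg ρ)]
    have h8 := mul_le_mul_of_nonneg_left h7 (sq_nonneg μ)
    have h9 : 2 * α / r * (J r - α * N r) + (J' r - α * N' r) +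
        μ ^ 2 * (r * (1 / (ρ ^ 2 + r ^ 2) * N r)) ≤ r * T r := by
      have e1 : (Θ r - 2 * α * J r + α ^ 2 * N r) / r =
        Θ r / r - 2 * α / r * J r + α ^ 2 * N r / r := by ring
      have e2 : 2 * α / r * (J r - α * N r) = 2 * α / r * J r - 2 * (α ^ 2 * N r / r) := by ring
      have e3 : μ ^ 2 * (N r / r) = μ ^ 2 * N r / r := by ring
      rw [e1] at h3
      linarith
    have h10 := mul_le_mul_of_nonneg_left h9 (sq_nonneg (gPlus α ρ r))
    refine (le_of_eq ?_).trans (h10.trans (le_of_eq ?_)) <;> ring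
  rw [← intervalIntegral.integral_add_adjacent_intervals (cL.intervalIntegrable 0 ρ)
    (cL.intervalIntegrable ρ R), ← intervalIntegral.integral_add_adjacent_intervals
    (cR.intervalIntegrable 0 ρ) (cR.intervalIntegrable ρ R)]
  -- What is left on the circle of radius `ρ` after the two terms `J ρ` have cancelled; it is
  -- nonnegative because `μ ≤ α`.
  have : 0 ≤ (α - μ / 2) * N ρ := mul_nonneg (by linarith) (hN0 ρ)
  linarith

/-! ### Partial derivatives and the weighted inequality in Cartesian coordinates -/

/-- The partial derivative of a vector valued function on the plane. -/
noncomputable def pderiv {E : Type*} [NormedAddCommGroup E] [NormedSpace ℝ E] (i : Fin 2)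
    (f : Plane → E) (x : Plane) : E :=
  fderiv ℝ f x (EuclideanSpace.single i (1 : ℝ))

section pderiv

variable {E : Type*} [NormedAddCommGroup E] [NormedSpace ℝ E]

lemma partialDeriv_eq (i : Fin 2) (φ : Plane → ℝ) : partialDeriv i φ = pderiv i φ := rfl

lemma ContDiff.pderiv {n m : WithTop ℕ∞} {f : Plane → E} (hf : ContDiff ℝ n f) (hmn : m + 1 ≤ n)
    (i : Fin 2) : ContDiff ℝ m (pderiv i f) :=
  (hf.fderiv_right hmn).clm_apply contDiff_const

lemma HasCompactSupport.pderiv {f : Plane → E} (hf : HasCompactSupport f) (i : Fin 2) :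
    HasCompactSupport (pderiv i f) :=
  hf.fderiv_apply (𝕜 := ℝ) _

lemma pderiv_eq_of_hasFDerivAt {f : Plane → E} {f' : Plane →L[ℝ] E} {x : Plane}
    (h : HasFDerivAt f f' x) (i : Fin 2) : pderiv i f x = f' (EuclideanSpace.single i 1) := by
  rw [PauliHardy.pderiv, h.fderiv]

lemma plane_eq_sum (x : Plane) :
    x = x 0 • EuclideanSpace.single 0 (1 : ℝ) + x 1 • EuclideanSpace.single 1 (1 : ℝ) := by
  ext i
  fin_cases i <;> simp

lemma fderiv_apply_eq (f : Plane → E) (x y : Plane) :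
    fderiv ℝ f x y = y 0 • pderiv 0 f x + y 1 • pderiv 1 f x := by
  conv_lhs => rw [plane_eq_sum y]
  rw [map_add, map_smul, map_smul]
  rfl

end pderiv

lemma polarPt_eq (r θ : ℝ) : polarPt r θ = (r * Real.cos θ) • EuclideanSpace.single 0 (1 : ℝ) +
    (r * Real.sin θ) • EuclideanSpace.single 1 (1 : ℝ) :=
  plane_eq_sum _

lemma hasDerivAt_polarPt_left (r θ : ℝ) :
    HasDerivAt (fun s => polarPt s θ) (polarPt 1 θ) r := by
  simp only [polarPt_eq]
  have h := (((hasDerivAt_id r).mul_const (Real.cos θ)).smul_const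
    (EuclideanSpace.single (0 : Fin 2) (1 : ℝ))).add
    (((hasDerivAt_id r).mul_const (Real.sin θ)).smul_const
      (EuclideanSpace.single (1 : Fin 2) (1 : ℝ)))
  exact h.congr_deriv (by simp)

lemma hasDerivAt_polarPt_right (r θ : ℝ) :
    HasDerivAt (fun s => polarPt r s) (!₂[-(r * Real.sin θ), r * Real.cos θ] : Plane) θ := by
  rw [plane_eq_sum (!₂[_, _] : Plane)]
  simp only [polarPt_eq]
  have h := (((Real.hasDerivAt_cos θ).const_mul r).smul_const
    (EuclideanSpace.single (0 : Fin 2) (1 : ℝ))).add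
    (((Real.hasDerivAt_sin θ).const_mul r).smul_const
      (EuclideanSpace.single (1 : Fin 2) (1 : ℝ)))
  exact h.congr_deriv (by simp)

lemma pderiv_eq_zero_of_notMem {E : Type*} [NormedAddCommGroup E] [NormedSpace ℝ E]
    {f : Plane → E} {x : Plane} (h : x ∉ tsupport f) (i : Fin 2) : pderiv i f x = 0 := by
  rw [pderiv, image_eq_zero_of_notMem_tsupport fun h' => h (tsupport_fderiv_subset ℝ h')]
  rfl

lemma exists_radius {E : Type*} [Zero E] {f : Plane → E} (hf : HasCompactSupport f) (c : ℝ) :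
    ∃ R, c < R ∧ ∀ x, R ≤ ‖x‖ → x ∉ tsupport f := by
  obtain ⟨R, hR⟩ := hf.isCompact.isBounded.subset_closedBall 0
  refine ⟨max R c + 1, by linarith [le_max_right R c], fun x hx h => ?_⟩
  have := hR h
  rw [mem_closedBall_zero_iff] at this
  linarith [le_max_left R c]

/-- The weighted Hardy inequality for the operator `∂₁ - i∂₂` on smooth functions. -/
lemma hardy_smooth {v : Plane → ℂ} (hv : ContDiff ℝ 2 v) (hvc : HasCompactSupport v)
    {α ρ : ℝ} (hα : 0 < α) (hρ : 0 < ρ) :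
    distInt α ^ 2 * (∫ x, gPlus α ρ ‖x‖ ^ 2 / (ρ ^ 2 + ‖x‖ ^ 2) * ‖v x‖ ^ 2) ≤
      ∫ x, gPlus α ρ ‖x‖ ^ 2 * ‖pderiv 0 v x - Complex.I * pderiv 1 v x‖ ^ 2 := by
  obtain ⟨R, hρR, hR'⟩ := exists_radius hvc ρ
  have hR : ∀ x, R ≤ ‖x‖ → v x = 0 ∧ pderiv 0 v x = 0 ∧ pderiv 1 v x = 0 := fun x hx =>
    ⟨image_eq_zero_of_notMem_tsupport (hR' x hx), pderiv_eq_zero_of_notMem (hR' x hx) 0,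
      pderiv_eq_zero_of_notMem (hR' x hx) 1⟩
  have hR0 : 0 ≤ R := (hρ.trans hρR).le
  have hvc' : Continuous v := hv.continuous
  have c0 : Continuous (pderiv 0 v) := (ContDiff.pderiv (m := 1) hv (by norm_num) 0).continuous
  have c1 : Continuous (pderiv 1 v) := (ContDiff.pderiv (m := 1) hv (by norm_num) 1).continuous
  have cg : Continuous (gPlus α ρ) := continuous_gPlus hρ
  have hden : ∀ x : Plane, ρ ^ 2 + ‖x‖ ^ 2 ≠ 0 := fun x => by positivity
  have cw : Continuous fun x : Plane => gPlus α ρ ‖x‖ ^ 2 / (ρ ^ 2 + ‖x‖ ^ 2) :=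
    (by fun_prop : Continuous fun x : Plane => gPlus α ρ ‖x‖ ^ 2).div (by fun_prop) hden
  rw [integral_eq_polar (by fun_prop) hR0 (fun x hx => by simp [(hR x hx).1]),
    integral_eq_polar (by fun_prop) hR0 (fun x hx => by simp [(hR x hx).2])]
  set W : ℝ × ℝ → ℂ := fun p => v (polarPt p.1 p.2) with hWdef
  have hW : ContDiff ℝ 2 W := hv.comp contDiff_polarPt
  have hWd : ∀ p, HasFDerivAt W (fderiv ℝ W p) p := fun p =>
    (hW.differentiable (by norm_num) p).hasFDerivAt
  have hvd : ∀ x, HasFDerivAt v (fderiv ℝ v x) x := fun x =>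
    (hv.differentiable (by norm_num) x).hasFDerivAt
  have hW1 : ∀ r θ : ℝ, fderiv ℝ W (r, θ) (1, 0) = Real.cos θ • pderiv 0 v (polarPt r θ) +
      Real.sin θ • pderiv 1 v (polarPt r θ) := fun r θ => by
    have h1 : HasDerivAt (fun s => W (s, θ)) (fderiv ℝ W (r, θ) (1, 0)) r :=
      (hWd (r, θ)).comp_hasDerivAt (f := fun s : ℝ => (s, θ)) r
        ((hasDerivAt_id r).prodMk (hasDerivAt_const r θ))
    have h2 := (hvd (polarPt r θ)).comp_hasDerivAt r (hasDerivAt_polarPt_left r θ)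
    rw [h1.unique h2, fderiv_apply_eq]
    simp [polarPt]
  have hW2 : ∀ r θ : ℝ, fderiv ℝ W (r, θ) (0, 1) = (-(r * Real.sin θ)) • pderiv 0 v (polarPt r θ) +
      (r * Real.cos θ) • pderiv 1 v (polarPt r θ) := fun r θ => by
    have h1 : HasDerivAt (fun s => W (r, s)) (fderiv ℝ W (r, θ) (0, 1)) θ :=
      (hWd (r, θ)).comp_hasDerivAt θ ((hasDerivAt_const θ r).prodMk (hasDerivAt_id θ))
    have h2 := (hvd (polarPt r θ)).comp_hasDerivAt θ (hasDerivAt_polarPt_right r θ)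
    rw [h1.unique h2, fderiv_apply_eq]
    simp
  have key := hardy_polar hW (fun r => by simp [hWdef, polarPt]) (fun θ => by
      simp [hWdef, polarPt_zero])
    (T := fun r => ∫ θ in (-Real.pi)..Real.pi,
      ‖pderiv 0 v (polarPt r θ) - Complex.I * pderiv 1 v (polarPt r θ)‖ ^ 2)
    (continuous_intervalIntegral_param (by
      have := continuous_polarPt
      simp only [Function.uncurry_def]
      fun_prop))
    (fun r hr => by
      refine intervalIntegral.integral_congr fun θ _ => ?_
      simp only [hW1, hW2]
      have hr' : (r : ℂ) ≠ 0 := by exact_mod_cast hr.ne'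
      set a := pderiv 0 v (polarPt r θ)
      set b := pderiv 1 v (polarPt r θ)
      -- Up to the unimodular factor `e^{iθ}`, the operator `∂₁ - i∂₂` is `∂_r - (i/r)∂_θ`.
      have e : Real.cos θ • a + Real.sin θ • b - Complex.I / r *
          ((-(r * Real.sin θ)) • a + (r * Real.cos θ) • b) =
          Complex.exp (θ * Complex.I) * (a - Complex.I * b) := by
        simp only [Complex.real_smul, Complex.exp_mul_I]
        push_cast
        field_simp
        linear_combination (Complex.sin θ * b) * Complex.I_sq
      rw [e, norm_mul, Complex.norm_exp_ofReal_mul_I, one_mul])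
    hα hρ hρR (fun θ => (hR _ (by rw [norm_polarPt]; exact le_abs_self R)).1)
  have cong : ∀ (F : ℝ → ℝ) (f : Plane → ℝ),
      (∫ r in (0 : ℝ)..R, r * ∫ θ in (-Real.pi)..Real.pi, F ‖polarPt r θ‖ * f (polarPt r θ)) =
      ∫ r in (0 : ℝ)..R, r * (F r * ∫ θ in (-Real.pi)..Real.pi, f (polarPt r θ)) := by
    intro F f
    refine intervalIntegral.integral_congr fun r hr => ?_
    rw [Set.uIcc_of_le hR0] at hr
    simp only [norm_polarPt, abs_of_nonneg hr.1, intervalIntegral.integral_const_mul]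
  rw [cong (fun r => gPlus α ρ r ^ 2 / (ρ ^ 2 + r ^ 2)) (fun x => ‖v x‖ ^ 2),
    cong (fun r => gPlus α ρ r ^ 2) (fun x => ‖pderiv 0 v x - Complex.I * pderiv 1 v x‖ ^ 2)]
  exact key

lemma integral_mul_pderiv {𝕜 : Type*} [RCLike 𝕜] {f g : Plane → 𝕜} (hf : ContDiff ℝ 1 f)
    (hg : ContDiff ℝ 1 g) (hgc : HasCompactSupport g) (i : Fin 2) :
    ∫ x, f x * pderiv i g x = -∫ x, pderiv i f x * g x := by
  have c1 : Continuous (pderiv i f) := (ContDiff.pderiv (m := 0) hf (by norm_num) i).continuous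
  have c2 : Continuous (pderiv i g) := (ContDiff.pderiv (m := 0) hg (by norm_num) i).continuous
  have c3 := hf.continuous
  have c4 := hg.continuous
  exact integral_mul_fderiv_eq_neg_fderiv_mul_of_integrable
    ((c1.mul c4).integrable_of_hasCompactSupport hgc.mul_left)
    ((c3.mul c2).integrable_of_hasCompactSupport (HasCompactSupport.pderiv hgc i).mul_left)
    ((c3.mul c4).integrable_of_hasCompactSupport hgc.mul_left)
    (fun x _ => hf.differentiable one_ne_zero x) (fun x _ => hg.differentiable one_ne_zero x)

/-! ### The logarithm as a fundamental solution of the Laplacian -/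

/-- The negative part of the logarithmic kernel. -/
noncomputable def logKernel (z : Plane) : ℝ :=
  (Metric.ball (0 : Plane) 1).indicator (fun z => |Real.log ‖z‖|) z

/-- In polar coordinates the integrand is `y log² y` on `(0,1)`, bounded by `4` because `|√y log √y|
< 1`. Square integrability is what pairs the singularity of the kernel with a field in `L²`. -/
lemma integrable_logKernel_sq : Integrable (fun z => logKernel z ^ 2) := by
  have h : (fun z => logKernel z ^ 2) =
      (Metric.ball (0 : Plane) 1).indicator (fun z => Real.log ‖z‖ ^ 2) := by
    ext z
    by_cases hz : z ∈ Metric.ball (0 : Plane) 1 <;> simp [logKernel, hz, -Metric.mem_ball]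
  rw [h, integrable_indicator_iff Metric.isOpen_ball.measurableSet]
  rw [integrableOn_fun_norm_addHaar volume (f := fun t => Real.log t ^ 2)]
  simp only [finrank_euclideanSpace, Fintype.card_fin, smul_eq_mul]
  refine Measure.integrableOn_of_bounded (M := 4) (by simp) (by fun_prop) ?_
  refine (ae_restrict_mem measurableSet_Ioo).mono fun y hy => ?_
  have h1 := Real.abs_log_mul_self_lt (Real.sqrt y) (Real.sqrt_pos.2 hy.1)
    (Real.sqrt_le_one.2 hy.2.le)
  rw [Real.log_sqrt hy.1.le] at h1
  have h2 : (Real.log y / 2 * Real.sqrt y) ^ 2 ≤ 1 := by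
    rw [sq_le_one_iff_abs_le_one]; exact h1.le
  rw [mul_pow, Real.sq_sqrt hy.1.le] at h2
  rw [Real.norm_eq_abs, abs_of_nonneg (by have := hy.1; positivity)]
  simp only [Nat.add_one_sub_one, pow_one]
  nlinarith

lemma abs_log_norm_le (z : Plane) : |Real.log ‖z‖| ≤ logKernel z + Real.log (1 + ‖z‖) := by
  by_cases hz : z ∈ Metric.ball (0 : Plane) 1
  · simp only [logKernel, Set.indicator_of_mem hz]
    linarith [Real.log_nonneg (by linarith [norm_nonneg z] : 1 ≤ 1 + ‖z‖)]
  · simp only [logKernel, Set.indicator_of_notMem hz]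
    have : 1 ≤ ‖z‖ := by simpa using hz
    rw [abs_of_nonneg (Real.log_nonneg this), zero_add]
    exact Real.log_le_log (by linarith) (by linarith)

lemma locallyIntegrable_log_norm : LocallyIntegrable (fun z : Plane => Real.log ‖z‖) := by
  have h1 : LocallyIntegrable (fun z : Plane => (logKernel z ^ 2 + 1) + Real.log (1 + ‖z‖)) := by
    refine (integrable_logKernel_sq.locallyIntegrable.add (locallyIntegrable_const 1)).add
      (Continuous.locallyIntegrable ?_)
    exact (by fun_prop : Continuous fun z : Plane => 1 + ‖z‖).log
      fun z => by positivity
  refine h1.mono (Real.measurable_log.comp measurable_norm).aestronglyMeasurable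
    (.of_forall fun z => ?_)
  rw [Real.norm_eq_abs]
  refine (abs_log_norm_le z).trans (le_trans ?_ (le_abs_self _))
  nlinarith [sq_nonneg (logKernel z - 1)]

/-- The integrated form of `½ Δ log(|x|² + δ²)`, written in polar coordinates. -/
lemma integral_log_add_mul_laplacian {φ : Plane → ℝ} (hφ : ContDiff ℝ 2 φ)
    {R δ : ℝ} (hR0 : 0 ≤ R) (hR : ∀ x, R ≤ ‖x‖ → x ∉ tsupport φ) (hδ : 0 < δ) :
    ∫ x, Real.log (‖x‖ ^ 2 + δ ^ 2) / 2 * (pderiv 0 (pderiv 0 φ) x + pderiv 1 (pderiv 1 φ) x) =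
      -∫ r in (0 : ℝ)..R, r ^ 2 / (r ^ 2 + δ ^ 2) *
        ∫ θ in (-Real.pi)..Real.pi, fderiv ℝ φ (polarPt r θ) (polarPt 1 θ) := by
  have hφc : HasCompactSupport φ := by
    refine HasCompactSupport.of_support_subset_isCompact (isCompact_closedBall (0 : Plane) R)
      fun x hx => ?_
    rw [mem_closedBall_zero_iff]
    by_contra! h
    exact hR x h.le (subset_tsupport _ hx)
  have hden : ∀ x : Plane, ‖x‖ ^ 2 + δ ^ 2 ≠ 0 := fun x => by positivity
  set L : Plane → ℝ := fun x => Real.log (‖x‖ ^ 2 + δ ^ 2) / 2 with hL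
  have hLs : ContDiff ℝ 1 L :=
    (((contDiff_norm_sq ℝ).add contDiff_const).log hden).div_const 2
  have hLd : ∀ i x, pderiv i L x = x i / (‖x‖ ^ 2 + δ ^ 2) := fun i x => by
    have h1 := (((hasStrictFDerivAt_norm_sq x).hasFDerivAt.add_const (δ ^ 2)).log
      (hden x)).mul_const (2 : ℝ)⁻¹
    have h2 := pderiv_eq_of_hasFDerivAt h1 i
    rw [hL]
    simp only [div_eq_mul_inv]
    rw [h2]
    simp [EuclideanSpace.inner_single_right]
    ring
  have s1 : ∀ i, ContDiff ℝ 1 (pderiv i φ) := fun i => ContDiff.pderiv hφ (by norm_num) i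
  have c1 : ∀ i, Continuous (pderiv i φ) := fun i => (s1 i).continuous
  have c2 : ∀ i, Continuous (pderiv i (pderiv i φ)) := fun i =>
    (ContDiff.pderiv (m := 0) (s1 i) (by norm_num) i).continuous
  have cs : ∀ i, HasCompactSupport (pderiv i φ) := fun i => HasCompactSupport.pderiv hφc i
  have cL := hLs.continuous
  have hint : ∀ i, Integrable fun x => L x * pderiv i (pderiv i φ) x := fun i =>
    (cL.mul (c2 i)).integrable_of_hasCompactSupport (HasCompactSupport.pderiv (cs i) i).mul_left
  have cq : Continuous fun x : Plane => (‖x‖ ^ 2 + δ ^ 2)⁻¹ :=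
    (by fun_prop : Continuous fun x : Plane => ‖x‖ ^ 2 + δ ^ 2).inv₀ hden
  have hint2 : ∀ i, Integrable fun x => pderiv i L x * pderiv i φ x := fun i =>
    ((ContDiff.pderiv (m := 0) hLs (by norm_num) i).continuous.mul
      (c1 i)).integrable_of_hasCompactSupport (cs i).mul_left
  have cdφ := hφ.continuous_fderiv (by norm_num)
  have e1 : ∀ x, L x * (pderiv 0 (pderiv 0 φ) x + pderiv 1 (pderiv 1 φ) x) =
      L x * pderiv 0 (pderiv 0 φ) x + L x * pderiv 1 (pderiv 1 φ) x := fun x => by ring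
  have e2 : ∀ x, pderiv 0 L x * pderiv 0 φ x + pderiv 1 L x * pderiv 1 φ x =
      -- The gradient of `½ log(|x|² + δ²)` is `x/(|x|² + δ²)`, so after one integration by parts
      -- only the radial derivative of `φ` survives.
      (‖x‖ ^ 2 + δ ^ 2)⁻¹ * fderiv ℝ φ x x := fun x => by
    rw [hLd, hLd, fderiv_apply_eq, smul_eq_mul, smul_eq_mul]
    ring
  change ∫ x, L x * (pderiv 0 (pderiv 0 φ) x + pderiv 1 (pderiv 1 φ) x) = _
  simp_rw [e1]
  rw [integral_add (hint 0) (hint 1), integral_mul_pderiv hLs (s1 0) (cs 0),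
    integral_mul_pderiv hLs (s1 1) (cs 1), ← neg_add, ← integral_add (hint2 0) (hint2 1)]
  simp_rw [e2]
  rw [integral_eq_polar (by fun_prop) hR0 fun x hx => by
    rw [fderiv_apply_eq, pderiv_eq_zero_of_notMem (hR x hx), pderiv_eq_zero_of_notMem (hR x hx)]
    simp]
  congr 1
  refine intervalIntegral.integral_congr fun r hr => ?_
  have e3 : ∀ θ, (‖polarPt r θ‖ ^ 2 + δ ^ 2)⁻¹ * fderiv ℝ φ (polarPt r θ) (polarPt r θ) =
      (r / (r ^ 2 + δ ^ 2)) * fderiv ℝ φ (polarPt r θ) (polarPt 1 θ) := fun θ => by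
    have : polarPt r θ = r • polarPt 1 θ := by simp [polarPt_eq, mul_smul]
    conv_lhs => rw [norm_polarPt, sq_abs]; arg 2; arg 2; rw [this]
    rw [map_smul, smul_eq_mul]
    ring
  simp only [e3, intervalIntegral.integral_const_mul]
  ring

/-- `log |x|` is `2π` times the fundamental solution of the Laplacian of the plane. -/
lemma integral_log_norm_mul_laplacian {φ : Plane → ℝ} (hφ : ContDiff ℝ 2 φ)
    (hφc : HasCompactSupport φ) :
    ∫ x, Real.log ‖x‖ * (pderiv 0 (pderiv 0 φ) x + pderiv 1 (pderiv 1 φ) x) =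
      2 * Real.pi * φ 0 := by
  obtain ⟨R, hR0, hR⟩ := exists_radius hφc 0
  set D : Plane → ℝ := fun x => pderiv 0 (pderiv 0 φ) x + pderiv 1 (pderiv 1 φ) x with hD
  have s1 : ∀ i, ContDiff ℝ 1 (pderiv i φ) := fun i => ContDiff.pderiv hφ (by norm_num) i
  have c2 : ∀ i, Continuous (pderiv i (pderiv i φ)) := fun i =>
    (ContDiff.pderiv (m := 0) (s1 i) (by norm_num) i).continuous
  have cD : Continuous D := (c2 0).add (c2 1)
  have cs : ∀ i, HasCompactSupport (pderiv i (pderiv i φ)) := fun i =>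
    HasCompactSupport.pderiv (HasCompactSupport.pderiv hφc i) i
  have csD : HasCompactSupport D := (cs 0).add (cs 1)
  have cdφ := hφ.continuous_fderiv (by norm_num)
  have cP := continuous_polarPt
  -- The logarithm is regularised as `½ log(|x|² + δ²)`, and `δ → 0` by dominated convergence on
  -- both sides of `integral_log_add_mul_laplacian`.
  set δ : ℕ → ℝ := fun n => 1 / ((n : ℝ) + 1) with hδ
  have hδ0 : ∀ n, 0 < δ n := fun n => by positivity
  have hδ1 : ∀ n, δ n ≤ 1 := fun n => by
    rw [hδ, div_le_one (by positivity)]; linarith [Nat.cast_nonneg (α := ℝ) n]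
  have hδlim : Filter.Tendsto δ Filter.atTop (nhds 0) := tendsto_one_div_add_atTop_nhds_zero_nat
  have lim1 : Filter.Tendsto (fun n => ∫ x, Real.log (‖x‖ ^ 2 + δ n ^ 2) / 2 * D x) Filter.atTop
      (nhds (∫ x, Real.log ‖x‖ * D x)) := by
    have cl : Continuous fun x : Plane => Real.log (‖x‖ ^ 2 + 1) :=
      (by fun_prop : Continuous fun x : Plane => ‖x‖ ^ 2 + 1).log fun x => by positivity
    refine tendsto_integral_of_dominated_convergence
      (fun x => |Real.log ‖x‖ * D x| + Real.log (‖x‖ ^ 2 + 1) * |D x|) (fun n => ?_) ?_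
      (fun n => ?_) ?_
    · have : Continuous fun x : Plane => Real.log (‖x‖ ^ 2 + δ n ^ 2) :=
        (by fun_prop : Continuous fun x : Plane => ‖x‖ ^ 2 + δ n ^ 2).log fun x => by
          have := hδ0 n; positivity
      exact ((this.div_const 2).mul cD).aestronglyMeasurable
    · refine Integrable.add ?_ ((cl.mul cD.abs).integrable_of_hasCompactSupport csD.abs.mul_left)
      have := locallyIntegrable_log_norm.integrable_smul_left_of_hasCompactSupport cD csD
      simp only [smul_eq_mul, mul_comm (D _)] at this
      exact this.abs
    · refine (measure_eq_zero_iff_ae_notMem.1 (measure_singleton (0 : Plane))).mono fun x hx => ?_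
      have hx0 : 0 < ‖x‖ := norm_pos_iff.2 hx
      have h1 : Real.log ‖x‖ ≤ Real.log (‖x‖ ^ 2 + δ n ^ 2) / 2 := by
        rw [le_div_iff₀ two_pos, mul_comm, ← Real.log_rpow hx0, Real.rpow_two]
        exact Real.log_le_log (by positivity) (by nlinarith [hδ0 n])
      have h2 : Real.log (‖x‖ ^ 2 + δ n ^ 2) ≤ Real.log (‖x‖ ^ 2 + 1) := by
        refine Real.log_le_log (by have := hδ0 n; positivity) ?_
        have := pow_le_one₀ (n := 2) (hδ0 n).le (hδ1 n)
        linarith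
      have h3 : 0 ≤ Real.log (‖x‖ ^ 2 + 1) := Real.log_nonneg (by nlinarith)
      rw [Real.norm_eq_abs, abs_mul, abs_mul, ← add_mul]
      refine mul_le_mul_of_nonneg_right (abs_le.2 ⟨?_, ?_⟩) (abs_nonneg _)
      · linarith [neg_abs_le (Real.log ‖x‖)]
      · linarith [abs_nonneg (Real.log ‖x‖)]
    · refine (measure_eq_zero_iff_ae_notMem.1 (measure_singleton (0 : Plane))).mono fun x hx => ?_
      have hx0 : 0 < ‖x‖ := norm_pos_iff.2 hx
      refine Filter.Tendsto.mul_const _ ?_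
      have h1 : Filter.Tendsto (fun n => ‖x‖ ^ 2 + δ n ^ 2) Filter.atTop (nhds (‖x‖ ^ 2)) := by
        simpa using (hδlim.pow 2).const_add (‖x‖ ^ 2)
      have h2 := (h1.log (by positivity)).div_const 2
      rwa [Real.log_pow, Nat.cast_ofNat, mul_div_cancel_left₀ _ two_ne_zero] at h2
  set M' : ℝ → ℝ := fun r => ∫ θ in (-Real.pi)..Real.pi, fderiv ℝ φ (polarPt r θ) (polarPt 1 θ)
    with hM'
  have cP1 : Continuous fun p : ℝ × ℝ => polarPt 1 p.2 :=
    continuous_polarPt.comp (by fun_prop : Continuous fun p : ℝ × ℝ => ((1 : ℝ), p.2))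
  have cunc : Continuous (Function.uncurry fun r θ => fderiv ℝ φ (polarPt r θ) (polarPt 1 θ)) := by
    simp only [Function.uncurry_def]
    exact (cdφ.comp cP).clm_apply cP1
  have cM' : Continuous M' := continuous_intervalIntegral_param cunc
  have dM : ∀ r, HasDerivAt (fun r => ∫ θ in (-Real.pi)..Real.pi, φ (polarPt r θ)) (M' r) r :=
    hasDerivAt_intervalIntegral_param (F := fun r θ => φ (polarPt r θ))
      (hφ.continuous.comp cP) cunc fun r θ =>
        ((hφ.differentiable (by norm_num) _).hasFDerivAt).comp_hasDerivAt r
          (hasDerivAt_polarPt_left r θ)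
  have lim2 : Filter.Tendsto (fun n => ∫ r in (0 : ℝ)..R, r ^ 2 / (r ^ 2 + δ n ^ 2) * M' r)
      Filter.atTop (nhds (∫ r in (0 : ℝ)..R, M' r)) := by
    refine intervalIntegral.tendsto_integral_filter_of_dominated_convergence (fun r => |M' r|)
      (.of_forall fun n => ?_) (.of_forall fun n => .of_forall fun r _ => ?_)
      (cM'.abs.intervalIntegrable _ _) (.of_forall fun r hr => ?_)
    · have : Continuous fun r : ℝ => r ^ 2 / (r ^ 2 + δ n ^ 2) :=
        (by fun_prop : Continuous fun r : ℝ => r ^ 2).div (by fun_prop) fun r => by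
          have := hδ0 n; positivity
      exact (this.mul cM').aestronglyMeasurable
    · rw [norm_mul, Real.norm_eq_abs, Real.norm_eq_abs]
      refine mul_le_of_le_one_left (abs_nonneg _) ?_
      rw [abs_of_nonneg (by positivity)]
      exact div_le_one_of_le₀ (by nlinarith [hδ0 n]) (by positivity)
    · rw [Set.uIoc_of_le hR0.le] at hr
      have hr0 : r ^ 2 ≠ 0 := pow_ne_zero _ hr.1.ne'
      have h1 : Filter.Tendsto (fun n => r ^ 2 / (r ^ 2 + δ n ^ 2)) Filter.atTop
          (nhds (r ^ 2 / (r ^ 2 + 0 ^ 2))) :=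
        tendsto_const_nhds.div ((hδlim.pow 2).const_add _) (by simpa using hr0)
      have h2 := h1.mul_const (M' r)
      simpa [hr.1.ne'] using h2
  -- `M'` is the derivative of the integral of `φ` over the angle, which vanishes at radius `R` and
  -- is `2π φ(0)` at radius `0`.
  have hval : ∫ r in (0 : ℝ)..R, M' r = -(2 * Real.pi * φ 0) := by
    rw [intervalIntegral.integral_eq_sub_of_hasDerivAt (fun r _ => dM r)
      (cM'.intervalIntegrable _ _)]
    have : ∀ θ, φ (polarPt R θ) = 0 := fun θ => image_eq_zero_of_notMem_tsupport
      (hR _ (by rw [norm_polarPt]; exact le_abs_self R))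
    simp only [this, polarPt_zero, intervalIntegral.integral_const, smul_eq_mul]
    ring
  have heq : ∀ n, ∫ x, Real.log (‖x‖ ^ 2 + δ n ^ 2) / 2 * D x =
      -∫ r in (0 : ℝ)..R, r ^ 2 / (r ^ 2 + δ n ^ 2) * M' r := fun n =>
    integral_log_add_mul_laplacian hφ hR0.le hR (hδ0 n)
  simp_rw [heq] at lim1
  have := tendsto_nhds_unique lim1 lim2.neg
  rw [this, hval, neg_neg]

/-! ### Integrability of the field and growth of its logarithmic potential -/

/-- The integrability properties of the magnetic field that the estimates use. -/
structure IsIntegrableField (B : Plane → ℝ) : Prop where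
  integrable : Integrable B
  integrable_sq : Integrable fun y => B y ^ 2
  integrable_log : Integrable fun y => B y * Real.log (1 + ‖y‖)

/-- Inside a disc, `L^p` with `p > 2` embeds in `L²` and `L¹`. Outside, a multiple of `(1+|x|)^{-τ}`
dominates, and `(1+|x|)^{-s}` is integrable on the plane for `s > 2`. -/
lemma FieldAssumption.isIntegrableField {B : Plane → ℝ} (hB : FieldAssumption B) :
    IsIntegrableField B := by
  obtain ⟨⟨p, hp, hpB⟩, τ, hτ, C, R, hR, hdec⟩ := hB
  have hmeas : AEStronglyMeasurable B := by
    have : (⋃ n : ℕ, Metric.closedBall (0 : Plane) n) = Set.univ := Metric.iUnion_closedBall_nat 0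
    rw [← Measure.restrict_univ (μ := volume), ← this]
    exact AEStronglyMeasurable.iUnion fun n => (hpB _ (isCompact_closedBall _ _)).1
  set K : Set Plane := Metric.closedBall 0 R with hK
  have hKc : IsCompact K := isCompact_closedBall _ _
  have : IsFiniteMeasure (volume.restrict K) := ⟨by simpa using hKc.measure_lt_top⟩
  have hL2 : MemLp B 2 (volume.restrict K) := (hpB K hKc).mono_exponent hp.le
  have hin1 : IntegrableOn B K := hL2.integrable (by norm_num)
  have hin2 : IntegrableOn (fun y => B y ^ 2) K := hL2.integrable_sq
  -- For `|x| ≥ R` one has `1 + |x| ≤ (1 + 1/R)|x|`, which trades `|x|^{-τ}` for `(1+|x|)^{-τ}`.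
  set C' : ℝ := |C| * (1 + 1 / R) ^ τ with hC'
  have hC'0 : 0 ≤ C' := by positivity
  have hout : ∀ᵐ x : Plane, x ∈ Kᶜ → |B x| ≤ C' * (1 + ‖x‖) ^ (-τ) := by
    filter_upwards [hdec] with x hx hxK
    have hRx : R < ‖x‖ := by simpa [hK] using hxK
    have hx0 : 0 < ‖x‖ := hR.trans hRx
    have h1 : ‖x‖ ^ (-τ) ≤ (1 + 1 / R) ^ τ * (1 + ‖x‖) ^ (-τ) := by
      rw [Real.rpow_neg hx0.le, Real.rpow_neg (by positivity), ← div_eq_mul_inv,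
        ← Real.div_rpow (by positivity) (by positivity), ← Real.inv_rpow hx0.le]
      refine Real.rpow_le_rpow (by positivity) ?_ (by linarith)
      rw [le_div_iff₀ (by positivity), inv_mul_le_iff₀ hx0]
      have : 1 ≤ ‖x‖ * (1 / R) := by
        rw [mul_one_div, le_div_iff₀ hR]; linarith
      linarith
    calc |B x| ≤ C * ‖x‖ ^ (-τ) := hx hRx.le
      _ ≤ |C| * ‖x‖ ^ (-τ) := by gcongr; exact le_abs_self C
      _ ≤ |C| * ((1 + 1 / R) ^ τ * (1 + ‖x‖) ^ (-τ)) := by gcongr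
      _ = C' * (1 + ‖x‖) ^ (-τ) := by rw [hC', mul_assoc]
  have hjap : ∀ s : ℝ, 2 < s → Integrable fun x : Plane => (1 + ‖x‖) ^ (-s) := fun s hs =>
    integrable_one_add_norm (by simpa using hs)
  have glue : ∀ {f g : Plane → ℝ}, AEStronglyMeasurable f → IntegrableOn f K → Integrable g →
      (∀ᵐ x : Plane, x ∈ Kᶜ → |f x| ≤ g x) → Integrable f := by
    intro f g hf hfK hg hfg
    rw [← integrableOn_univ, ← Set.union_compl_self K]
    refine hfK.union ?_
    exact Integrable.mono' hg.integrableOn hf.restrict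
      ((ae_restrict_iff' hKc.measurableSet.compl).2 hfg)
  refine ⟨?_, ?_, ?_⟩
  · exact glue hmeas hin1 ((hjap τ hτ).const_mul C') hout
  · refine glue (hmeas.pow 2) hin2 ((hjap τ hτ).const_mul (C' ^ 2)) ?_
    filter_upwards [hout] with x hx hxK
    have h1 : (1 + ‖x‖) ^ (-τ) ≤ 1 :=
      Real.rpow_le_one_of_one_le_of_nonpos (by linarith [norm_nonneg x]) (by linarith)
    have h0 : 0 ≤ (1 + ‖x‖) ^ (-τ) := by positivity
    rw [abs_pow]
    calc |B x| ^ 2 ≤ (C' * (1 + ‖x‖) ^ (-τ)) ^ 2 := by gcongr; exact hx hxK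
      _ = C' ^ 2 * ((1 + ‖x‖) ^ (-τ) * (1 + ‖x‖) ^ (-τ)) := by ring
      _ ≤ C' ^ 2 * (1 + ‖x‖) ^ (-τ) := by
        gcongr; exact mul_le_of_le_one_left h0 h1
  · have hlogc : Continuous fun y : Plane => Real.log (1 + ‖y‖) :=
      (by fun_prop : Continuous fun y : Plane => 1 + ‖y‖).log fun y => by positivity
    -- Half of the excess of `τ` over `2` absorbs the logarithm.
    set ε : ℝ := (τ - 2) / 2 with hε
    have hε0 : 0 < ε := by rw [hε]; linarith
    refine glue (hmeas.mul hlogc.aestronglyMeasurable)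
      (hin1.mul_continuousOn hlogc.continuousOn hKc)
      ((hjap (τ - ε) (by rw [hε]; linarith)).const_mul (C' / ε)) ?_
    filter_upwards [hout] with x hx hxK
    have hx1 : 0 < 1 + ‖x‖ := by positivity
    have h1 : 0 ≤ Real.log (1 + ‖x‖) := Real.log_nonneg (by linarith [norm_nonneg x])
    rw [abs_mul, abs_of_nonneg h1]
    calc |B x| * Real.log (1 + ‖x‖) ≤ (C' * (1 + ‖x‖) ^ (-τ)) * ((1 + ‖x‖) ^ ε / ε) :=
          mul_le_mul (hx hxK) (Real.log_le_rpow_div hx1.le hε0) h1 (by positivity)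
      _ = C' / ε * ((1 + ‖x‖) ^ (-τ) * (1 + ‖x‖) ^ ε) := by ring
      _ = C' / ε * (1 + ‖x‖) ^ (-(τ - ε)) := by
        rw [← Real.rpow_add hx1]; congr 2; ring

/-- If `|x-y| < 1`, then `1 + |x| ≤ 2(1+|y|)` and the singularity is `logKernel`. Otherwise `1 + |x|
≤ 2(1+|y|)|x-y|` and `|x-y| ≤ (1+|x|)(1+|y|)`. -/
lemma abs_log_norm_sub_sub_log_le (x y : Plane) :
    |Real.log ‖x - y‖ - Real.log (1 + ‖x‖)| ≤
      Real.log 2 + Real.log (1 + ‖y‖) + logKernel (x - y) := by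
  have hx : 0 < 1 + ‖x‖ := by positivity
  have hy : 0 < 1 + ‖y‖ := by positivity
  have hy1 : 0 ≤ Real.log (1 + ‖y‖) := Real.log_nonneg (by linarith [norm_nonneg y])
  have hx1 : 0 ≤ Real.log (1 + ‖x‖) := Real.log_nonneg (by linarith [norm_nonneg x])
  have h2 : 0 ≤ Real.log 2 := Real.log_nonneg one_le_two
  have htri : ‖x‖ ≤ ‖x - y‖ + ‖y‖ := by simpa using norm_add_le (x - y) y
  by_cases hz : x - y ∈ Metric.ball (0 : Plane) 1
  · have hz' : ‖x - y‖ < 1 := by simpa using hz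
    have hk : logKernel (x - y) = |Real.log ‖x - y‖| := by
      simp only [logKernel, Set.indicator_of_mem hz]
    have h3 : Real.log (1 + ‖x‖) ≤ Real.log 2 + Real.log (1 + ‖y‖) := by
      rw [← Real.log_mul two_ne_zero hy.ne']
      exact Real.log_le_log hx (by linarith [norm_nonneg y])
    rw [hk, abs_le]
    constructor
    · linarith [neg_abs_le (Real.log ‖x - y‖)]
    · linarith [le_abs_self (Real.log ‖x - y‖)]
  · have hk : logKernel (x - y) = 0 := by simp only [logKernel, Set.indicator_of_notMem hz]
    have hz' : 1 ≤ ‖x - y‖ := by simpa using hz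
    have hz0 : 0 < ‖x - y‖ := by linarith
    rw [hk, add_zero, abs_le]
    constructor
    · have : Real.log (1 + ‖x‖) ≤ Real.log 2 + Real.log (1 + ‖y‖) + Real.log ‖x - y‖ := by
        rw [← Real.log_mul two_ne_zero hy.ne', ← Real.log_mul (by positivity) hz0.ne']
        refine Real.log_le_log hx ?_
        nlinarith [norm_nonneg y]
      linarith
    · have : Real.log ‖x - y‖ ≤ Real.log (1 + ‖x‖) + Real.log (1 + ‖y‖) := by
        rw [← Real.log_mul hx.ne' hy.ne']
        refine Real.log_le_log hz0 ?_
        nlinarith [norm_sub_le x y, norm_nonneg x, norm_nonneg y,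
          mul_nonneg (norm_nonneg x) (norm_nonneg y)]
      linarith

namespace IsIntegrableField

/-- The point is that `M` does not depend on `x`: the product of `|B|` and the singular kernel is
split by `2ab ≤ a² + b²`, and the integral of the squared kernel is translation invariant. -/
lemma exists_majorant {B : Plane → ℝ} (hB : IsIntegrableField B)
    : ∃ M : ℝ, ∀ x : Plane, ∃ m : Plane → ℝ, Integrable m ∧ ∫ y, m y = M ∧
    ∀ y, |B y| * |Real.log ‖x - y‖ - Real.log (1 + ‖x‖)| ≤ m y := by
  have i1 : Integrable fun y => |B y| * Real.log 2 + |B y| * Real.log (1 + ‖y‖) + B y ^ 2 / 2 := by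
    refine ((hB.integrable.abs.mul_const _).add ?_).add (hB.integrable_sq.div_const 2)
    refine hB.integrable_log.abs.congr (.of_forall fun y => ?_)
    simp only [abs_mul]
    rw [abs_of_nonneg (Real.log_nonneg (by linarith [norm_nonneg y] : 1 ≤ 1 + ‖y‖))]
  refine ⟨(∫ y, (|B y| * Real.log 2 + |B y| * Real.log (1 + ‖y‖) + B y ^ 2 / 2)) +
    ∫ z, logKernel z ^ 2 / 2, fun x => ⟨fun y =>
    (|B y| * Real.log 2 + |B y| * Real.log (1 + ‖y‖) + B y ^ 2 / 2) + logKernel (x - y) ^ 2 / 2,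
    ?_, ?_, fun y => ?_⟩⟩
  · exact i1.add ((integrable_logKernel_sq.comp_sub_left x).div_const 2)
  · rw [integral_add i1 ((integrable_logKernel_sq.comp_sub_left x).div_const 2)]
    congr 1
    exact integral_sub_left_eq_self (fun z => logKernel z ^ 2 / 2) volume x
  · have h1 := mul_le_mul_of_nonneg_left (abs_log_norm_sub_sub_log_le x y) (abs_nonneg (B y))
    have h2 := two_mul_le_add_sq (|B y|) (logKernel (x - y))
    rw [sq_abs] at h2
    linarith

lemma aestronglyMeasurable_kernel {B : Plane → ℝ} (hB : IsIntegrableField B) :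
    AEStronglyMeasurable (fun p : Plane × Plane => B p.2 * Real.log ‖p.1 - p.2‖)
      (volume.prod volume) :=
  hB.integrable.aestronglyMeasurable.comp_snd.mul
    (Real.measurable_log.comp (measurable_fst.sub measurable_snd).norm).aestronglyMeasurable

lemma integrable_mul_log_norm_sub {B : Plane → ℝ} (hB : IsIntegrableField B)
    (x : Plane) : Integrable fun y => B y * Real.log ‖x - y‖ := by
  obtain ⟨M, hM⟩ := hB.exists_majorant
  obtain ⟨m, hm, -, hmB⟩ := hM x
  have h1 : Integrable fun y => B y * (Real.log ‖x - y‖ - Real.log (1 + ‖x‖)) :=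
    hm.mono' (hB.integrable.aestronglyMeasurable.mul
      ((Real.measurable_log.comp (measurable_const.sub measurable_id).norm).sub
        measurable_const).aestronglyMeasurable)
      (.of_forall fun y => by rw [norm_mul]; exact hmB y)
  refine (h1.add (hB.integrable.mul_const (Real.log (1 + ‖x‖)))).congr (.of_forall fun y => ?_)
  simp only [Pi.add_apply]
  ring

/-- Subtracting `log(1+|x|)` under the integral removes exactly the flux times `log(1+|x|)`, and the
remainder is bounded by the common majorant. -/
lemma exists_abs_logPotential_le {B : Plane → ℝ} (hB : IsIntegrableField B) : ∃ M : ℝ, 0 ≤ M ∧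
    ∀ x, |-logPotential B x - flux B * Real.log (1 + ‖x‖)| ≤ M := by
  obtain ⟨M, hM⟩ := hB.exists_majorant
  refine ⟨1 / (2 * Real.pi) * |M|, by have := Real.pi_pos; positivity, fun x => ?_⟩
  obtain ⟨m, hm, hmM, hmB⟩ := hM x
  have h1 : -logPotential B x - flux B * Real.log (1 + ‖x‖) =
      1 / (2 * Real.pi) * ∫ y, B y * (Real.log ‖x - y‖ - Real.log (1 + ‖x‖)) := by
    simp_rw [mul_sub]
    rw [integral_sub (hB.integrable_mul_log_norm_sub x) (hB.integrable.mul_const _),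
      integral_mul_const, logPotential, flux]
    ring
  rw [h1, abs_mul, abs_of_pos (by have := Real.pi_pos; positivity)]
  refine mul_le_mul_of_nonneg_left ?_ (by have := Real.pi_pos; positivity)
  refine (abs_integral_le_integral_abs).trans (le_trans ?_ (le_abs_self M))
  rw [← hmM]
  refine integral_mono_of_nonneg (.of_forall fun y => abs_nonneg _) hm (.of_forall fun y => ?_)
  dsimp only
  rw [abs_mul]
  exact hmB y

/-- Both `e^{-h}` and `g₊` are comparable with `(1+|x|)^α`. This yields positivity of `k₊` and
finiteness of `K₊`. -/
lemma exists_abs_log_ratio_le {B : Plane → ℝ} (hB : IsIntegrableField B)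
    {ρ : ℝ} (hρ : 0 < ρ) : ∃ M : ℝ,
    ∀ x, |-logPotential B x - Real.log (gPlus (flux B) ρ ‖x‖)| ≤ M := by
  obtain ⟨M, hM0, hM⟩ := hB.exists_abs_logPotential_le
  refine ⟨M + |flux B| * (Real.log (1 + 1 / ρ) + Real.log (1 + ρ) + |Real.log ρ|), fun x => ?_⟩
  have hmax : 0 < max ρ ‖x‖ := lt_max_of_lt_left hρ
  have hg : Real.log (gPlus (flux B) ρ ‖x‖) = flux B * (Real.log (max ρ ‖x‖) - Real.log ρ) := by
    rw [gPlus_eq hρ, Real.log_mul (by positivity) (by positivity), Real.log_rpow hρ,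
      Real.log_rpow hmax]
    ring
  have hx : 0 < 1 + ‖x‖ := by positivity
  have h1 : Real.log (1 + ‖x‖) ≤ Real.log (1 + 1 / ρ) + Real.log (max ρ ‖x‖) := by
    rw [← Real.log_mul (by positivity) hmax.ne']
    refine Real.log_le_log hx ?_
    have : 1 ≤ 1 / ρ * max ρ ‖x‖ := by
      rw [one_div_mul_eq_div, le_div_iff₀ hρ, one_mul]; exact le_max_left _ _
    linarith [le_max_right ρ ‖x‖]
  have h2 : Real.log (max ρ ‖x‖) ≤ Real.log (1 + ρ) + Real.log (1 + ‖x‖) := by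
    rw [← Real.log_mul (by positivity) hx.ne']
    refine Real.log_le_log hmax (max_le ?_ ?_) <;> nlinarith [norm_nonneg x]
  have h3 : 0 ≤ Real.log (1 + 1 / ρ) := Real.log_nonneg (by
    have : 0 < 1 / ρ := by positivity
    linarith)
  have h4 : 0 ≤ Real.log (1 + ρ) := Real.log_nonneg (by linarith)
  have h5 : |Real.log (1 + ‖x‖) - Real.log (max ρ ‖x‖) + Real.log ρ| ≤
      Real.log (1 + 1 / ρ) + Real.log (1 + ρ) + |Real.log ρ| := by
    refine (abs_add_le _ _).trans (add_le_add_left (abs_le.2 ⟨by linarith, by linarith⟩) _)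
  have h6 : -logPotential B x - Real.log (gPlus (flux B) ρ ‖x‖) =
      (-logPotential B x - flux B * Real.log (1 + ‖x‖)) +
      flux B * (Real.log (1 + ‖x‖) - Real.log (max ρ ‖x‖) + Real.log ρ) := by
    rw [hg]; ring
  rw [h6]
  refine (abs_add_le _ _).trans (add_le_add (hM x) ?_)
  rw [abs_mul]
  exact mul_le_mul_of_nonneg_left h5 (abs_nonneg _)

lemma ratioPlus_eq_exp {B : Plane → ℝ} {ρ : ℝ} (hρ : 0 < ρ) (x : Plane) : ratioPlus B ρ x =
    Real.exp (-logPotential B x - Real.log (gPlus (flux B) ρ ‖x‖)) := by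
  rw [ratioPlus, Real.exp_sub, Real.exp_log (gPlus_pos hρ)]

lemma kPlus_pos {B : Plane → ℝ} (hB : IsIntegrableField B)
    {ρ : ℝ} (hρ : 0 < ρ) : 0 < kPlus B ρ := by
  obtain ⟨M, hM⟩ := hB.exists_abs_log_ratio_le hρ
  refine (Real.exp_pos (-M)).trans_le (le_ciInf fun x => ?_)
  rw [ratioPlus_eq_exp hρ]
  exact Real.exp_le_exp.2 (abs_le.1 (hM x)).1

lemma bddAbove_ratioPlus {B : Plane → ℝ} (hB : IsIntegrableField B)
    {ρ : ℝ} (hρ : 0 < ρ) : BddAbove (Set.range (ratioPlus B ρ)) := by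
  obtain ⟨M, hM⟩ := hB.exists_abs_log_ratio_le hρ
  refine ⟨Real.exp M, ?_⟩
  rintro _ ⟨x, rfl⟩
  rw [ratioPlus_eq_exp hρ]
  exact Real.exp_le_exp.2 (abs_le.1 (hM x)).2

lemma kPlus_le {B : Plane → ℝ} {ρ : ℝ} (hρ : 0 < ρ) (x : Plane) : kPlus B ρ ≤ ratioPlus B ρ x :=
  ciInf_le ⟨0, by
    rintro _ ⟨x, rfl⟩
    simp only [ratioPlus_eq_exp hρ]
    positivity⟩ x

lemma le_KPlus {B : Plane → ℝ} (hB : IsIntegrableField B)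
    {ρ : ℝ} (hρ : 0 < ρ) (x : Plane) : ratioPlus B ρ x ≤ KPlus B ρ :=
  le_ciSup (hB.bddAbove_ratioPlus hρ) x

lemma locallyIntegrable_logPotential {B : Plane → ℝ} (hB : IsIntegrableField B)
    : LocallyIntegrable (logPotential B) := by
  obtain ⟨M, hM0, hM⟩ := hB.exists_abs_logPotential_le
  have hc : Continuous fun x : Plane => M + |flux B| * Real.log (1 + ‖x‖) :=
    continuous_const.add (continuous_const.mul
      ((by fun_prop : Continuous fun y : Plane => 1 + ‖y‖).log fun y => by positivity))
  refine hc.locallyIntegrable.mono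
    (hB.aestronglyMeasurable_kernel.integral_prod_right'.const_mul _) (.of_forall fun x => ?_)
  refine le_trans ?_ (le_abs_self _)
  have h1 : -logPotential B x = (-logPotential B x - flux B * Real.log (1 + ‖x‖)) +
    flux B * Real.log (1 + ‖x‖) := by ring
  rw [Real.norm_eq_abs, ← abs_neg, h1]
  refine (abs_add_le _ _).trans (add_le_add (hM x) ?_)
  rw [abs_mul, abs_of_nonneg (Real.log_nonneg (by linarith [norm_nonneg x] : 1 ≤ 1 + ‖x‖))]

/-- `-Δ h = B` in the sense of distributions. -/
lemma integral_logPotential_mul_laplacian {B : Plane → ℝ} (hB : IsIntegrableField B)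
    {φ : Plane → ℝ} (hφ : ContDiff ℝ 2 φ)
    (hφc : HasCompactSupport φ) :
    ∫ x, logPotential B x * (pderiv 0 (pderiv 0 φ) x + pderiv 1 (pderiv 1 φ) x) =
      -∫ y, B y * φ y := by
  obtain ⟨M, hM⟩ := hB.exists_majorant
  set D : Plane → ℝ := fun x => pderiv 0 (pderiv 0 φ) x + pderiv 1 (pderiv 1 φ) x with hD
  have s1 : ∀ i, ContDiff ℝ 1 (pderiv i φ) := fun i => ContDiff.pderiv hφ (by norm_num) i
  have c2 : ∀ i, Continuous (pderiv i (pderiv i φ)) := fun i =>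
    (ContDiff.pderiv (m := 0) (s1 i) (by norm_num) i).continuous
  have cD : Continuous D := (c2 0).add (c2 1)
  have csD : HasCompactSupport D :=
    (HasCompactSupport.pderiv (HasCompactSupport.pderiv hφc 0) 0).add
      (HasCompactSupport.pderiv (HasCompactSupport.pderiv hφc 1) 1)
  have clog : Continuous fun x : Plane => Real.log (1 + ‖x‖) :=
    (by fun_prop : Continuous fun y : Plane => 1 + ‖y‖).log fun y => by positivity
  have hmeas : AEStronglyMeasurable
      (fun p : Plane × Plane => B p.2 * Real.log ‖p.1 - p.2‖ * D p.1) (volume.prod volume) :=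
    hB.aestronglyMeasurable_kernel.mul cD.aestronglyMeasurable.comp_fst
  have hbound : ∀ x, ∫ y, |B y * Real.log ‖x - y‖| ≤
      M + (∫ y, |B y|) * Real.log (1 + ‖x‖) := fun x => by
    obtain ⟨m, hm, hmM, hmB⟩ := hM x
    rw [← hmM, ← integral_mul_const, ← integral_add hm (hB.integrable.abs.mul_const _)]
    refine integral_mono (hB.integrable_mul_log_norm_sub x).abs
      (hm.add (hB.integrable.abs.mul_const _)) fun y => ?_
    dsimp only
    rw [abs_mul]
    refine le_trans ?_ (add_le_add_left (hmB y) _)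
    rw [← mul_add]
    refine mul_le_mul_of_nonneg_left ?_ (abs_nonneg _)
    have h1 : Real.log ‖x - y‖ = (Real.log ‖x - y‖ - Real.log (1 + ‖x‖)) + Real.log (1 + ‖x‖) := by
      ring
    conv_lhs => rw [h1]
    refine (abs_add_le _ _).trans_eq ?_
    rw [abs_of_nonneg (Real.log_nonneg (by linarith [norm_nonneg x] : 1 ≤ 1 + ‖x‖))]
  -- Absolute integrability for Fubini: the inner integral grows at most logarithmically in `x`, and
  -- `D` is continuous with compact support.
  have hint : Integrable (fun p : Plane × Plane => B p.2 * Real.log ‖p.1 - p.2‖ * D p.1)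
      (volume.prod volume) := by
    rw [integrable_prod_iff hmeas]
    refine ⟨.of_forall fun x => (hB.integrable_mul_log_norm_sub x).mul_const (D x), ?_⟩
    have hc : Continuous fun x : Plane => (M + (∫ y, |B y|) * Real.log (1 + ‖x‖)) * |D x| := by
      fun_prop
    refine (hc.integrable_of_hasCompactSupport csD.abs.mul_left).mono'
      hmeas.norm.integral_prod_right' (.of_forall fun x => ?_)
    rw [Real.norm_eq_abs, abs_of_nonneg (integral_nonneg fun y => norm_nonneg _)]
    simp only [norm_mul _ (D x), integral_mul_const, Real.norm_eq_abs]
    exact mul_le_mul_of_nonneg_right (hbound x) (abs_nonneg _)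
  -- The fundamental solution identity at the origin, applied to the translate of `φ` by `y`.
  have hinner : ∀ y, ∫ x, Real.log ‖x - y‖ * D x = 2 * Real.pi * φ y := fun y => by
    rw [← integral_add_right_eq_self _ y]
    have hp : ∀ (i : Fin 2) (f : Plane → ℝ) x, pderiv i (fun x => f (x + y)) x =
        pderiv i f (x + y) := fun i f x => by
      rw [pderiv, fderiv_comp_add_right]; rfl
    have := integral_log_norm_mul_laplacian (φ := fun x => φ (x + y))
      (hφ.comp (contDiff_id.add contDiff_const))
      (hφc.comp_homeomorph (Homeomorph.addRight y))
    have hp' : ∀ i : Fin 2, pderiv i (fun x => φ (x + y)) = fun x => pderiv i φ (x + y) :=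
      fun i => funext fun x => hp i φ x
    simp only [hp', hp, zero_add] at this
    simpa only [add_sub_cancel_right] using this
  have hpi : (2 * Real.pi) ≠ 0 := by have := Real.pi_pos; positivity
  calc ∫ x, logPotential B x * D x
      = -(1 / (2 * Real.pi)) * ∫ x, ∫ y, B y * Real.log ‖x - y‖ * D x := by
        rw [← integral_const_mul]
        refine integral_congr_ae (.of_forall fun x => ?_)
        simp only [logPotential, integral_mul_const]
        ring
    _ = -(1 / (2 * Real.pi)) * ∫ y, ∫ x, B y * Real.log ‖x - y‖ * D x := by
        rw [integral_integral_swap hint]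
    _ = -(1 / (2 * Real.pi)) * ∫ y, 2 * Real.pi * (B y * φ y) := by
        congr 1
        refine integral_congr_ae (.of_forall fun y => ?_)
        simp only [mul_assoc, integral_const_mul, hinner]
        ring
    _ = -∫ y, B y * φ y := by
        rw [integral_const_mul]
        field_simp

end IsIntegrableField

/-! ### Mollification and the gauge transformation -/

lemma two_le_infty : (2 : WithTop ℕ∞) ≤ (∞ : WithTop ℕ∞) := by
  change ((2 : ℕ∞) : WithTop ℕ∞) ≤ ((⊤ : ℕ∞) : WithTop ℕ∞)
  exact WithTop.coe_le_coe.2 le_top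

section moll

variable {E : Type*} [NormedAddCommGroup E] [NormedSpace ℝ E]

open scoped Convolution in
/-- The mollification of `f` with the kernel `ψ`. -/
noncomputable def moll (ψ : Plane → ℝ) (f : Plane → E) : Plane → E :=
  ψ ⋆[ContinuousLinearMap.lsmul ℝ ℝ, volume] f

lemma moll_apply (ψ : Plane → ℝ) (f : Plane → E) (x : Plane) :
    moll ψ f x = ∫ t, ψ t • f (x - t) := rfl

lemma moll_apply' (ψ : Plane → ℝ) (f : Plane → E) (x : Plane) :
    moll ψ f x = ∫ t, ψ (x - t) • f t := convolution_lsmul_swap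

lemma contDiff_moll {ψ : Plane → ℝ} (hψ : ContDiff ℝ ∞ ψ) (hψc : HasCompactSupport ψ)
    {f : Plane → E} (hf : LocallyIntegrable f) : ContDiff ℝ ∞ (moll ψ f) :=
  hψc.contDiff_convolution_left _ hψ hf

lemma pderiv_moll {ψ : Plane → ℝ} (hψ : ContDiff ℝ ∞ ψ) (hψc : HasCompactSupport ψ)
    {f : Plane → E} (hf : LocallyIntegrable f) (i : Fin 2) :
    pderiv i (moll ψ f) = moll (pderiv i ψ) f := by
  ext x
  have hψ1 : ContDiff ℝ 1 ψ := hψ.of_le (by exact_mod_cast le_top)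
  have h1 := hψc.hasFDerivAt_convolution_right (ContinuousLinearMap.lsmul ℝ ℝ).flip hf hψ1 x
  rw [convolution_flip] at h1
  have h2 := pderiv_eq_of_hasFDerivAt h1 i
  rw [convolution_precompR_apply _ hf (hψc.fderiv (𝕜 := ℝ)) (hψ1.continuous_fderiv one_ne_zero),
    convolution_flip] at h2
  exact h2

lemma pderiv_comp_const_sub {f : Plane → E} (hf : Differentiable ℝ f) (i : Fin 2) (x t : Plane) :
    pderiv i (fun t => f (x - t)) t = -pderiv i f (x - t) := by
  have h := (hf (x - t)).hasFDerivAt.comp t ((hasFDerivAt_id t).const_sub x)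
  refine (pderiv_eq_of_hasFDerivAt h i).trans ?_
  simp [pderiv]

lemma isTestFunction_comp_const_sub {ψ : Plane → ℝ} (hψ : ContDiff ℝ ∞ ψ)
    (hψc : HasCompactSupport ψ) (x : Plane) : IsTestFunction fun t => ψ (x - t) :=
  ⟨hψ.comp (contDiff_const.sub contDiff_id), hψc.comp_homeomorph (Homeomorph.subLeft x)⟩

end moll

/-- A mollified vector potential has the mollified magnetic field. -/
lemma curl_moll {ψ : Plane → ℝ} (hψ : ContDiff ℝ ∞ ψ) (hψc : HasCompactSupport ψ)
    {A : Plane → Plane} {B : Plane → ℝ} (hcurl : HasDistribCurl A B)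
    (hA : ∀ j, LocallyIntegrable fun x => A x j) (x : Plane) :
    pderiv 0 (moll ψ fun x => A x 1) x - pderiv 1 (moll ψ fun x => A x 0) x =
      ∫ t, B t * ψ (x - t) := by
  have hc : ∀ i, Continuous (pderiv i ψ) := fun i =>
    (ContDiff.pderiv (m := 0) hψ (by norm_num) i).continuous
  have hi : ∀ i j, Integrable fun t => pderiv i ψ (x - t) * A t j := fun i j => by
    have := (hA j).integrable_smul_left_of_hasCompactSupport
      (g := fun t => pderiv i ψ (x - t)) ((hc i).comp (by fun_prop))
      ((HasCompactSupport.pderiv hψc i).comp_homeomorph (Homeomorph.subLeft x))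
    exact this
  rw [pderiv_moll hψ hψc (hA 1), pderiv_moll hψ hψc (hA 0), moll_apply', moll_apply',
    ← hcurl _ (isTestFunction_comp_const_sub hψ hψc x)]
  simp only [smul_eq_mul]
  rw [← integral_sub (hi 0 1) (hi 1 0)]
  refine integral_congr_ae (.of_forall fun t => ?_)
  simp only [partialDeriv_eq, pderiv_comp_const_sub (hψ.differentiable (by simp))]
  ring

/-- Together with `curl_moll` this shows that the mollified `A` and the mollified `h` satisfy `curl
= -Δ` pointwise, without error, as `exists_gauge` requires. -/
lemma laplacian_moll {ψ : Plane → ℝ} (hψ : ContDiff ℝ ∞ ψ) (hψc : HasCompactSupport ψ)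
    {B : Plane → ℝ} (hB : IsIntegrableField B) (x : Plane) :
    pderiv 0 (pderiv 0 (moll ψ (logPotential B))) x +
      pderiv 1 (pderiv 1 (moll ψ (logPotential B))) x = -∫ t, B t * ψ (x - t) := by
  have hh := hB.locallyIntegrable_logPotential
  have hs : ∀ i, ContDiff ℝ ∞ (pderiv i ψ) := fun i => ContDiff.pderiv hψ (by norm_num) i
  have hcs : ∀ i, HasCompactSupport (pderiv i ψ) := fun i => HasCompactSupport.pderiv hψc i
  have hi : ∀ i, Integrable fun t => pderiv i (pderiv i ψ) (x - t) * logPotential B t := fun i => by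
    have := hh.integrable_smul_left_of_hasCompactSupport
      (g := fun t => pderiv i (pderiv i ψ) (x - t))
      ((ContDiff.pderiv (m := 0) (hs i) (by norm_num) i).continuous.comp (by fun_prop))
      ((HasCompactSupport.pderiv (hcs i) i).comp_homeomorph (Homeomorph.subLeft x))
    exact this
  have ht := isTestFunction_comp_const_sub hψ hψc x
  rw [← hB.integral_logPotential_mul_laplacian (ht.1.of_le two_le_infty) ht.2]
  rw [pderiv_moll hψ hψc hh, pderiv_moll hψ hψc hh, pderiv_moll (hs 0) (hcs 0) hh,
    pderiv_moll (hs 1) (hcs 1) hh, moll_apply', moll_apply']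
  simp only [smul_eq_mul]
  rw [← integral_add (hi 0) (hi 1)]
  refine integral_congr_ae (.of_forall fun t => ?_)
  have e : ∀ i, pderiv i (fun t => ψ (x - t)) = fun t => -pderiv i ψ (x - t) := fun i =>
    funext fun t => pderiv_comp_const_sub (hψ.differentiable (by simp)) i x t
  have e' : ∀ (i : Fin 2) (f : Plane → ℝ), pderiv i (fun t => -f t) t = -pderiv i f t :=
    fun i f => by
      rw [pderiv, pderiv, show (fun t => -f t) = -f from rfl, fderiv_neg]
      rfl
  simp only [e, e', pderiv_comp_const_sub ((hs _).differentiable (by simp))]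
  ring

/-- A smooth vector potential of the field `-Δη` is `∇^⊥ η` up to a gauge transformation. -/
lemma exists_gauge {a₀ a₁ η : Plane → ℝ} (h₀ : ContDiff ℝ ∞ a₀) (h₁ : ContDiff ℝ ∞ a₁)
    (hη : ContDiff ℝ ∞ η) (hcurl : ∀ x, pderiv 0 a₁ x - pderiv 1 a₀ x =
      -(pderiv 0 (pderiv 0 η) x + pderiv 1 (pderiv 1 η) x)) :
    ∃ χ : Plane → ℝ, ContDiff ℝ ∞ χ ∧ (∀ x, a₀ x = pderiv 1 η x + pderiv 0 χ x) ∧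
      ∀ x, a₁ x = -pderiv 0 η x + pderiv 1 χ x := by
  set F₀ : Plane → ℝ := fun x => a₀ x - pderiv 1 η x with hF₀
  set F₁ : Plane → ℝ := fun x => a₁ x + pderiv 0 η x with hF₁
  have s₀ : ContDiff ℝ ∞ F₀ := h₀.sub (ContDiff.pderiv hη (by norm_num) 1)
  have s₁ : ContDiff ℝ ∞ F₁ := h₁.add (ContDiff.pderiv hη (by norm_num) 0)
  have dη : ∀ i, Differentiable ℝ (pderiv i η) := fun i =>
    (ContDiff.pderiv (m := 1) hη (by norm_num; exact two_le_infty) i).differentiable one_ne_zero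
  have d₀ : Differentiable ℝ F₀ := s₀.differentiable (by simp)
  have d₁ : Differentiable ℝ F₁ := s₁.differentiable (by simp)
  set P₀ : Plane →L[ℝ] ℝ := EuclideanSpace.proj 0
  set P₁ : Plane →L[ℝ] ℝ := EuclideanSpace.proj 1
  -- The difference of the two vector potentials, as a one-form. Equality of the curls makes it
  -- closed, and the Poincaré lemma on the plane provides the primitive `χ`.
  set ϖ : Plane → Plane →L[ℝ] ℝ := fun x => F₀ x • P₀ + F₁ x • P₁ with hϖ
  have sϖ : ContDiff ℝ ∞ ϖ := (s₀.smul contDiff_const).add (s₁.smul contDiff_const)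
  have hclosed : ∀ x, pderiv 0 F₁ x = pderiv 1 F₀ x := fun x => by
    have e1 : pderiv 0 F₁ x = pderiv 0 a₁ x + pderiv 0 (pderiv 0 η) x := by
      have := ((h₁.differentiable (by simp) x).hasFDerivAt).add ((dη 0 x).hasFDerivAt)
      exact pderiv_eq_of_hasFDerivAt this 0
    have e2 : pderiv 1 F₀ x = pderiv 1 a₀ x - pderiv 1 (pderiv 1 η) x := by
      have := ((h₀.differentiable (by simp) x).hasFDerivAt).sub ((dη 1 x).hasFDerivAt)
      exact pderiv_eq_of_hasFDerivAt this 1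
    rw [e1, e2]
    linarith [hcurl x]
  obtain ⟨χ, hχ⟩ : ∃ χ : Plane → ℝ, ∀ x ∈ Set.univ, HasFDerivAt χ (ϖ x) x :=
    convex_univ.exists_forall_hasFDerivAt_of_fderiv_symmetric isOpen_univ
    (sϖ.differentiable (by simp)).differentiableOn (fun x _ y z => by
      have h := (((d₀ x).hasFDerivAt).smul_const P₀).add (((d₁ x).hasFDerivAt).smul_const P₁)
      have h' : HasFDerivAt ϖ _ x := h
      rw [h'.fderiv]
      simp only [add_apply, ContinuousLinearMap.smulRight_apply,
        smul_apply, smul_eq_mul, fderiv_apply_eq]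
      have := hclosed x
      have e0 : ∀ y, P₀ y = y 0 := fun _ => rfl
      have e1 : ∀ y, P₁ y = y 1 := fun _ => rfl
      simp only [e0, e1]
      linear_combination (y 0 * z 1 - z 0 * y 1) * this)
  have hχ' : ∀ x, HasFDerivAt χ (ϖ x) x := fun x => hχ x (Set.mem_univ x)
  have hf : fderiv ℝ χ = ϖ := funext fun x => (hχ' x).fderiv
  refine ⟨χ, ?_, fun x => ?_, fun x => ?_⟩
  · rw [show (∞ : WithTop ℕ∞) = (∞ : WithTop ℕ∞) + 1 from rfl, contDiff_succ_iff_fderiv]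
    exact ⟨fun x => (hχ' x).differentiableAt, by simp, hf ▸ sϖ⟩
  · rw [pderiv_eq_of_hasFDerivAt (hχ' x)]
    simp [hϖ, P₀, P₁, hF₀]
  · rw [pderiv_eq_of_hasFDerivAt (hχ' x)]
    simp [hϖ, P₀, P₁, hF₁]

/-! ### Conjugating the first order operator to `∂₁ - i∂₂` -/

/-- The operator `(i∂₁ + a₁) - i (i∂₂ + a₂)`. -/
noncomputable def dbarOp (a : Fin 2 → Plane → ℝ) (u : Plane → ℂ) (Du : Fin 2 → Plane → ℂ)
    (x : Plane) : ℂ :=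
  (Complex.I * Du 0 x + a 0 x * u x) - Complex.I * (Complex.I * Du 1 x + a 1 x * u x)

/-- As `a₀ - i a₁ = i(∂₁ - i∂₂)w` for `w = η - iχ`, the operator is `i e^{-w}(∂₁ - i∂₂)e^w`, and
`|e^w| = e^η`. So `hardy_smooth` applies to `v = e^w u`. The lower bound on `-η` replaces `e^{-2η}`
by `e^{2lo} g₊²` in front of the derivative, and the upper bound gives `g₊² |v|² ≥ e^{-2hi} |u|²`.
-/
lemma hardy_dbarOp {a : Fin 2 → Plane → ℝ} {η χ : Plane → ℝ} (hη : ContDiff ℝ ∞ η)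
    (hχ : ContDiff ℝ ∞ χ) (ha₀ : ∀ x, a 0 x = pderiv 1 η x + pderiv 0 χ x)
    (ha₁ : ∀ x, a 1 x = -pderiv 0 η x + pderiv 1 χ x) {α ρ lo hi : ℝ} (hα : 0 < α) (hρ : 0 < ρ)
    (hlo : ∀ x, lo + Real.log (gPlus α ρ ‖x‖) ≤ -η x)
    (hhi : ∀ x, -η x ≤ hi + Real.log (gPlus α ρ ‖x‖))
    {u : Plane → ℂ} (hu : ContDiff ℝ ∞ u) (huc : HasCompactSupport u) :
    distInt α ^ 2 * Real.exp (2 * (lo - hi)) * (∫ x, ‖u x‖ ^ 2 / (ρ ^ 2 + ‖x‖ ^ 2)) ≤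
      ∫ x, ‖dbarOp a u (fun i => pderiv i u) x‖ ^ 2 := by
  set w : Plane → ℂ := fun x => (η x : ℂ) - Complex.I * χ x with hw
  have sofR : ∀ {f : Plane → ℝ}, ContDiff ℝ ∞ f → ContDiff ℝ ∞ fun x => (f x : ℂ) := fun h =>
    Complex.ofRealCLM.contDiff.comp h
  have hwd : ∀ i x, pderiv i w x = pderiv i η x - Complex.I * pderiv i χ x := fun i x => by
    have h1 := Complex.ofRealCLM.hasFDerivAt.comp x (hη.differentiable (by simp) x).hasFDerivAt
    have h2 := Complex.ofRealCLM.hasFDerivAt.comp x (hχ.differentiable (by simp) x).hasFDerivAt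
    exact pderiv_eq_of_hasFDerivAt (h1.sub (h2.const_mul Complex.I)) i
  have sw : ContDiff ℝ ∞ w := (sofR hη).sub (contDiff_const.mul (sofR hχ))
  set v : Plane → ℂ := fun x => Complex.exp (w x) * u x with hv
  have sv : ContDiff ℝ ∞ v := sw.cexp.mul hu
  have hvc : HasCompactSupport v := huc.mul_left
  have hvd : ∀ i x, pderiv i v x = Complex.exp (w x) * (pderiv i u x + pderiv i w x * u x) :=
    fun i x => by
      have h1 := ((sw.differentiable (by simp) x).hasFDerivAt.cexp).mul
        (hu.differentiable (by simp) x).hasFDerivAt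
      refine (pderiv_eq_of_hasFDerivAt h1 i).trans ?_
      simp only [add_apply, smul_apply, smul_eq_mul, pderiv]
      ring
  have hne : ∀ x, ‖Complex.exp (w x)‖ = Real.exp (η x) := fun x => by
    rw [Complex.norm_exp, hw]; simp
  have hop : ∀ x, ‖pderiv 0 v x - Complex.I * pderiv 1 v x‖ =
      Real.exp (η x) * ‖dbarOp a u (fun i => pderiv i u) x‖ := fun x => by
    have : pderiv 0 v x - Complex.I * pderiv 1 v x = Complex.exp (w x) *
        (-Complex.I * dbarOp a u (fun i => pderiv i u) x) := by
      simp only [hvd, hwd, dbarOp, ha₀, ha₁]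
      push_cast
      ring_nf
      simp only [Complex.I_sq, show Complex.I ^ 3 = -Complex.I from Complex.I_pow_three]
      ring
    rw [this, norm_mul, hne, norm_mul, norm_neg, Complex.norm_I, one_mul]
  have key := hardy_smooth (sv.of_le two_le_infty) hvc hα hρ
  have cg := continuous_gPlus (α := α) hρ
  have cη := hη.continuous
  have cu := hu.continuous
  have cv := sv.continuous
  have cpu : ∀ i, Continuous (pderiv i u) := fun i =>
    (ContDiff.pderiv (m := 0) hu (by norm_num) i).continuous
  have cpv : ∀ i, Continuous (pderiv i v) := fun i =>
    (ContDiff.pderiv (m := 0) sv (by norm_num) i).continuous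
  have hden : ∀ x : Plane, ρ ^ 2 + ‖x‖ ^ 2 ≠ 0 := fun x => by positivity
  have cw : Continuous fun x : Plane => gPlus α ρ ‖x‖ ^ 2 / (ρ ^ 2 + ‖x‖ ^ 2) :=
    (by fun_prop : Continuous fun x : Plane => gPlus α ρ ‖x‖ ^ 2).div (by fun_prop) hden
  have cq : Continuous fun x : Plane => ‖u x‖ ^ 2 / (ρ ^ 2 + ‖x‖ ^ 2) :=
    (by fun_prop : Continuous fun x : Plane => ‖u x‖ ^ 2).div (by fun_prop) hden
  have cD : Continuous fun x => dbarOp a u (fun i => pderiv i u) x := by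
    have c0 : Continuous fun x => (a 0 x : ℂ) := Complex.continuous_ofReal.comp <| by
      rw [show a 0 = fun x => pderiv 1 η x + pderiv 0 χ x from funext ha₀]
      exact (ContDiff.pderiv (m := 0) hη (by norm_num) 1).continuous.add
        (ContDiff.pderiv (m := 0) hχ (by norm_num) 0).continuous
    have c1 : Continuous fun x => (a 1 x : ℂ) := Complex.continuous_ofReal.comp <| by
      rw [show a 1 = fun x => -pderiv 0 η x + pderiv 1 χ x from funext ha₁]
      exact (ContDiff.pderiv (m := 0) hη (by norm_num) 0).continuous.neg.add
        (ContDiff.pderiv (m := 0) hχ (by norm_num) 1).continuous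
    unfold dbarOp
    fun_prop
  have sD : ∀ x, x ∉ tsupport u → dbarOp a u (fun i => pderiv i u) x = 0 := fun x hx => by
    simp [dbarOp, pderiv_eq_zero_of_notMem hx, image_eq_zero_of_notMem_tsupport hx]
  have iD : Integrable fun x => ‖dbarOp a u (fun i => pderiv i u) x‖ ^ 2 :=
    (cD.norm.pow 2).integrable_of_hasCompactSupport
      (HasCompactSupport.intro huc fun x hx => by simp [sD x hx])
  have iv : Integrable fun x => gPlus α ρ ‖x‖ ^ 2 * ‖pderiv 0 v x - Complex.I * pderiv 1 v x‖ ^ 2 :=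
    (by fun_prop : Continuous fun x => gPlus α ρ ‖x‖ ^ 2 *
      ‖pderiv 0 v x - Complex.I * pderiv 1 v x‖ ^ 2).integrable_of_hasCompactSupport
      (HasCompactSupport.intro hvc fun x hx => by simp [pderiv_eq_zero_of_notMem hx])
  have ivl : Integrable fun x => gPlus α ρ ‖x‖ ^ 2 / (ρ ^ 2 + ‖x‖ ^ 2) * ‖v x‖ ^ 2 :=
    (by fun_prop : Continuous fun x => gPlus α ρ ‖x‖ ^ 2 / (ρ ^ 2 + ‖x‖ ^ 2) *
      ‖v x‖ ^ 2).integrable_of_hasCompactSupport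
      (HasCompactSupport.intro hvc fun x hx => by simp [image_eq_zero_of_notMem_tsupport hx])
  have iq : Integrable fun x => ‖u x‖ ^ 2 / (ρ ^ 2 + ‖x‖ ^ 2) :=
    cq.integrable_of_hasCompactSupport
      (HasCompactSupport.intro huc fun x hx => by simp [image_eq_zero_of_notMem_tsupport hx])
  have gexp : ∀ x : Plane, gPlus α ρ ‖x‖ = Real.exp (Real.log (gPlus α ρ ‖x‖)) := fun x =>
    (Real.exp_log (gPlus_pos hρ)).symm
  have sq_exp : ∀ t : ℝ, Real.exp t ^ 2 = Real.exp (2 * t) := fun t => by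
    rw [← Real.exp_nat_mul]; norm_num
  have up : Real.exp (2 * lo) * (∫ x, gPlus α ρ ‖x‖ ^ 2 *
      ‖pderiv 0 v x - Complex.I * pderiv 1 v x‖ ^ 2) ≤
      ∫ x, ‖dbarOp a u (fun i => pderiv i u) x‖ ^ 2 := by
    rw [← integral_const_mul]
    refine integral_mono (iv.const_mul _) iD fun x => ?_
    dsimp only
    rw [hop, mul_pow, ← mul_assoc, ← mul_assoc]
    refine mul_le_of_le_one_left (by positivity) ?_
    rw [gexp, sq_exp, sq_exp, ← Real.exp_add, ← Real.exp_add, Real.exp_le_one_iff]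
    linarith [hlo x]
  have down : Real.exp (-(2 * hi)) * (∫ x, ‖u x‖ ^ 2 / (ρ ^ 2 + ‖x‖ ^ 2)) ≤
      ∫ x, gPlus α ρ ‖x‖ ^ 2 / (ρ ^ 2 + ‖x‖ ^ 2) * ‖v x‖ ^ 2 := by
    rw [← integral_const_mul]
    refine integral_mono (iq.const_mul _) ivl fun x => ?_
    dsimp only
    have h1 : gPlus α ρ ‖x‖ ^ 2 / (ρ ^ 2 + ‖x‖ ^ 2) * ‖v x‖ ^ 2 =
        (gPlus α ρ ‖x‖ ^ 2 * Real.exp (η x) ^ 2) * (‖u x‖ ^ 2 / (ρ ^ 2 + ‖x‖ ^ 2)) := by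
      simp only [hv, norm_mul, hne]; ring
    rw [h1]
    refine mul_le_mul_of_nonneg_right ?_ (by positivity)
    rw [gexp, sq_exp, sq_exp, ← Real.exp_add, Real.exp_le_exp]
    linarith [hhi x]
  have e : Real.exp (2 * (lo - hi)) = Real.exp (2 * lo) * Real.exp (-(2 * hi)) := by
    rw [← Real.exp_add]; ring_nf
  calc _ = Real.exp (2 * lo) * (distInt α ^ 2 * (Real.exp (-(2 * hi)) *
        ∫ x, ‖u x‖ ^ 2 / (ρ ^ 2 + ‖x‖ ^ 2))) := by rw [e]; ring
    _ ≤ Real.exp (2 * lo) * (distInt α ^ 2 *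
        ∫ x, gPlus α ρ ‖x‖ ^ 2 / (ρ ^ 2 + ‖x‖ ^ 2) * ‖v x‖ ^ 2) := by gcongr
    _ ≤ _ := (mul_le_mul_of_nonneg_left key (Real.exp_pos _).le).trans up

/-! ### Standard mollifiers and the passage to a bounded vector potential -/

/-- A sequence of bump functions that concentrates at the origin. -/
noncomputable def bump (n : ℕ) : ContDiffBump (0 : Plane) where
  rIn := 1 / ((n : ℝ) + 1) / 2
  rOut := 1 / ((n : ℝ) + 1)
  rIn_pos := by positivity
  rIn_lt_rOut := half_lt_self (by positivity)

/-- The standard mollifiers. -/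
noncomputable def mollifier (n : ℕ) : Plane → ℝ := (bump n).normed volume

lemma contDiff_mollifier (n : ℕ) : ContDiff ℝ ∞ (mollifier n) := (bump n).contDiff_normed

lemma hasCompactSupport_mollifier (n : ℕ) : HasCompactSupport (mollifier n) :=
  (bump n).hasCompactSupport_normed

lemma mollifier_nonneg (n : ℕ) (x : Plane) : 0 ≤ mollifier n x := (bump n).nonneg_normed x

lemma integral_mollifier (n : ℕ) : ∫ x, mollifier n x = 1 := (bump n).integral_normed

lemma mollifier_eq_zero (n : ℕ) {x : Plane} (hx : 1 / ((n : ℝ) + 1) ≤ ‖x‖) :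
    mollifier n x = 0 := by
  rw [← Function.notMem_support, mollifier, (bump n).support_normed_eq]
  simpa [bump] using hx

lemma integrable_mollifier (n : ℕ) : Integrable (mollifier n) := (bump n).integrable_normed

lemma tendsto_moll {E : Type*} [NormedAddCommGroup E] [NormedSpace ℝ E] [CompleteSpace E]
    {f : Plane → E} (hf : LocallyIntegrable f) :
    ∀ᵐ x, Filter.Tendsto (fun n => moll (mollifier n) f x) Filter.atTop (nhds (f x)) := by
  -- Lebesgue differentiation needs the ratio of outer to inner radius to stay bounded; for `bump`
  -- it is `2`.
  refine ContDiffBump.ae_convolution_tendsto_right_of_locallyIntegrable (φ := bump) (K := 2)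
    ?_ (.of_forall fun n => ?_) hf
  · exact tendsto_one_div_add_atTop_nhds_zero_nat
  · simp only [bump]; linarith

lemma integrable_moll_integrand {E : Type*} [NormedAddCommGroup E] [NormedSpace ℝ E] (n : ℕ)
    {f : Plane → E} (hf : LocallyIntegrable f) (x : Plane) :
    Integrable fun t => mollifier n t • f (x - t) :=
  (hasCompactSupport_mollifier n).convolutionExists_left (ContinuousLinearMap.lsmul ℝ ℝ)
    (contDiff_mollifier n).continuous hf x

lemma norm_moll_le {E : Type*} [NormedAddCommGroup E] [NormedSpace ℝ E] (n : ℕ)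
    {f : Plane → E} {C : ℝ} (hC : ∀ᵐ x, ‖f x‖ ≤ C) (x : Plane) :
    ‖moll (mollifier n) f x‖ ≤ C := by
  rw [moll_apply']
  have h1 : ∫ t, mollifier n (x - t) * C = C := by
    rw [integral_mul_const, integral_sub_left_eq_self (mollifier n) volume x, integral_mollifier,
      one_mul]
  rw [← h1]
  refine norm_integral_le_of_norm_le (((integrable_mollifier n).comp_sub_left x).mul_const C) ?_
  filter_upwards [hC] with t ht
  rw [norm_smul, Real.norm_eq_abs, abs_of_nonneg (mollifier_nonneg n _)]
  exact mul_le_mul_of_nonneg_left ht (mollifier_nonneg n _)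

lemma le_moll (n : ℕ) {f : Plane → ℝ} (hf : LocallyIntegrable f) {c : ℝ} {x : Plane}
    (hc : ∀ t, ‖t‖ ≤ 1 / ((n : ℝ) + 1) → c ≤ f (x - t)) : c ≤ moll (mollifier n) f x := by
  rw [moll_apply]
  have h1 : ∫ t, mollifier n t * c = c := by
    rw [integral_mul_const, integral_mollifier, one_mul]
  rw [← h1]
  refine integral_mono ((integrable_mollifier n).mul_const c) (integrable_moll_integrand n hf x)
    fun t => ?_
  rcases le_total ‖t‖ (1 / ((n : ℝ) + 1)) with ht | ht
  · exact mul_le_mul_of_nonneg_left (hc t ht) (mollifier_nonneg n t)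
  · simp [mollifier_eq_zero n ht]

lemma moll_neg {ψ : Plane → ℝ} (f : Plane → ℝ) (x : Plane) :
    moll ψ (fun x => -f x) x = -moll ψ f x := by
  simp only [moll_apply, smul_neg, integral_neg]

lemma log_gPlus {α ρ : ℝ} (hρ : 0 < ρ) (r : ℝ) :
    Real.log (gPlus α ρ r) = α * (Real.log (max ρ r) - Real.log ρ) := by
  have hmax : 0 < max ρ r := lt_max_of_lt_left hρ
  rw [gPlus_eq hρ, Real.log_mul (by positivity) (by positivity), Real.log_rpow hρ,
    Real.log_rpow hmax]
  ring

/-- The slope of `log (max ρ r)` is at most `1/ρ`. This bounds the loss from averaging over a small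
disc. -/
lemma log_gPlus_sub_le {α ρ : ℝ} (hα : 0 < α) (hρ : 0 < ρ) (r s : ℝ) :
    Real.log (gPlus α ρ r) - Real.log (gPlus α ρ s) ≤ α / ρ * |r - s| := by
  have hr : 0 < max ρ r := lt_max_of_lt_left hρ
  have hs : 0 < max ρ s := lt_max_of_lt_left hρ
  have h1 : Real.log (max ρ r) - Real.log (max ρ s) ≤ |r - s| / ρ := by
    rw [← Real.log_div hr.ne' hs.ne']
    refine (Real.log_le_sub_one_of_pos (by positivity)).trans ?_
    rw [div_sub_one hs.ne']
    have h2 : max ρ r - max ρ s ≤ |r - s| := by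
      have := abs_max_sub_max_le_max ρ r ρ s
      rw [sub_self, abs_zero] at this
      exact (le_abs_self _).trans (this.trans (max_le (abs_nonneg _) le_rfl))
    calc (max ρ r - max ρ s) / max ρ s ≤ |r - s| / max ρ s := by gcongr
      _ ≤ |r - s| / ρ := by gcongr; exact le_max_left _ _
  rw [log_gPlus hρ, log_gPlus hρ]
  calc _ = α * (Real.log (max ρ r) - Real.log (max ρ s)) := by ring
    _ ≤ α * (|r - s| / ρ) := by gcongr
    _ = _ := by ring

/-- Pointwise, `-h - log g₊` lies between `log k₊` and `log K₊`. Averaging over a disc of radius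
`1/(n+1)` moves `log g₊` by at most `α/ρ` times that radius. -/
lemma IsIntegrableField.moll_logPotential_bounds {B : Plane → ℝ} (hB : IsIntegrableField B)
    (hflux : 0 < flux B) {ρ : ℝ} (hρ : 0 < ρ) (n : ℕ) (x : Plane) :
    (Real.log (kPlus B ρ) - flux B / ρ * (1 / ((n : ℝ) + 1))) +
        Real.log (gPlus (flux B) ρ ‖x‖) ≤ -moll (mollifier n) (logPotential B) x ∧
      -moll (mollifier n) (logPotential B) x ≤
        (Real.log (KPlus B ρ) + flux B / ρ * (1 / ((n : ℝ) + 1))) +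
        Real.log (gPlus (flux B) ρ ‖x‖) := by
  have hh := hB.locallyIntegrable_logPotential
  have hk := hB.kPlus_pos hρ
  have hdiff : ∀ t : Plane, ‖t‖ ≤ 1 / ((n : ℝ) + 1) → |‖x - t‖ - ‖x‖| ≤ 1 / ((n : ℝ) + 1) :=
    fun t ht => by
      have := abs_norm_sub_norm_le (x - t) x
      rw [sub_sub_cancel_left, norm_neg] at this
      exact this.trans ht
  have hb : 0 < flux B / ρ := by positivity
  have hratio : ∀ y, Real.log (ratioPlus B ρ y) =
      -logPotential B y - Real.log (gPlus (flux B) ρ ‖y‖) := fun y => by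
    rw [IsIntegrableField.ratioPlus_eq_exp hρ, Real.log_exp]
  constructor
  · rw [← moll_neg]
    refine le_moll n hh.neg fun t ht => ?_
    change _ ≤ -logPotential B (x - t)
    have h1 := Real.log_le_log hk (IsIntegrableField.kPlus_le hρ (x - t))
    rw [hratio] at h1
    have h2 := log_gPlus_sub_le hflux hρ ‖x‖ ‖x - t‖
    rw [abs_sub_comm] at h2
    have h3 := mul_le_mul_of_nonneg_left (hdiff t ht) hb.le
    linarith
  · rw [neg_le]
    refine le_moll n hh fun t ht => ?_
    have h1 := Real.log_le_log (hk.trans_le (IsIntegrableField.kPlus_le hρ (x - t)))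
      (hB.le_KPlus hρ (x - t))
    rw [hratio] at h1
    have h2 := log_gPlus_sub_le hflux hρ ‖x - t‖ ‖x‖
    have h3 := mul_le_mul_of_nonneg_left (hdiff t ht) hb.le
    linarith

lemma locallyIntegrable_component {A : Plane → Plane} (hA : MemLp A ∞ volume) (j : Fin 2) :
    LocallyIntegrable fun x => A x j :=
  MemLp.locallyIntegrable (p := ∞)
    ((EuclideanSpace.proj j : Plane →L[ℝ] ℝ).comp_memLp' hA) le_top

lemma exists_bound_component {A : Plane → Plane} (hA : MemLp A ∞ volume) :
    ∃ C : ℝ, 0 ≤ C ∧ ∀ᵐ x, ∀ j, |A x j| ≤ C := by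
  refine ⟨(eLpNorm A ∞ volume).toReal, ENNReal.toReal_nonneg, ?_⟩
  have h1 := ae_le_eLpNormEssSup (f := A) (μ := volume)
  filter_upwards [h1] with x hx j
  have h2 : ‖A x‖ ≤ (eLpNorm A ∞ volume).toReal := by
    rw [← ENNReal.ofReal_le_iff_le_toReal hA.2.ne, ofReal_norm, eLpNorm_exponent_top]
    exact hx
  exact (PiLp.norm_apply_le (A x) j).trans h2

lemma norm_dbarOp_le {a : Fin 2 → Plane → ℝ} {C : ℝ} {x : Plane} (ha : ∀ j, |a j x| ≤ C)
    (u : Plane → ℂ) (Du : Fin 2 → Plane → ℂ) :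
    ‖dbarOp a u Du x‖ ≤ ‖Du 0 x‖ + ‖Du 1 x‖ + 2 * C * ‖u x‖ := by
  have h : ∀ j, ‖Complex.I * Du j x + a j x * u x‖ ≤ ‖Du j x‖ + C * ‖u x‖ := fun j => by
    refine (norm_add_le _ _).trans ?_
    rw [norm_mul, norm_mul, Complex.norm_I, one_mul, Complex.norm_real]
    gcongr
    exact ha j
  refine (norm_sub_le _ _).trans ?_
  rw [norm_mul, Complex.norm_I, one_mul]
  linarith [h 0, h 1]

/-- The Hardy inequality for the first order operator with a rough bounded vector potential. -/
lemma hardy_dbarOp_rough {B : Plane → ℝ} (hB : IsIntegrableField B) (hflux : 0 < flux B)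
    {A : Plane → Plane} (hA : MemLp A ∞ volume) (hcurl : HasDistribCurl A B)
    {ρ : ℝ} (hρ : 0 < ρ) {u : Plane → ℂ} (hu : ContDiff ℝ ∞ u) (huc : HasCompactSupport u) :
    distInt (flux B) ^ 2 * betaPlus B ρ * (∫ x, ‖u x‖ ^ 2 / (ρ ^ 2 + ‖x‖ ^ 2)) ≤
      ∫ x, ‖dbarOp (fun j x => A x j) u (fun i => pderiv i u) x‖ ^ 2 := by
  obtain ⟨C, hC0, hC⟩ := exists_bound_component hA
  have hAj := locallyIntegrable_component hA
  have hh := hB.locallyIntegrable_logPotential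
  set a : ℕ → Fin 2 → Plane → ℝ := fun n j => moll (mollifier n) fun x => A x j with ha
  have sa : ∀ n j, ContDiff ℝ ∞ (a n j) := fun n j =>
    contDiff_moll (contDiff_mollifier n) (hasCompactSupport_mollifier n) (hAj j)
  have ha_le : ∀ n j x, |a n j x| ≤ C := fun n j x =>
    norm_moll_le (f := fun x => A x j) n (hC.mono fun x hx => hx j) x
  have cu := hu.continuous
  have cpu : ∀ i, Continuous (pderiv i u) := fun i =>
    (ContDiff.pderiv (m := 0) hu (by norm_num) i).continuous
  have hn : ∀ n : ℕ, distInt (flux B) ^ 2 * Real.exp (2 *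
      ((Real.log (kPlus B ρ) - flux B / ρ * (1 / ((n : ℝ) + 1))) -
        (Real.log (KPlus B ρ) + flux B / ρ * (1 / ((n : ℝ) + 1))))) *
      (∫ x, ‖u x‖ ^ 2 / (ρ ^ 2 + ‖x‖ ^ 2)) ≤
      ∫ x, ‖dbarOp (a n) u (fun i => pderiv i u) x‖ ^ 2 := fun n => by
    obtain ⟨χ, hχ, h0, h1⟩ := exists_gauge (sa n 0) (sa n 1)
      (contDiff_moll (contDiff_mollifier n) (hasCompactSupport_mollifier n) hh) fun x => by
        rw [curl_moll (contDiff_mollifier n) (hasCompactSupport_mollifier n) hcurl hAj,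
          laplacian_moll (contDiff_mollifier n) (hasCompactSupport_mollifier n) hB, neg_neg]
    exact hardy_dbarOp (contDiff_moll (contDiff_mollifier n) (hasCompactSupport_mollifier n) hh)
      hχ h0 h1 hflux hρ (fun x => (hB.moll_logPotential_bounds hflux hρ n x).1)
      (fun x => (hB.moll_logPotential_bounds hflux hρ n x).2) hu huc
  -- The mollified potentials keep the uniform bound `C` and converge almost everywhere, so
  -- dominated convergence applies to the fixed compactly supported `u`.
  have lim1 : Filter.Tendsto (fun n => ∫ x, ‖dbarOp (a n) u (fun i => pderiv i u) x‖ ^ 2)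
      Filter.atTop (nhds (∫ x, ‖dbarOp (fun j x => A x j) u (fun i => pderiv i u) x‖ ^ 2)) := by
    refine tendsto_integral_of_dominated_convergence
      (fun x => (‖pderiv 0 u x‖ + ‖pderiv 1 u x‖ + 2 * C * ‖u x‖) ^ 2) (fun n => ?_) ?_
      (fun n => .of_forall fun x => ?_) ?_
    · have c : ∀ j, Continuous (a n j) := fun j => (sa n j).continuous
      unfold dbarOp
      exact (by fun_prop : Continuous _).aestronglyMeasurable
    · refine (by fun_prop : Continuous fun x => (‖pderiv 0 u x‖ + ‖pderiv 1 u x‖ +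
        2 * C * ‖u x‖) ^ 2).integrable_of_hasCompactSupport
        (HasCompactSupport.intro huc fun x hx => ?_)
      simp [pderiv_eq_zero_of_notMem hx, image_eq_zero_of_notMem_tsupport hx]
    · rw [norm_pow, norm_norm]
      gcongr
      exact norm_dbarOp_le (fun j => ha_le n j x) u _
    · filter_upwards [tendsto_moll (hAj 0), tendsto_moll (hAj 1)] with x h0 h1
      have h0' : Filter.Tendsto (fun n => (a n 0 x : ℂ)) Filter.atTop (nhds (A x 0 : ℂ)) :=
        (Complex.continuous_ofReal.tendsto _).comp h0
      have h1' : Filter.Tendsto (fun n => (a n 1 x : ℂ)) Filter.atTop (nhds (A x 1 : ℂ)) :=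
        (Complex.continuous_ofReal.tendsto _).comp h1
      exact (((h0'.mul_const (u x)).const_add _).sub
        (((h1'.mul_const (u x)).const_add _).const_mul _)).norm.pow 2
  have lim2 : Filter.Tendsto (fun n : ℕ => distInt (flux B) ^ 2 * Real.exp (2 *
      ((Real.log (kPlus B ρ) - flux B / ρ * (1 / ((n : ℝ) + 1))) -
        (Real.log (KPlus B ρ) + flux B / ρ * (1 / ((n : ℝ) + 1))))) *
      (∫ x, ‖u x‖ ^ 2 / (ρ ^ 2 + ‖x‖ ^ 2))) Filter.atTop
      (nhds (distInt (flux B) ^ 2 * betaPlus B ρ * (∫ x, ‖u x‖ ^ 2 / (ρ ^ 2 + ‖x‖ ^ 2)))) := by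
    have hδ := (tendsto_one_div_add_atTop_nhds_zero_nat (𝕜 := ℝ)).const_mul (flux B / ρ)
    have h1 := (((Real.continuous_exp.tendsto _).comp
      (((hδ.const_sub (Real.log (kPlus B ρ))).sub
        (hδ.const_add (Real.log (KPlus B ρ)))).const_mul 2)).const_mul
          (distInt (flux B) ^ 2)).mul_const (∫ x, ‖u x‖ ^ 2 / (ρ ^ 2 + ‖x‖ ^ 2))
    have hk := hB.kPlus_pos hρ
    have hK : 0 < KPlus B ρ :=
      (hk.trans_le (IsIntegrableField.kPlus_le hρ 0)).trans_le (hB.le_KPlus hρ 0)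
    -- The averaging errors vanish in the limit, and `exp (2 (log k₊ - log K₊))` is `β₊`.
    have h2 : betaPlus B ρ = Real.exp (2 * (Real.log (kPlus B ρ) - flux B / ρ * 0 -
        (Real.log (KPlus B ρ) + flux B / ρ * 0))) := by
      rw [betaPlus, mul_zero, sub_zero, add_zero, ← Real.log_div hk.ne' hK.ne',
        two_mul, Real.exp_add, Real.exp_log (by positivity), sq]
    rw [h2]
    exact h1
  exact le_of_tendsto_of_tendsto' lim2 lim1 hn

/-! ### The Pauli form as the square of the first order operator -/

lemma pderiv_pderiv_comm {f : Plane → ℝ} (hf : ContDiff ℝ 2 f) (i j : Fin 2) (x : Plane) :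
    pderiv i (pderiv j f) x = pderiv j (pderiv i f) x := by
  have hD : Differentiable ℝ (fderiv ℝ f) :=
    (hf.fderiv_right (m := 1) (by norm_num)).differentiable one_ne_zero
  have h : ∀ i j, pderiv i (pderiv j f) x = fderiv ℝ (fderiv ℝ f) x
      (EuclideanSpace.single i 1) (EuclideanSpace.single j 1) := fun i j => by
    have := ((ContinuousLinearMap.apply ℝ ℝ (EuclideanSpace.single j (1 : ℝ))).hasFDerivAt.comp x
      (hD x).hasFDerivAt)
    exact pderiv_eq_of_hasFDerivAt this i
  rw [h, h]
  exact (hf.contDiffAt.isSymmSndFDerivAt (by simp)).eq _ _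

/-- The Jacobian determinant is a null Lagrangian. -/
lemma integral_jacobian_eq_zero {p q : Plane → ℝ} (hp : ContDiff ℝ 2 p) (hq : ContDiff ℝ 2 q)
    (hqc : HasCompactSupport q) :
    ∫ x, (pderiv 0 p x * pderiv 1 q x - pderiv 1 p x * pderiv 0 q x) = 0 := by
  have sp : ∀ i, ContDiff ℝ 1 (pderiv i p) := fun i => ContDiff.pderiv hp (by norm_num) i
  have cq : ∀ i, Continuous (pderiv i q) := fun i =>
    (ContDiff.pderiv (m := 1) hq (by norm_num) i).continuous
  have hint : ∀ i j, Integrable fun x => pderiv i p x * pderiv j q x := fun i j =>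
    ((sp i).continuous.mul (cq j)).integrable_of_hasCompactSupport
      (HasCompactSupport.pderiv hqc j).mul_left
  have hq1 : ContDiff ℝ 1 q := hq.of_le (by norm_num)
  rw [integral_sub (hint 0 1) (hint 1 0), integral_mul_pderiv (sp 0) hq1 hqc,
    integral_mul_pderiv (sp 1) hq1 hqc]
  simp only [pderiv_pderiv_comm hp 1 0, sub_self]

lemma memLp_magnetic {A : Plane → Plane} (hA : MemLp A ∞ volume) {u v : Plane → ℂ}
    (hu : MemLp u 2) (hv : MemLp v 2) (j : Fin 2) :
    MemLp (fun x => Complex.I * v x + (A x j : ℂ) * u x) 2 := by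
  have h1 : MemLp (fun x => (A x j : ℂ)) ∞ :=
    (Complex.ofRealCLM ∘L (EuclideanSpace.proj j : Plane →L[ℝ] ℝ)).comp_memLp' hA
  exact (hv.const_mul Complex.I).add (hu.mul h1)

lemma pderiv_re {u : Plane → ℂ} (hu : Differentiable ℝ u) (i : Fin 2) (x : Plane) :
    pderiv i (fun x => (u x).re) x = (pderiv i u x).re :=
  pderiv_eq_of_hasFDerivAt (Complex.reCLM.hasFDerivAt.comp x (hu x).hasFDerivAt) i

lemma pderiv_im {u : Plane → ℂ} (hu : Differentiable ℝ u) (i : Fin 2) (x : Plane) :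
    pderiv i (fun x => (u x).im) x = (pderiv i u x).im :=
  pderiv_eq_of_hasFDerivAt (Complex.imCLM.hasFDerivAt.comp x (hu x).hasFDerivAt) i

lemma pderiv_norm_sq {u : Plane → ℂ} (hu : Differentiable ℝ u) (i : Fin 2) (x : Plane) :
    pderiv i (fun x => ‖u x‖ ^ 2) x =
      2 * ((u x).re * (pderiv i u x).re + (u x).im * (pderiv i u x).im) := by
  have h := (hu x).hasFDerivAt.norm_sq
  refine (pderiv_eq_of_hasFDerivAt h i).trans ?_
  simp [pderiv, Complex.inner]
  ring

lemma isTestFunction_norm_sq {u : Plane → ℂ} (hu : ContDiff ℝ ∞ u) (huc : HasCompactSupport u) :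
    IsTestFunction fun x => ‖u x‖ ^ 2 :=
  ⟨hu.norm_sq ℝ, HasCompactSupport.intro huc fun x hx => by
    simp [image_eq_zero_of_notMem_tsupport hx]⟩

/-- On smooth functions the Pauli form is the square of the first order operator. -/
lemma pauliPlusForm_eq {B : Plane → ℝ} (hB : Integrable B) {A : Plane → Plane}
    (hA : MemLp A ∞ volume) (hcurl : HasDistribCurl A B) {u : Plane → ℂ} (hu : ContDiff ℝ ∞ u)
    (huc : HasCompactSupport u) :
    pauliPlusForm A B u (fun i => pderiv i u) =
      ∫ x, ‖dbarOp (fun j x => A x j) u (fun i => pderiv i u) x‖ ^ 2 := by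
  have hud : Differentiable ℝ u := hu.differentiable (by simp)
  have cu := hu.continuous
  have spu : ∀ i, ContDiff ℝ ∞ (pderiv i u) := fun i => ContDiff.pderiv hu (by norm_num) i
  have cpu : ∀ i, Continuous (pderiv i u) := fun i => (spu i).continuous
  have hpc : ∀ i, HasCompactSupport (pderiv i u) := fun i => HasCompactSupport.pderiv huc i
  have mu : MemLp u 2 := cu.memLp_of_hasCompactSupport huc
  have mpu : ∀ i, MemLp (pderiv i u) 2 := fun i => (cpu i).memLp_of_hasCompactSupport (hpc i)
  set φ : Plane → ℝ := fun x => ‖u x‖ ^ 2 with hφdef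
  have hφ : IsTestFunction φ := isTestFunction_norm_sq hu huc
  have cpφ : ∀ i, Continuous (pderiv i φ) := fun i =>
    (ContDiff.pderiv (m := 0) hφ.1 (by norm_num) i).continuous
  have i1 : ∀ j, Integrable fun x => ‖Complex.I * pderiv j u x + (A x j : ℂ) * u x‖ ^ 2 :=
    fun j => (memLp_magnetic hA mu (mpu j) j).integrable_norm_pow (by norm_num)
  have i2 : Integrable fun x => B x * φ x := by
    have := hB.locallyIntegrable.integrable_smul_left_of_hasCompactSupport hφ.1.continuous hφ.2
    simpa only [smul_eq_mul, mul_comm (φ _)] using this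
  have i3 : ∀ i j, Integrable fun x => A x j * pderiv i φ x := fun i j => by
    have := (locallyIntegrable_component hA j).integrable_smul_left_of_hasCompactSupport (cpφ i)
      (HasCompactSupport.pderiv hφ.2 i)
    simpa only [smul_eq_mul, mul_comm (pderiv i φ _)] using this
  set p : Plane → ℝ := fun x => (u x).re with hp
  set q : Plane → ℝ := fun x => (u x).im with hq
  have sp : ContDiff ℝ ∞ p := Complex.reCLM.contDiff.comp hu
  have sq : ContDiff ℝ ∞ q := Complex.imCLM.contDiff.comp hu
  have hqc : HasCompactSupport q := huc.comp_left (g := Complex.im) rfl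
  have hjac := integral_jacobian_eq_zero (sp.of_le two_le_infty) (sq.of_le two_le_infty) hqc
  have i4 : Integrable fun x => pderiv 0 p x * pderiv 1 q x - pderiv 1 p x * pderiv 0 q x := by
    have c1 : ∀ i, Continuous (pderiv i p) := fun i =>
      (ContDiff.pderiv (m := 0) sp (by norm_num) i).continuous
    have c2 : ∀ i, Continuous (pderiv i q) := fun i =>
      (ContDiff.pderiv (m := 0) sq (by norm_num) i).continuous
    exact (((c1 0).mul (c2 1)).integrable_of_hasCompactSupport
      (HasCompactSupport.pderiv hqc 1).mul_left).sub
      (((c1 1).mul (c2 0)).integrable_of_hasCompactSupport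
      (HasCompactSupport.pderiv hqc 0).mul_left)
  -- The cross term of the square is `A · ∇^⊥|u|²` plus twice the Jacobian of `(Re u, Im u)`. The
  -- former integrates to `∫ B|u|²` by the distributional curl tested against `|u|²`, the latter to
  -- zero.
  have hpt : ∀ x, ‖dbarOp (fun j x => A x j) u (fun i => pderiv i u) x‖ ^ 2 =
      ((∑ j : Fin 2, ‖Complex.I * pderiv j u x + (A x j : ℂ) * u x‖ ^ 2) +
      (A x 0 * pderiv 1 φ x - A x 1 * pderiv 0 φ x)) +
      2 * (pderiv 0 p x * pderiv 1 q x - pderiv 1 p x * pderiv 0 q x) := fun x => by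
    rw [hp, hq, pderiv_re hud, pderiv_re hud, pderiv_im hud, pderiv_im hud, hφdef,
      pderiv_norm_sq hud, pderiv_norm_sq hud, Fin.sum_univ_two]
    simp only [dbarOp, ← Complex.normSq_eq_norm_sq, Complex.normSq_apply]
    simp
    ring
  have i13 : Integrable fun x => ∑ j : Fin 2, ‖Complex.I * pderiv j u x + (A x j : ℂ) * u x‖ ^ 2 :=
    integrable_finsetSum _ fun j _ => i1 j
  have i33 : Integrable fun x => A x 0 * pderiv 1 φ x - A x 1 * pderiv 0 φ x :=
    (i3 1 0).sub (i3 0 1)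
  have i5 : Integrable fun x =>
      (∑ j : Fin 2, ‖Complex.I * pderiv j u x + (A x j : ℂ) * u x‖ ^ 2) +
      (A x 0 * pderiv 1 φ x - A x 1 * pderiv 0 φ x) := i13.add i33
  have hc := hcurl φ hφ
  simp only [partialDeriv_eq] at hc
  simp_rw [hpt]
  rw [integral_add i5 (i4.const_mul 2), integral_const_mul, hjac, mul_zero, add_zero]
  refine (integral_add i13 i2).trans ?_
  refine Eq.trans ?_ (integral_add i13 i33).symm
  congr 1
  exact hc.symm

/-! ### Form boundedness of the magnetic field -/

lemma norm_fderiv_le {E : Type*} [NormedAddCommGroup E] [NormedSpace ℝ E] (f : Plane → E)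
    (x : Plane) : ‖fderiv ℝ f x‖ ≤ ‖pderiv 0 f x‖ + ‖pderiv 1 f x‖ := by
  refine ContinuousLinearMap.opNorm_le_bound _ (by positivity) fun y => ?_
  rw [fderiv_apply_eq, add_mul]
  refine (norm_add_le _ _).trans (add_le_add ?_ ?_) <;>
  · rw [norm_smul, mul_comm]
    exact mul_le_mul_of_nonneg_left (PiLp.norm_apply_le y _) (norm_nonneg _)

/-- The square of the Sobolev norm. -/
noncomputable def energy (v : Plane → ℂ) (Dv : Fin 2 → Plane → ℂ) : ℝ :=
  (∫ x, ‖v x‖ ^ 2) + ((∫ x, ‖Dv 0 x‖ ^ 2) + ∫ x, ‖Dv 1 x‖ ^ 2)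

/-- The magnetic field is form bounded with respect to the Sobolev norm. -/
lemma IsIntegrableField.exists_integral_abs_mul_le {B : Plane → ℝ} (hB : IsIntegrableField B) :
    ∃ C : ℝ, 0 ≤ C ∧ ∀ v : Plane → ℂ, ContDiff ℝ ∞ v → HasCompactSupport v →
      Integrable (fun x => |B x| * ‖v x‖ ^ 2) ∧
      ∫ x, |B x| * ‖v x‖ ^ 2 ≤ C * energy v (fun i => pderiv i v) := by
  have hB2 : MemLp B 2 :=
    (memLp_two_iff_integrable_sq hB.integrable.aestronglyMeasurable).2 hB.integrable_sq
  have hconj : NNReal.HolderConjugate (Module.finrank ℝ Plane) 2 := by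
    rw [finrank_euclideanSpace, Fintype.card_fin, NNReal.holderConjugate_iff]
    norm_num
  set S := eLpNormLESNormFDerivOneConst (volume : Measure Plane) (2 : NNReal) with hS
  -- Cauchy-Schwarz with `B ∈ L²`, followed by the Sobolev embedding of `W^{1,1}` in `L²` of the
  -- plane with constant `S`, applied to `|v|²`. The factor `2` comes from `|∇|v|²| ≤ 2(|v|² +
  -- |∇v|²)`.
  refine ⟨(eLpNorm B 2 volume).toReal * (S * 2), by positivity, fun v hv hvc => ?_⟩
  have hvd : Differentiable ℝ v := hv.differentiable (by simp)
  have hφ := isTestFunction_norm_sq hv hvc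
  have cpv : ∀ i, Continuous (pderiv i v) := fun i =>
    (ContDiff.pderiv (m := 0) hv (by norm_num) i).continuous
  have cv := hv.continuous
  set φ : Plane → ℝ := fun x => ‖v x‖ ^ 2 with hφdef
  have hint : Integrable fun x => |B x| * φ x := by
    have := hB.integrable.abs.locallyIntegrable.integrable_smul_left_of_hasCompactSupport
      hφ.1.continuous hφ.2
    simpa only [smul_eq_mul, mul_comm (φ _)] using this
  refine ⟨hint, ?_⟩
  have iv : Integrable φ := hφ.1.continuous.integrable_of_hasCompactSupport hφ.2
  have ipv : ∀ i, Integrable fun x => ‖pderiv i v x‖ ^ 2 := fun i =>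
    ((cpv i).norm.pow 2).integrable_of_hasCompactSupport
      (HasCompactSupport.intro hvc fun x hx => by simp [pderiv_eq_zero_of_notMem hx])
  have hpt : ∀ x, ‖fderiv ℝ φ x‖ ≤
      2 * (φ x + (‖pderiv 0 v x‖ ^ 2 + ‖pderiv 1 v x‖ ^ 2)) := fun x => by
    have h : ∀ i, ‖pderiv i φ x‖ ≤ 2 * (‖v x‖ * ‖pderiv i v x‖) := fun i => by
      have : pderiv i φ x = 2 * inner ℝ (v x) (pderiv i v x) := by
        rw [hφdef, pderiv_norm_sq hvd]
        simp [Complex.inner]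
        ring
      rw [this, norm_mul, Real.norm_ofNat]
      exact mul_le_mul_of_nonneg_left (norm_inner_le_norm _ _) two_pos.le
    refine (norm_fderiv_le φ x).trans ((add_le_add (h 0) (h 1)).trans ?_)
    simp only [hφdef]
    nlinarith [sq_nonneg (‖v x‖ - ‖pderiv 0 v x‖), sq_nonneg (‖v x‖ - ‖pderiv 1 v x‖),
      sq_nonneg (‖pderiv 0 v x‖), sq_nonneg (‖pderiv 1 v x‖)]
  have i01 : Integrable fun x => ‖pderiv 0 v x‖ ^ 2 + ‖pderiv 1 v x‖ ^ 2 := (ipv 0).add (ipv 1)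
  have hE : Integrable fun x => 2 * (φ x + (‖pderiv 0 v x‖ ^ 2 + ‖pderiv 1 v x‖ ^ 2)) :=
    (iv.add i01).const_mul 2
  have hEint : ∫ x, 2 * (φ x + (‖pderiv 0 v x‖ ^ 2 + ‖pderiv 1 v x‖ ^ 2)) =
      2 * energy v (fun i => pderiv i v) := by
    rw [integral_const_mul, integral_add iv i01, energy,
      integral_add (ipv 0) (ipv 1)]
  have hgrad : eLpNorm (fderiv ℝ φ) 1 volume ≤
      ENNReal.ofReal (2 * energy v (fun i => pderiv i v)) := by
    rw [eLpNorm_one_eq_lintegral_enorm, ← hEint,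
      ofReal_integral_eq_lintegral_ofReal hE (.of_forall fun x => by positivity)]
    refine lintegral_mono fun x => ?_
    rw [← ofReal_norm]
    exact ENNReal.ofReal_le_ofReal (hpt x)
  have hsob : eLpNorm φ 2 volume ≤ S * eLpNorm (fderiv ℝ φ) 1 volume :=
    eLpNorm_le_eLpNorm_fderiv_one volume (hφ.1.of_le (by exact_mod_cast le_top)) hφ.2 hconj
  have hhol : eLpNorm (fun x => B x * φ x) 1 volume ≤ eLpNorm B 2 volume * eLpNorm φ 2 volume := by
    have := eLpNorm_smul_le_mul_eLpNorm (p := 2) (q := 2) (r := 1)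
      hφ.1.continuous.aestronglyMeasurable (μ := volume) hB.integrable.aestronglyMeasurable
    exact this
  have hE0 : 0 ≤ energy v (fun i => pderiv i v) := by
    unfold energy; positivity
  have hfin : ENNReal.ofReal (∫ x, |B x| * φ x) ≤
      ENNReal.ofReal ((eLpNorm B 2 volume).toReal * (S * 2) * energy v (fun i => pderiv i v)) := by
    calc ENNReal.ofReal (∫ x, |B x| * φ x) = eLpNorm (fun x => B x * φ x) 1 volume := by
          rw [eLpNorm_one_eq_lintegral_enorm, ofReal_integral_eq_lintegral_ofReal hint
            (.of_forall fun x => by simp only [hφdef, Pi.zero_apply]; positivity)]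
          refine lintegral_congr fun x => ?_
          rw [← ofReal_norm, norm_mul, Real.norm_eq_abs, Real.norm_eq_abs,
            abs_of_nonneg (show 0 ≤ φ x by simp only [hφdef]; positivity)]
      _ ≤ eLpNorm B 2 volume * (S * ENNReal.ofReal (2 * energy v (fun i => pderiv i v))) := by
          refine hhol.trans ?_
          gcongr
          refine hsob.trans ?_
          gcongr
      _ = _ := by
          rw [← ENNReal.ofReal_toReal hB2.2.ne, ← ENNReal.ofReal_coe_nnreal,
            ← ENNReal.ofReal_mul (by positivity), ← ENNReal.ofReal_mul (by positivity),
            ENNReal.toReal_ofReal (by positivity)]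
          congr 1
          ring
  exact (ENNReal.ofReal_le_ofReal_iff (by positivity)).1 hfin

/-! ### Convergence in `L²` and density of smooth functions -/

/-- The integrals of squared norms against a weight converge along a sequence that converges in
the weighted `L²` space. -/
lemma tendsto_integral_mul_norm_sq {w : Plane → ℝ} {f : Plane → ℂ} {F : ℕ → Plane → ℂ}
    (hw : AEStronglyMeasurable w) (hf : AEStronglyMeasurable f)
    (hF : ∀ n, AEStronglyMeasurable (F n)) (hwf : Integrable fun x => |w x| * ‖f x‖ ^ 2)
    (hwF : ∀ n, Integrable fun x => |w x| * ‖F n x - f x‖ ^ 2)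
    (hlim : Filter.Tendsto (fun n => ∫ x, |w x| * ‖F n x - f x‖ ^ 2) Filter.atTop (nhds 0)) :
    Filter.Tendsto (fun n => ∫ x, w x * ‖F n x‖ ^ 2) Filter.atTop
      (nhds (∫ x, w x * ‖f x‖ ^ 2)) := by
  have iwf : Integrable fun x => w x * ‖f x‖ ^ 2 := hwf.mono (hw.mul (hf.norm.pow 2))
    (.of_forall fun x => by simp)
  have iwF : ∀ n, Integrable fun x => w x * ‖F n x‖ ^ 2 := fun n => by
    refine (((hwF n).const_mul 2).add (hwf.const_mul 2)).mono' (hw.mul ((hF n).norm.pow 2))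
      (.of_forall fun x => ?_)
    have h1 : ‖F n x‖ ≤ ‖F n x - f x‖ + ‖f x‖ := by simpa using norm_add_le (F n x - f x) (f x)
    have h2 : ‖F n x‖ ^ 2 ≤ 2 * ‖F n x - f x‖ ^ 2 + 2 * ‖f x‖ ^ 2 := by
      nlinarith [norm_nonneg (F n x), sq_nonneg (‖F n x - f x‖ - ‖f x‖)]
    have h3 := mul_le_mul_of_nonneg_left h2 (abs_nonneg (w x))
    rw [norm_mul, norm_pow, norm_norm, Real.norm_eq_abs]
    simp only [Pi.add_apply]
    linarith
  set b := ∫ x, |w x| * ‖f x‖ ^ 2 with hb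
  have hb0 : 0 ≤ b := integral_nonneg fun x => by positivity
  -- From `||F|² - |f|²| ≤ d² + 2d|f|` with `d = |F - f|`, and Young's inequality with parameter
  -- `t`.
  have main : ∀ t : ℝ, 0 < t → ∀ n, |(∫ x, w x * ‖F n x‖ ^ 2) - ∫ x, w x * ‖f x‖ ^ 2| ≤
      (1 + t⁻¹) * (∫ x, |w x| * ‖F n x - f x‖ ^ 2) + t * b := by
    intro t ht n
    rw [← integral_sub (iwF n) iwf, hb, ← integral_const_mul, ← integral_const_mul,
      ← integral_add ((hwF n).const_mul _) (hwf.const_mul _)]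
    refine abs_integral_le_integral_abs.trans (integral_mono ((iwF n).sub iwf).abs
      (((hwF n).const_mul _).add (hwf.const_mul _)) fun x => ?_)
    dsimp only
    set d := ‖F n x - f x‖
    have h1 : |‖F n x‖ - ‖f x‖| ≤ d := abs_norm_sub_norm_le _ _
    have h2 : ‖F n x‖ + ‖f x‖ ≤ d + 2 * ‖f x‖ := by
      have : ‖F n x‖ ≤ d + ‖f x‖ := by simpa using norm_add_le (F n x - f x) (f x)
      linarith
    have h3 : |‖F n x‖ ^ 2 - ‖f x‖ ^ 2| ≤ d * (d + 2 * ‖f x‖) := by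
      rw [sq_sub_sq, abs_mul, mul_comm, abs_of_nonneg (by positivity : 0 ≤ ‖F n x‖ + ‖f x‖)]
      gcongr
    have h4 : 2 * d * ‖f x‖ ≤ t⁻¹ * d ^ 2 + t * ‖f x‖ ^ 2 := by
      have : t⁻¹ * d ^ 2 + t * ‖f x‖ ^ 2 - 2 * d * ‖f x‖ = t⁻¹ * (d - t * ‖f x‖) ^ 2 := by
        field_simp
        ring
      have : 0 ≤ t⁻¹ * (d - t * ‖f x‖) ^ 2 := by positivity
      linarith
    have h5 : |‖F n x‖ ^ 2 - ‖f x‖ ^ 2| ≤ (1 + t⁻¹) * d ^ 2 + t * ‖f x‖ ^ 2 := by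
      nlinarith
    rw [← mul_sub, abs_mul]
    refine (mul_le_mul_of_nonneg_left h5 (abs_nonneg _)).trans_eq ?_
    ring
  rw [Metric.tendsto_atTop]
  intro ε hε
  -- Chosen so that `t b ≤ ε/2`; the `+ 1` covers `b = 0`.
  set t := ε / (2 * (b + 1)) with ht
  have ht0 : 0 < t := by positivity
  have htb : t * b ≤ ε / 2 := by
    rw [ht, div_mul_eq_mul_div, div_le_div_iff₀ (by positivity) two_pos]
    nlinarith
  have hlim' := hlim.const_mul (1 + t⁻¹)
  rw [mul_zero] at hlim'
  obtain ⟨N, hN⟩ := (Metric.tendsto_atTop.1 hlim') (ε / 2) (by positivity)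
  refine ⟨N, fun n hn => ?_⟩
  have h1 := hN n hn
  rw [Real.dist_eq, sub_zero] at h1
  rw [Real.dist_eq]
  linarith [main t ht0 n, le_abs_self ((1 + t⁻¹) * ∫ x, |w x| * ‖F n x - f x‖ ^ 2)]

lemma integrable_norm_sq {f : Plane → ℂ} (hf : MemLp f 2) : Integrable fun x => ‖f x‖ ^ 2 :=
  (memLp_two_iff_integrable_sq_norm hf.1).1 hf

/-- A sequence that converges almost everywhere and whose `L²` norms do not exceed that of the
limit converges in `L²`. -/
lemma tendsto_integral_norm_sub_sq {f : Plane → ℂ} {F : ℕ → Plane → ℂ} (hf : MemLp f 2)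
    (hF : ∀ n, MemLp (F n) 2) (hle : ∀ n, ∫ x, ‖F n x‖ ^ 2 ≤ ∫ x, ‖f x‖ ^ 2)
    (hlim : ∀ᵐ x, Filter.Tendsto (fun n => F n x) Filter.atTop (nhds (f x))) :
    Filter.Tendsto (fun n => ∫ x, ‖F n x - f x‖ ^ 2) Filter.atTop (nhds 0) := by
  have i1 := integrable_norm_sq hf
  have i2 := fun n => integrable_norm_sq (hF n)
  have i3 : ∀ n, Integrable fun x => ‖F n x - f x‖ ^ 2 := fun n =>
    integrable_norm_sq ((hF n).sub hf)
  have i4 : ∀ n, Integrable fun x => ‖F n x + f x‖ ^ 2 := fun n =>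
    integrable_norm_sq ((hF n).add hf)
  set b := ∫ x, ‖f x‖ ^ 2 with hb
  -- The parallelogram law reduces the claim to a lower bound on `∫ |F n + f|²`, whose pointwise
  -- limit is `4|f|²`; Fatou's lemma supplies it.
  have hpar : ∀ n, (∫ x, ‖F n x - f x‖ ^ 2) ≤ 4 * b - ∫ x, ‖F n x + f x‖ ^ 2 := fun n => by
    have h1 : (∫ x, ‖F n x + f x‖ ^ 2) + ∫ x, ‖F n x - f x‖ ^ 2 =
        2 * (∫ x, ‖F n x‖ ^ 2) + 2 * b := by
      rw [← integral_add (i4 n) (i3 n), hb, ← integral_const_mul, ← integral_const_mul,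
        ← integral_add ((i2 n).const_mul 2) (i1.const_mul 2)]
      refine integral_congr_ae (.of_forall fun x => ?_)
      have := parallelogram_law_with_norm ℝ (F n x) (f x)
      dsimp only
      linarith
    linarith [hle n]
  have hfatou : ENNReal.ofReal (4 * b) ≤
      Filter.liminf (fun n => ENNReal.ofReal (∫ x, ‖F n x + f x‖ ^ 2)) Filter.atTop := by
    have h1 : ENNReal.ofReal (4 * b) = ∫⁻ x, Filter.liminf
        (fun n => ENNReal.ofReal (‖F n x + f x‖ ^ 2)) Filter.atTop := by
      rw [hb, ← integral_const_mul, ofReal_integral_eq_lintegral_ofReal (i1.const_mul 4)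
        (.of_forall fun x => by positivity)]
      refine lintegral_congr_ae ?_
      filter_upwards [hlim] with x hx
      have h2 : Filter.Tendsto (fun n => ENNReal.ofReal (‖F n x + f x‖ ^ 2)) Filter.atTop
          (nhds (ENNReal.ofReal (‖f x + f x‖ ^ 2))) :=
        (ENNReal.continuous_ofReal.tendsto _).comp ((hx.add_const (f x)).norm.pow 2)
      rw [h2.liminf_eq, ← two_mul, norm_mul, Complex.norm_ofNat]
      congr 1
      ring
    rw [h1]
    refine (lintegral_liminf_le' fun n => (i4 n).aestronglyMeasurable.aemeasurable.ennreal_ofReal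
      ).trans_eq (congrArg (Filter.liminf · Filter.atTop) (funext fun n => ?_))
    exact (ofReal_integral_eq_lintegral_ofReal (i4 n) (.of_forall fun x => by positivity)).symm
  have hb0 : 0 ≤ b := integral_nonneg fun x => by positivity
  rw [Metric.tendsto_atTop]
  intro ε hε
  have hev : ∀ᶠ n in Filter.atTop, 4 * b - ε < ∫ x, ‖F n x + f x‖ ^ 2 := by
    -- `ENNReal.ofReal` truncates negative numbers, so a negative bound is handled apart.
    rcases lt_or_ge (4 * b - ε) 0 with h | h
    · exact .of_forall fun n => h.trans_le (integral_nonneg fun x => by positivity)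
    · have h1 : ENNReal.ofReal (4 * b - ε) <
          Filter.liminf (fun n => ENNReal.ofReal (∫ x, ‖F n x + f x‖ ^ 2)) Filter.atTop :=
        lt_of_lt_of_le ((ENNReal.ofReal_lt_ofReal_iff_of_nonneg h).2 (by linarith)) hfatou
      exact (Filter.eventually_lt_of_lt_liminf h1).mono fun n hn =>
        (ENNReal.ofReal_lt_ofReal_iff_of_nonneg h).1 hn
  obtain ⟨N, hN⟩ := Filter.eventually_atTop.1 hev
  refine ⟨N, fun n hn => ?_⟩
  rw [Real.dist_eq, sub_zero, abs_of_nonneg (integral_nonneg fun x => by positivity)]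
  linarith [hpar n, hN n hn]

/-- Jensen's inequality for the probability density `mollifier n`, obtained from the nonnegativity
of the variance of `|f|` about its mean `c`. -/
lemma norm_moll_sq_le (n : ℕ) {f : Plane → ℂ} (hf : MemLp f 2) (x : Plane) :
    ‖moll (mollifier n) f x‖ ^ 2 ≤ moll (mollifier n) (fun y => ‖f y‖ ^ 2) x := by
  have j1 := integrable_moll_integrand n (hf.norm.locallyIntegrable (by norm_num)) x
  have j2 := integrable_moll_integrand n (integrable_norm_sq hf).locallyIntegrable x
  set c := ∫ t, mollifier n t • ‖f (x - t)‖ with hc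
  have h1 : ‖moll (mollifier n) f x‖ ≤ c := by
    rw [moll_apply]
    refine (norm_integral_le_integral_norm _).trans_eq (integral_congr_ae (.of_forall fun t => ?_))
    dsimp only
    rw [norm_smul, Real.norm_eq_abs, abs_of_nonneg (mollifier_nonneg n t), smul_eq_mul]
  have h2 : 0 ≤ ∫ t, mollifier n t * (‖f (x - t)‖ - c) ^ 2 :=
    integral_nonneg fun t => mul_nonneg (mollifier_nonneg n t) (sq_nonneg _)
  have h3 : ∫ t, mollifier n t * (‖f (x - t)‖ - c) ^ 2 =
      moll (mollifier n) (fun y => ‖f y‖ ^ 2) x - 2 * c * c + c ^ 2 := by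
    have e : (fun t => mollifier n t * (‖f (x - t)‖ - c) ^ 2) = fun t =>
        (mollifier n t • ‖f (x - t)‖ ^ 2 - 2 * c * (mollifier n t • ‖f (x - t)‖)) +
          mollifier n t * c ^ 2 := by
      ext t
      simp only [smul_eq_mul]
      ring
    have j3 : Integrable fun t =>
        mollifier n t • ‖f (x - t)‖ ^ 2 - 2 * c * (mollifier n t • ‖f (x - t)‖) :=
      j2.sub (j1.const_mul _)
    rw [e, integral_add j3 ((integrable_mollifier n).mul_const _),
      integral_sub j2 (j1.const_mul _), integral_const_mul, integral_mul_const,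
      integral_mollifier, one_mul, moll_apply, hc]
  nlinarith [norm_nonneg (moll (mollifier n) f x)]

lemma memLp_moll (n : ℕ) {f : Plane → ℂ} (hf : MemLp f 2) :
    MemLp (moll (mollifier n) f) 2 ∧ ∫ x, ‖moll (mollifier n) f x‖ ^ 2 ≤ ∫ x, ‖f x‖ ^ 2 := by
  have hfl : LocallyIntegrable f := hf.locallyIntegrable (by norm_num)
  have hm := (contDiff_moll (contDiff_mollifier n) (hasCompactSupport_mollifier n)
    hfl).continuous
  have i1 := integrable_norm_sq hf
  have i2 : Integrable (moll (mollifier n) fun y => ‖f y‖ ^ 2) :=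
    (integrable_mollifier n).integrable_convolution (ContinuousLinearMap.lsmul ℝ ℝ) i1
  have i3 : Integrable fun x => ‖moll (mollifier n) f x‖ ^ 2 :=
    i2.mono' (hm.norm.pow 2).aestronglyMeasurable (.of_forall fun x => by
      rw [norm_pow, norm_norm]
      exact norm_moll_sq_le n hf x)
  refine ⟨(memLp_two_iff_integrable_sq_norm hm.aestronglyMeasurable).2 i3, ?_⟩
  refine (integral_mono i3 i2 (norm_moll_sq_le n hf)).trans_eq ?_
  have := integral_convolution (ContinuousLinearMap.lsmul ℝ ℝ) (integrable_mollifier n) i1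
    (μ := volume) (ν := volume)
  refine this.trans ?_
  rw [integral_mollifier]
  simp

/-- The bump function that is `1` on the unit disc and is supported in the disc of radius `2`. -/
noncomputable def unitBump : ContDiffBump (0 : Plane) where
  rIn := 1
  rOut := 2
  rIn_pos := one_pos
  rIn_lt_rOut := one_lt_two

/-- Smooth cutoff functions of the discs of radius `n + 1`. -/
noncomputable def cutoff (n : ℕ) (x : Plane) : ℝ := unitBump (((n : ℝ) + 1)⁻¹ • x)

lemma contDiff_cutoff (n : ℕ) : ContDiff ℝ ∞ (cutoff n) :=
  unitBump.contDiff.comp (contDiff_const_smul _)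

lemma hasCompactSupport_cutoff (n : ℕ) : HasCompactSupport (cutoff n) :=
  unitBump.hasCompactSupport.comp_smul (by positivity)

lemma abs_cutoff_le_one (n : ℕ) (x : Plane) : |cutoff n x| ≤ 1 := by
  rw [cutoff, abs_of_nonneg unitBump.nonneg]
  exact unitBump.le_one

lemma cutoff_eq_one {n : ℕ} {x : Plane} (hx : ‖x‖ ≤ n + 1) : cutoff n x = 1 := by
  refine unitBump.one_of_mem_closedBall ?_
  rw [mem_closedBall_zero_iff, norm_smul, norm_inv, Real.norm_of_nonneg (by positivity)]
  exact inv_mul_le_one_of_le₀ hx (by positivity)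

lemma tendsto_cutoff (x : Plane) :
    Filter.Tendsto (fun n => cutoff n x) Filter.atTop (nhds 1) := by
  refine tendsto_const_nhds.congr' ?_
  filter_upwards [Filter.eventually_ge_atTop ⌈‖x‖⌉₊] with n hn
  exact (cutoff_eq_one ((Nat.ceil_le.1 hn).trans (by linarith))).symm

/-- The dilation in `cutoff` contributes the factor `1/(n+1)`, which makes the cutoff term of the
Leibniz rule vanish in `L²`. -/
lemma exists_abs_pderiv_cutoff_le :
    ∃ C : ℝ, 0 ≤ C ∧ ∀ n i x, |pderiv i (cutoff n) x| ≤ C * (1 / ((n : ℝ) + 1)) := by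
  have hc : ∀ i, Continuous (pderiv i unitBump) := fun i =>
    (ContDiff.pderiv (m := 0) (n := 1) unitBump.contDiff (by norm_num) i).continuous
  have hb := fun i => (HasCompactSupport.pderiv unitBump.hasCompactSupport i
    ).exists_bound_of_continuous (hc i)
  choose C hC using hb
  refine ⟨max (C 0) (C 1), ((norm_nonneg _).trans (hC 0 0)).trans (le_max_left _ _),
    fun n i x => ?_⟩
  have h1 : pderiv i (cutoff n) x = ((n : ℝ) + 1)⁻¹ * pderiv i unitBump (((n : ℝ) + 1)⁻¹ • x) := by
    have hd : Differentiable ℝ (unitBump : Plane → ℝ) :=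
      (unitBump.contDiff (n := 1)).differentiable one_ne_zero
    have h := (hd (((n : ℝ) + 1)⁻¹ • x)).hasFDerivAt.comp x
      ((hasFDerivAt_id x).const_smul ((n : ℝ) + 1)⁻¹)
    refine (pderiv_eq_of_hasFDerivAt h i).trans ?_
    simp [pderiv]
  have h2 : |pderiv i unitBump (((n : ℝ) + 1)⁻¹ • x)| ≤ max (C 0) (C 1) := by
    refine (hC i _).trans ?_
    fin_cases i
    exacts [le_max_left _ _, le_max_right _ _]
  rw [h1, abs_mul, abs_of_nonneg (by positivity), mul_comm, one_div]
  gcongr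

lemma pderiv_mul_smul {ζ : Plane → ℝ} {v : Plane → ℂ} (hζ : Differentiable ℝ ζ)
    (hv : Differentiable ℝ v) (i : Fin 2) (x : Plane) :
    pderiv i (fun x => ζ x • v x) x = ζ x • pderiv i v x + pderiv i ζ x • v x := by
  have h := (hζ x).hasFDerivAt.smul (hv x).hasFDerivAt
  refine (pderiv_eq_of_hasFDerivAt h i).trans ?_
  simp [pderiv]

/-- The translated and reflected kernel `t ↦ ψ(x - t)` is itself a test function in the definition
of the weak derivative. -/
lemma HasH1Gradient.pderiv_moll_mollifier {u : Plane → ℂ} {Du : Fin 2 → Plane → ℂ}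
    (hu : HasH1Gradient u Du) (n : ℕ) (i : Fin 2) :
    pderiv i (moll (mollifier n) u) = moll (mollifier n) (Du i) := by
  have hul : LocallyIntegrable u := hu.memLp.locallyIntegrable (by norm_num)
  rw [pderiv_moll (contDiff_mollifier n) (hasCompactSupport_mollifier n) hul]
  ext x
  have h := hu.weak_deriv i _ (isTestFunction_comp_const_sub (contDiff_mollifier n)
    (hasCompactSupport_mollifier n) x)
  simp only [partialDeriv_eq,
    pderiv_comp_const_sub ((contDiff_mollifier n).differentiable (by simp)), Complex.ofReal_neg,
    neg_mul, integral_neg, neg_inj, ← Complex.real_smul] at h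
  rw [moll_apply', moll_apply', h]

/-- Smooth functions with compact support are dense in the Sobolev space, with convergence almost
everywhere of the approximating sequence. -/
lemma HasH1Gradient.exists_approx {u : Plane → ℂ} {Du : Fin 2 → Plane → ℂ}
    (hu : HasH1Gradient u Du) : ∃ w : ℕ → Plane → ℂ,
      (∀ n, ContDiff ℝ ∞ (w n)) ∧ (∀ n, HasCompactSupport (w n)) ∧
      (∀ᵐ x, Filter.Tendsto (fun n => w n x) Filter.atTop (nhds (u x))) ∧
      Filter.Tendsto (fun n => ∫ x, ‖w n x - u x‖ ^ 2) Filter.atTop (nhds 0) ∧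
      ∀ i, Filter.Tendsto (fun n => ∫ x, ‖pderiv i (w n) x - Du i x‖ ^ 2) Filter.atTop
        (nhds 0) := by
  have hmul : ∀ (f : Plane → ℂ), MemLp f 2 → ∀ n,
      MemLp (fun x => cutoff n x • moll (mollifier n) f x) 2 ∧
      ∫ x, ‖cutoff n x • moll (mollifier n) f x‖ ^ 2 ≤ ∫ x, ‖f x‖ ^ 2 := fun f hf n => by
    have hm := memLp_moll n hf
    have hle : ∀ x, ‖cutoff n x • moll (mollifier n) f x‖ ≤ ‖moll (mollifier n) f x‖ := fun x => by
      rw [norm_smul]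
      exact mul_le_of_le_one_left (norm_nonneg _) (abs_cutoff_le_one n x)
    have hmm : MemLp (fun x => cutoff n x • moll (mollifier n) f x) 2 :=
      hm.1.of_le ((contDiff_cutoff n).continuous.aestronglyMeasurable.smul hm.1.1)
        (.of_forall hle)
    refine ⟨hmm, (integral_mono (integrable_norm_sq hmm) (integrable_norm_sq hm.1)
      fun x => ?_).trans hm.2⟩
    dsimp only
    gcongr
    exact hle x
  have hconv : ∀ (f : Plane → ℂ), MemLp f 2 → ∀ᵐ x, Filter.Tendsto
      (fun n => cutoff n x • moll (mollifier n) f x) Filter.atTop (nhds (f x)) := fun f hf => by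
    filter_upwards [tendsto_moll (hf.locallyIntegrable (by norm_num))] with x hx
    simpa using (tendsto_cutoff x).smul hx
  have hL2 : ∀ (f : Plane → ℂ), MemLp f 2 → Filter.Tendsto
      (fun n => ∫ x, ‖cutoff n x • moll (mollifier n) f x - f x‖ ^ 2) Filter.atTop (nhds 0) :=
    fun f hf => tendsto_integral_norm_sub_sq hf (fun n => (hmul f hf n).1)
      (fun n => (hmul f hf n).2) (hconv f hf)
  have hsm : ∀ n, ContDiff ℝ ∞ (moll (mollifier n) u) := fun n =>
    contDiff_moll (contDiff_mollifier n) (hasCompactSupport_mollifier n)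
      (hu.memLp.locallyIntegrable (by norm_num))
  refine ⟨fun n x => cutoff n x • moll (mollifier n) u x, fun n => (contDiff_cutoff n).smul (hsm n),
    fun n => (hasCompactSupport_cutoff n).smul_right, hconv u hu.memLp, hL2 u hu.memLp,
    fun i => ?_⟩
  obtain ⟨C, hC0, hC⟩ := exists_abs_pderiv_cutoff_le
  set b := ∫ x, ‖u x‖ ^ 2
  -- The two terms of the Leibniz rule: the truncated mollification of `Du i` converges in `L²`, and
  -- the derivative of the cutoff has size `C/(n+1)`.
  have hlim : Filter.Tendsto (fun n : ℕ =>
      2 * (∫ x, ‖cutoff n x • moll (mollifier n) (Du i) x - Du i x‖ ^ 2) +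
        2 * ((C * (1 / ((n : ℝ) + 1))) ^ 2 * b)) Filter.atTop (nhds 0) := by
    have h1 := (hL2 (Du i) (hu.memLp_grad i)).const_mul 2
    have h2 := ((((tendsto_one_div_add_atTop_nhds_zero_nat (𝕜 := ℝ)).const_mul C).pow 2).mul_const
      b).const_mul 2
    simpa using h1.add h2
  refine squeeze_zero (fun n => integral_nonneg fun x => by positivity) (fun n => ?_) hlim
  have hm := memLp_moll n hu.memLp
  have i1 : Integrable fun x => ‖cutoff n x • moll (mollifier n) (Du i) x - Du i x‖ ^ 2 :=
    integrable_norm_sq ((hmul _ (hu.memLp_grad i) n).1.sub (hu.memLp_grad i))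
  have i2 := integrable_norm_sq hm.1
  have hpd : ∀ x, pderiv i (fun x => cutoff n x • moll (mollifier n) u x) x =
      cutoff n x • moll (mollifier n) (Du i) x + pderiv i (cutoff n) x • moll (mollifier n) u x :=
    fun x => by
      rw [pderiv_mul_smul ((contDiff_cutoff n).differentiable (by simp))
        ((hsm n).differentiable (by simp)), hu.pderiv_moll_mollifier]
  calc ∫ x, ‖pderiv i (fun x => cutoff n x • moll (mollifier n) u x) x - Du i x‖ ^ 2
      ≤ ∫ x, (2 * ‖cutoff n x • moll (mollifier n) (Du i) x - Du i x‖ ^ 2 +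
          2 * ((C * (1 / ((n : ℝ) + 1))) ^ 2 * ‖moll (mollifier n) u x‖ ^ 2)) := by
        refine integral_mono_of_nonneg (.of_forall fun x => by positivity)
          ((i1.const_mul 2).add ((i2.const_mul _).const_mul 2)) (.of_forall fun x => ?_)
        dsimp only
        rw [hpd, add_sub_right_comm]
        have h1 := norm_add_le (cutoff n x • moll (mollifier n) (Du i) x - Du i x)
          (pderiv i (cutoff n) x • moll (mollifier n) u x)
        have h2 : ‖pderiv i (cutoff n) x • moll (mollifier n) u x‖ ≤
            C * (1 / ((n : ℝ) + 1)) * ‖moll (mollifier n) u x‖ := by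
          rw [norm_smul]
          gcongr
          exact hC n i x
        rw [← mul_pow]
        exact (pow_le_pow_left₀ (norm_nonneg _) (h1.trans (add_le_add_right h2 _)) 2).trans
          (by rw [← mul_add]; exact add_sq_le)
    _ = 2 * (∫ x, ‖cutoff n x • moll (mollifier n) (Du i) x - Du i x‖ ^ 2) +
          2 * ((C * (1 / ((n : ℝ) + 1))) ^ 2 * ∫ x, ‖moll (mollifier n) u x‖ ^ 2) := by
        rw [integral_add (i1.const_mul 2) ((i2.const_mul _).const_mul 2), integral_const_mul,
          integral_const_mul, integral_const_mul]
    _ ≤ _ := by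
        gcongr
        exact hm.2

/-- Fatou's lemma for nonnegative functions whose integrals are bounded by a convergent
sequence. -/
lemma integrable_of_tendsto_ae {g : Plane → ℝ} {G : ℕ → Plane → ℝ} {c : ℕ → ℝ} {l : ℝ}
    (hG : ∀ n, Integrable (G n)) (hG0 : ∀ n x, 0 ≤ G n x)
    (hlim : ∀ᵐ x, Filter.Tendsto (fun n => G n x) Filter.atTop (nhds (g x)))
    (hle : ∀ n, ∫ x, G n x ≤ c n) (hc : Filter.Tendsto c Filter.atTop (nhds l)) :
    Integrable g ∧ ∫ x, g x ≤ l := by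
  have hm : AEStronglyMeasurable g :=
    aestronglyMeasurable_of_tendsto_ae Filter.atTop (fun n => (hG n).aestronglyMeasurable) hlim
  have hg0 : 0 ≤ᵐ[volume] g := by
    filter_upwards [hlim] with x hx
    exact ge_of_tendsto' hx fun n => hG0 n x
  have hl : 0 ≤ l := ge_of_tendsto' hc fun n => (integral_nonneg (hG0 n)).trans (hle n)
  have key : ∫⁻ x, ENNReal.ofReal (g x) ≤ ENNReal.ofReal l := by
    have h1 : ∫⁻ x, ENNReal.ofReal (g x) = ∫⁻ x, Filter.liminf
        (fun n => ENNReal.ofReal (G n x)) Filter.atTop := by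
      refine lintegral_congr_ae ?_
      filter_upwards [hlim] with x hx
      exact ((ENNReal.continuous_ofReal.tendsto _).comp hx).liminf_eq.symm
    have h2 : Filter.Tendsto (fun n => ENNReal.ofReal (c n)) Filter.atTop
        (nhds (ENNReal.ofReal l)) := (ENNReal.continuous_ofReal.tendsto _).comp hc
    rw [h1, ← h2.liminf_eq]
    refine (lintegral_liminf_le' fun n => (hG n).aestronglyMeasurable.aemeasurable.ennreal_ofReal
      ).trans (Filter.liminf_le_liminf (.of_forall fun n => ?_))
    rw [← ofReal_integral_eq_lintegral_ofReal (hG n) (.of_forall (hG0 n))]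
    exact ENNReal.ofReal_le_ofReal (hle n)
  have hi : Integrable g :=
    ⟨hm, (hasFiniteIntegral_iff_ofReal hg0).2 (key.trans_lt ENNReal.ofReal_lt_top)⟩
  refine ⟨hi, ?_⟩
  rw [← ofReal_integral_eq_lintegral_ofReal hi hg0] at key
  exact (ENNReal.ofReal_le_ofReal_iff hl).1 key

/-! ### Passing to the limit in the Pauli form -/

lemma norm_sub_sq_le (a b c : ℂ) : ‖a - b‖ ^ 2 ≤ 2 * ‖a - c‖ ^ 2 + 2 * ‖b - c‖ ^ 2 := by
  have h : ‖a - b‖ ≤ ‖a - c‖ + ‖b - c‖ := by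
    rw [← sub_sub_sub_cancel_right a b c]
    exact norm_sub_le _ _
  rw [← mul_add]
  exact (pow_le_pow_left₀ (norm_nonneg _) h 2).trans add_sq_le

lemma integral_norm_sub_sq_le {f g h : Plane → ℂ} (hf : MemLp f 2) (hg : MemLp g 2)
    (hh : MemLp h 2) :
    ∫ x, ‖f x - g x‖ ^ 2 ≤ 2 * (∫ x, ‖f x - h x‖ ^ 2) + 2 * ∫ x, ‖g x - h x‖ ^ 2 := by
  have i1 : Integrable fun x => ‖f x - g x‖ ^ 2 := integrable_norm_sq (hf.sub hg)
  have i2 : Integrable fun x => ‖f x - h x‖ ^ 2 := integrable_norm_sq (hf.sub hh)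
  have i3 : Integrable fun x => ‖g x - h x‖ ^ 2 := integrable_norm_sq (hg.sub hh)
  rw [← integral_const_mul, ← integral_const_mul,
    ← integral_add (i2.const_mul 2) (i3.const_mul 2)]
  exact integral_mono i1 ((i2.const_mul 2).add (i3.const_mul 2)) fun x => norm_sub_sq_le _ _ _

/-- Convergence in the Sobolev space implies convergence in the space weighted with the magnetic
field. -/
lemma IsIntegrableField.tendsto_integral_abs_mul {B : Plane → ℝ} (hB : IsIntegrableField B)
    {u : Plane → ℂ} {Du : Fin 2 → Plane → ℂ} (hu : HasH1Gradient u Du) {w : ℕ → Plane → ℂ}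
    (hw : ∀ n, ContDiff ℝ ∞ (w n)) (hwc : ∀ n, HasCompactSupport (w n))
    (hae : ∀ᵐ x, Filter.Tendsto (fun n => w n x) Filter.atTop (nhds (u x)))
    (h0 : Filter.Tendsto (fun n => ∫ x, ‖w n x - u x‖ ^ 2) Filter.atTop (nhds 0))
    (h1 : ∀ i, Filter.Tendsto (fun n => ∫ x, ‖pderiv i (w n) x - Du i x‖ ^ 2) Filter.atTop
      (nhds 0)) :
    Integrable (fun x => |B x| * ‖u x‖ ^ 2) ∧
    (∀ n, Integrable fun x => |B x| * ‖w n x - u x‖ ^ 2) ∧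
    Filter.Tendsto (fun n => ∫ x, |B x| * ‖w n x - u x‖ ^ 2) Filter.atTop (nhds 0) := by
  obtain ⟨C, hC0, hC⟩ := hB.exists_integral_abs_mul_le
  have mw : ∀ n, MemLp (w n) 2 := fun n => (hw n).continuous.memLp_of_hasCompactSupport (hwc n)
  have mpw : ∀ n i, MemLp (pderiv i (w n)) 2 := fun n i =>
    (ContDiff.pderiv (m := 0) (hw n) (by norm_num) i).continuous.memLp_of_hasCompactSupport
      (HasCompactSupport.pderiv (hwc n) i)
  set E : ℕ → ℝ := fun n => energy (fun x => w n x - u x) (fun i x => pderiv i (w n) x - Du i x)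
    with hE
  have hE0 : Filter.Tendsto E Filter.atTop (nhds 0) := by
    simpa [hE, energy] using h0.add ((h1 0).add (h1 1))
  -- The form bound is known only for smooth functions, so it is applied to differences `w n - w m`;
  -- Fatou's lemma as `m → ∞` then replaces `w m` by `u`.
  have hdiff : ∀ n m, Integrable (fun x => |B x| * ‖w n x - w m x‖ ^ 2) ∧
      ∫ x, |B x| * ‖w n x - w m x‖ ^ 2 ≤ C * (2 * E n + 2 * E m) := fun n m => by
    obtain ⟨hi, hle⟩ := hC (fun x => w n x - w m x) ((hw n).sub (hw m)) ((hwc n).sub (hwc m))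
    refine ⟨hi, hle.trans (mul_le_mul_of_nonneg_left ?_ hC0)⟩
    have hp : ∀ i x, pderiv i (fun x => w n x - w m x) x = pderiv i (w n) x - pderiv i (w m) x :=
      fun i x => pderiv_eq_of_hasFDerivAt
        ((((hw n).differentiable (by simp)) x).hasFDerivAt.sub
          (((hw m).differentiable (by simp)) x).hasFDerivAt) i
    simp only [hE, energy, hp]
    linarith [integral_norm_sub_sq_le (mw n) (mw m) hu.memLp,
      integral_norm_sub_sq_le (mpw n 0) (mpw m 0) (hu.memLp_grad 0),
      integral_norm_sub_sq_le (mpw n 1) (mpw m 1) (hu.memLp_grad 1)]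
  have hlim : ∀ n, Integrable (fun x => |B x| * ‖w n x - u x‖ ^ 2) ∧
      ∫ x, |B x| * ‖w n x - u x‖ ^ 2 ≤ C * (2 * E n) := fun n => by
    refine integrable_of_tendsto_ae (fun m => (hdiff n m).1) (fun m x => by positivity) ?_
      (fun m => (hdiff n m).2) (by simpa using ((hE0.const_mul 2).const_add (2 * E n)).const_mul C)
    filter_upwards [hae] with x hx
    exact ((hx.const_sub (w n x)).norm.pow 2).const_mul _
  refine ⟨?_, fun n => (hlim n).1, squeeze_zero (fun n => integral_nonneg fun x => by positivity)
    (fun n => (hlim n).2) ?_⟩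
  · refine (((hC (w 0) (hw 0) (hwc 0)).1.const_mul 2).add ((hlim 0).1.const_mul 2)).mono'
      (hB.integrable.aestronglyMeasurable.norm.mul (hu.memLp.1.norm.pow 2))
      (.of_forall fun x => ?_)
    have h := mul_le_mul_of_nonneg_left (norm_sub_sq_le (u x) 0 (w 0 x)) (abs_nonneg (B x))
    rw [sub_zero, zero_sub, norm_neg, norm_sub_rev] at h
    simp only [Pi.add_apply, norm_mul, norm_pow, Real.norm_eq_abs, abs_abs, abs_norm]
    linarith
  · simpa using (hE0.const_mul 2).const_mul C

lemma integrable_pauliPlusDensity {A : Plane → Plane} (hA : MemLp A ∞ volume) {B : Plane → ℝ}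
    {u : Plane → ℂ} {Du : Fin 2 → Plane → ℂ} (hu : MemLp u 2) (hDu : ∀ i, MemLp (Du i) 2)
    (hBu : Integrable fun x => B x * ‖u x‖ ^ 2) :
    Integrable (pauliPlusDensity A B u Du) ∧
    pauliPlusForm A B u Du = (∑ j, ∫ x, ‖Complex.I * Du j x + (A x j : ℂ) * u x‖ ^ 2) +
      ∫ x, B x * ‖u x‖ ^ 2 := by
  have h : ∀ j ∈ Finset.univ, Integrable fun x => ‖Complex.I * Du j x + (A x j : ℂ) * u x‖ ^ 2 :=
    fun j _ => integrable_norm_sq (memLp_magnetic hA hu (hDu j) j)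
  have hs := integrable_finsetSum _ h
  refine ⟨hs.add hBu, ?_⟩
  unfold pauliPlusForm pauliPlusDensity
  rw [integral_add hs hBu, integral_finsetSum _ h]

/-- As `A` is bounded, `(u, v) ↦ i v + A_j u` is a bounded map on `L²`. -/
lemma tendsto_integral_magnetic {A : Plane → Plane} (hA : MemLp A ∞ volume) {u v : Plane → ℂ}
    {w z : ℕ → Plane → ℂ} (hu : MemLp u 2) (hv : MemLp v 2) (hw : ∀ n, MemLp (w n) 2)
    (hz : ∀ n, MemLp (z n) 2)
    (hwu : Filter.Tendsto (fun n => ∫ x, ‖w n x - u x‖ ^ 2) Filter.atTop (nhds 0))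
    (hzv : Filter.Tendsto (fun n => ∫ x, ‖z n x - v x‖ ^ 2) Filter.atTop (nhds 0)) (j : Fin 2) :
    Filter.Tendsto (fun n => ∫ x, ‖Complex.I * z n x + (A x j : ℂ) * w n x‖ ^ 2) Filter.atTop
      (nhds (∫ x, ‖Complex.I * v x + (A x j : ℂ) * u x‖ ^ 2)) := by
  obtain ⟨C, hC0, hC⟩ := exists_bound_component hA
  have mf := memLp_magnetic hA hu hv j
  have mF := fun n => memLp_magnetic hA (hw n) (hz n) j
  have md : ∀ n, Integrable fun x => ‖(Complex.I * z n x + (A x j : ℂ) * w n x) -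
      (Complex.I * v x + (A x j : ℂ) * u x)‖ ^ 2 := fun n => integrable_norm_sq ((mF n).sub mf)
  have iw : ∀ n, Integrable fun x => ‖w n x - u x‖ ^ 2 := fun n =>
    integrable_norm_sq ((hw n).sub hu)
  have iz : ∀ n, Integrable fun x => ‖z n x - v x‖ ^ 2 := fun n =>
    integrable_norm_sq ((hz n).sub hv)
  have := tendsto_integral_mul_norm_sq (w := fun _ => 1) aestronglyMeasurable_const mf.1
    (fun n => (mF n).1) (by simpa using integrable_norm_sq mf) (by simpa using md) ?_
  · simpa using this
  simp only [abs_one, one_mul]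
  refine squeeze_zero (g := fun n => 2 * (∫ x, ‖z n x - v x‖ ^ 2) +
    2 * (C ^ 2 * ∫ x, ‖w n x - u x‖ ^ 2)) (fun n => integral_nonneg fun x => by positivity)
    (fun n => ?_) ?_
  · rw [← integral_const_mul, ← integral_const_mul, ← integral_const_mul,
      ← integral_add ((iz n).const_mul 2) (((iw n).const_mul _).const_mul 2)]
    refine integral_mono_ae (md n) (((iz n).const_mul 2).add (((iw n).const_mul _).const_mul 2)) ?_
    filter_upwards [hC] with x hx
    have h1 : (Complex.I * z n x + (A x j : ℂ) * w n x) - (Complex.I * v x + (A x j : ℂ) * u x) =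
        Complex.I * (z n x - v x) + (A x j : ℂ) * (w n x - u x) := by ring
    have h2 : ‖Complex.I * (z n x - v x) + (A x j : ℂ) * (w n x - u x)‖ ≤
        ‖z n x - v x‖ + C * ‖w n x - u x‖ := by
      refine (norm_add_le _ _).trans ?_
      rw [norm_mul, norm_mul, Complex.norm_I, one_mul, Complex.norm_real]
      gcongr
      exact hx j
    rw [h1, ← mul_pow, ← mul_add]
    exact (pow_le_pow_left₀ (norm_nonneg _) h2 2).trans add_sq_le
  · simpa using (hzv.const_mul 2).add ((hwu.const_mul (C ^ 2)).const_mul 2)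

lemma inv_add_norm_sq_le {ρ : ℝ} (hρ : 0 < ρ) (x : Plane) :
    |(ρ ^ 2 + ‖x‖ ^ 2)⁻¹| ≤ (ρ ^ 2)⁻¹ := by
  rw [abs_of_nonneg (by positivity)]
  exact inv_anti₀ (by positivity) (by linarith [sq_nonneg ‖x‖])

lemma continuous_inv_add_norm_sq {ρ : ℝ} (hρ : 0 < ρ) :
    Continuous fun x : Plane => (ρ ^ 2 + ‖x‖ ^ 2)⁻¹ :=
  Continuous.inv₀ (by fun_prop) fun x => by positivity

lemma integrable_hardy_weight {ρ : ℝ} (hρ : 0 < ρ) {u : Plane → ℂ} (hu : MemLp u 2) :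
    Integrable fun x => |(ρ ^ 2 + ‖x‖ ^ 2)⁻¹| * ‖u x‖ ^ 2 :=
  (integrable_norm_sq hu).bdd_mul (continuous_inv_add_norm_sq hρ).abs.aestronglyMeasurable
    (.of_forall fun x => by rw [Real.norm_eq_abs, abs_abs]; exact inv_add_norm_sq_le hρ x)

lemma tendsto_integral_hardy_weight {ρ : ℝ} (hρ : 0 < ρ) {u : Plane → ℂ} {w : ℕ → Plane → ℂ}
    (hu : MemLp u 2) (hw : ∀ n, MemLp (w n) 2)
    (hwu : Filter.Tendsto (fun n => ∫ x, ‖w n x - u x‖ ^ 2) Filter.atTop (nhds 0)) :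
    Filter.Tendsto (fun n => ∫ x, ‖w n x‖ ^ 2 / (ρ ^ 2 + ‖x‖ ^ 2)) Filter.atTop
      (nhds (∫ x, ‖u x‖ ^ 2 / (ρ ^ 2 + ‖x‖ ^ 2))) := by
  have iw : ∀ n, Integrable fun x => ‖w n x - u x‖ ^ 2 := fun n =>
    integrable_norm_sq ((hw n).sub hu)
  have idw : ∀ n, Integrable fun x => |(ρ ^ 2 + ‖x‖ ^ 2)⁻¹| * ‖w n x - u x‖ ^ 2 := fun n =>
    integrable_hardy_weight hρ ((hw n).sub hu)
  simp only [div_eq_inv_mul]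
  refine tendsto_integral_mul_norm_sq (continuous_inv_add_norm_sq hρ).aestronglyMeasurable
    hu.1 (fun n => (hw n).1) (integrable_hardy_weight hρ hu) idw ?_
  refine squeeze_zero (g := fun n => (ρ ^ 2)⁻¹ * ∫ x, ‖w n x - u x‖ ^ 2)
    (fun n => integral_nonneg fun x => by positivity) (fun n => ?_)
    (by simpa using hwu.const_mul (ρ ^ 2)⁻¹)
  rw [← integral_const_mul]
  refine integral_mono (idw n) ((iw n).const_mul _) fun x => ?_
  exact mul_le_mul_of_nonneg_right (inv_add_norm_sq_le hρ x) (by positivity)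

/-- The Hardy inequality for the Pauli form on the Sobolev space. -/
lemma hardy_pauliPlusForm {B : Plane → ℝ} (hB : IsIntegrableField B) (hflux : 0 < flux B)
    {A : Plane → Plane} (hA : MemLp A ∞ volume) (hcurl : HasDistribCurl A B)
    {ρ : ℝ} (hρ : 0 < ρ) {u : Plane → ℂ} {Du : Fin 2 → Plane → ℂ} (hu : HasH1Gradient u Du) :
    Integrable (pauliPlusDensity A B u Du) ∧
    distInt (flux B) ^ 2 * betaPlus B ρ * (∫ x, ‖u x‖ ^ 2 / (ρ ^ 2 + ‖x‖ ^ 2)) ≤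
      pauliPlusForm A B u Du := by
  obtain ⟨w, hw, hwc, hae, h0, h1⟩ := hu.exists_approx
  obtain ⟨ibu, ibw, hbw⟩ := hB.tendsto_integral_abs_mul hu hw hwc hae h0 h1
  have mw : ∀ n, MemLp (w n) 2 := fun n => (hw n).continuous.memLp_of_hasCompactSupport (hwc n)
  have mpw : ∀ n i, MemLp (pderiv i (w n)) 2 := fun n i =>
    (ContDiff.pderiv (m := 0) (hw n) (by norm_num) i).continuous.memLp_of_hasCompactSupport
      (HasCompactSupport.pderiv (hwc n) i)
  have mB := hB.integrable.aestronglyMeasurable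
  obtain ⟨C, -, hC⟩ := hB.exists_integral_abs_mul_le
  have hform : ∀ {v : Plane → ℂ} {Dv : Fin 2 → Plane → ℂ}, MemLp v 2 → (∀ i, MemLp (Dv i) 2) →
      Integrable (fun x => |B x| * ‖v x‖ ^ 2) → _ := fun {v Dv} mv mdv hv =>
    integrable_pauliPlusDensity hA mv mdv (hv.mono (mB.mul (mv.1.norm.pow 2))
      (.of_forall fun x => by simp))
  obtain ⟨hden, hfu⟩ := hform hu.memLp hu.memLp_grad ibu
  refine ⟨hden, ?_⟩
  have hlim : Filter.Tendsto (fun n => pauliPlusForm A B (w n) fun i => pderiv i (w n))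
      Filter.atTop (nhds (pauliPlusForm A B u Du)) := by
    rw [hfu]
    refine Filter.Tendsto.congr
      (fun n => (hform (mw n) (mpw n) (hC _ (hw n) (hwc n)).1).2.symm) ?_
    exact (tendsto_finsetSum _ fun j _ => tendsto_integral_magnetic hA hu.memLp (hu.memLp_grad j)
      mw (fun n => mpw n j) h0 (h1 j) j).add
      (tendsto_integral_mul_norm_sq mB hu.memLp.1 (fun n => (mw n).1) ibu ibw hbw)
  -- Both sides converge along the smooth approximations, where `pauliPlusForm_eq` and
  -- `hardy_dbarOp_rough` give the inequality.
  refine le_of_tendsto_of_tendsto'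
    ((tendsto_integral_hardy_weight hρ hu.memLp mw h0).const_mul _) hlim fun n => ?_
  rw [pauliPlusForm_eq hB.integrable hA hcurl (hw n) (hwc n)]
  exact hardy_dbarOp_rough hB hflux hA hcurl hρ (hw n) (hwc n)

end PauliHardy

/-- Real suprema of unbounded families and integrals of nonintegrable functions have default value
`0`, so finiteness of `K₊` is expressed by `BddAbove`, and absolute convergence by separate
`Integrable` clauses. -/
theorem theorem2p2 (B : PauliHardy.Plane → ℝ) (hB : PauliHardy.FieldAssumption B)
    (hflux_pos : 0 < PauliHardy.flux B) (hflux_int : ∀ m : ℤ, PauliHardy.flux B ≠ (m : ℝ))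
    (A : PauliHardy.Plane → PauliHardy.Plane) (hA : MemLp A ∞ volume)
    (hcurl : PauliHardy.HasDistribCurl A B) :
    -- the potential, the constants and the integrals below are well defined,
    (∀ x : PauliHardy.Plane, Integrable (fun y => B y * Real.log ‖x - y‖) volume) ∧
    ∀ ρ : ℝ, 0 < ρ →
      (0 < PauliHardy.kPlus B ρ ∧ BddAbove (Set.range (PauliHardy.ratioPlus B ρ))) ∧
      ∀ (u : PauliHardy.Plane → ℂ) (Du : Fin 2 → PauliHardy.Plane → ℂ),
        PauliHardy.HasH1Gradient u Du →
        Integrable (PauliHardy.pauliPlusDensity A B u Du) volume ∧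
        Integrable (fun x => ‖u x‖ ^ 2 / (ρ ^ 2 + ‖x‖ ^ 2)) volume ∧
        -- and the Hardy inequality holds.
        PauliHardy.distInt (PauliHardy.flux B) ^ 2 * PauliHardy.betaPlus B ρ *
            ∫ x, ‖u x‖ ^ 2 / (ρ ^ 2 + ‖x‖ ^ 2)
          ≤ PauliHardy.pauliPlusForm A B u Du := by
  have hB' := hB.isIntegrableField
  refine ⟨hB'.integrable_mul_log_norm_sub, fun ρ hρ => ⟨⟨hB'.kPlus_pos hρ,
    hB'.bddAbove_ratioPlus hρ⟩, fun u Du hu => ?_⟩⟩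
  obtain ⟨h1, h2⟩ := PauliHardy.hardy_pauliPlusForm hB' hflux_pos hA hcurl hρ hu
  refine ⟨h1, (PauliHardy.integrable_hardy_weight hρ hu.memLp).congr (.of_forall fun x => ?_), h2⟩
  dsimp only
  rw [abs_of_nonneg (by positivity), div_eq_inv_mul]
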